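/- Let $N$ be a closed connected smooth manifold, $q:\widetilde N\to N$ its universal cover, and $\varphi_t$ a smooth Anosov flow on $N$. Let $G$ be a (finite-dimensional) Lie group with Lie algebra $\mathfrak g$, let $\pi:P\to N$ be a smooth principal $G$-bundle, and let $\Phi_t$ be a smooth principal extension of $\varphi_t$ to $P$: a smooth flow on $P$ with $\pi\circ\Phi_t=\varphi_t\circ\pi$ and $\Phi_t(u\cdot a)=\Phi_t(u)\cdot a$ for all $a\in G$. Let $X$ be the generator of $\Phi_t$ and $\mathbb V=\ker d\pi$. Assume that $\Phi_t$ is partially hyperbolic with center $E_c=\mathbb RX\oplus\mathbb V$; that is, for some right-invariant Riemannian metric on $P$ there is a $d\Phi_t$-invariant decomposition $TP=E_s\oplus E_c\oplus E_u$ such that, uniformly on $P$, $E_s$ (resp. $E_u$) is exponentially contracted in forward (resp. backward) time, exponentially more than any central vector. (For instance, this is the case for isometric extensions, with $G$ compact.) The dynamical horizontal distribution is $\mathbb H=E_s\oplus E_u\oplus\mathbb RX$, and the dynamical connection form is the $\mathfrak g$-valued 1-form $\Theta$ on $P$ with $\Theta|_{\mathbb H}=0$ and $\Theta(A^*)=A$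 for every $A\in\mathfrak g$, where $A^*$ is the fundamental vector field of $A$. Assume that $\Theta$ is of class $\mathcal C^1$. Let $\Omega(Y,Z)=d\Theta(Y,Z)+[\Theta(Y),\Theta(Z)]$, and let the dynamical curvature $\omega$ be the induced 2-form on $N$ with values in $\mathrm{Ad}(P)$: for $u\in P$ and $y,z\in T_{\pi(u)}N$ with $\Theta$-horizontal lifts $\tilde y,\tilde z\in T_uP$, $\omega(y,z)=[u,\Omega_u(\tilde y,\tilde z)]$. Then the following are equivalent: 1. the distribution $\mathbb H$ is integrable, i.e. through every point of $P$ there passes a ($\mathcal C^1$, immersed) integral manifold of $\mathbb H$; 2. the dynamical curvature $\omega$ vanishes; 3. the flow $\Phi_t$ is flat: there is a representation $\rho:\pi_1(N)\to G$ such that, with $\pi_1(N)$ acting on $\widetilde N\times G$ by $\gamma\cdot(x,a)=(\gamma x,\rho(\gamma)a)$ (where $\gamma x$ is the action by deck transformations) and $\tilde\varphi_t$ the lift of $\varphi_t$ to $\widetilde N$, the flow $(x,a)\mapsto(\tilde\varphi_t(x),a)$ on $\widetilde N\times G$ descends to a flow on $\widetilde N\times_\rho G=(\widetilde N\times G)/\pi_1(N)$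 which is conjugate to $(P,\Phi_t)$ by a $\mathcal C^1$ isomorphism of principal $G$-bundles over the identity of $N$. -/

import Mathlib

open scoped Manifold ContDiff

noncomputable section

/-! ## Linear algebra, flows and metrics -/

/-- `V = A ⊕ B ⊕ C` (internal direct sum). -/
def IsInternalTriple {V : Type*} [AddCommGroup V] [Module ℝ V] (A B C : Submodule ℝ V) : Prop :=
  Disjoint A B ∧ IsCompl (A ⊔ B) C

section Flows

variable {E : Type*} [NormedAddCommGroup E] [NormedSpace ℝ E]
  {M : Type*} [TopologicalSpace M] [ChartedSpace E M]

/-- The flow is smooth, jointly in time and space. -/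
def IsSmoothFlow (φ : Flow ℝ M) : Prop :=
  ContMDiff (𝓘(ℝ, ℝ).prod 𝓘(ℝ, E)) 𝓘(ℝ, E) ∞ (fun p : ℝ × M => φ p.1 p.2)

/-- The generator of a flow: `X x = d/dt φ_t(x)` at `t = 0`. -/
def flowGenerator (φ : Flow ℝ M) (x : M) : TangentSpace 𝓘(ℝ, E) x :=
  (mfderiv 𝓘(ℝ, ℝ) 𝓘(ℝ, E) (fun t : ℝ => φ t x) 0 : ℝ → E) 1

/-- The differential `dφ_t` at `x`. -/
def flowDeriv (φ : Flow ℝ M) (t : ℝ) (x : M) :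
    TangentSpace 𝓘(ℝ, E) x →L[ℝ] TangentSpace 𝓘(ℝ, E) (φ t x) :=
  mfderiv 𝓘(ℝ, E) 𝓘(ℝ, E) (φ t) x

/-- A (continuous) Riemannian metric on a manifold. -/
abbrev RiemMetric (E : Type*) [NormedAddCommGroup E] [NormedSpace ℝ E]
    (M : Type*) [TopologicalSpace M] [ChartedSpace E M] [IsManifold 𝓘(ℝ, E) ∞ M] :=
  haveI : IsManifold 𝓘(ℝ, E) 1 M := IsManifold.of_le (n := ∞) (by norm_cast)
  Bundle.ContinuousRiemannianMetric E (fun x : M => TangentSpace 𝓘(ℝ, E) x)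

/-- The norm of a tangent vector. -/
def RiemMetric.nrm [IsManifold 𝓘(ℝ, E) ∞ M] (g : RiemMetric E M) {x : M}
    (v : TangentSpace 𝓘(ℝ, E) x) : ℝ :=
  Real.sqrt (g.inner x v v)

/-- `φ` is an Anosov flow: its generator has no zeros and there is a `dφ_t`-invariant decomposition
`TM = ℝX ⊕ E_s ⊕ E_u`, with `E_s` exponentially contracted in forward time and `E_u` exponentially
contracted in backward time. (Such a decomposition is unique and automatically continuous.) -/
def IsAnosov [IsManifold 𝓘(ℝ, E) ∞ M] (φ : Flow ℝ M) : Prop :=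
  IsSmoothFlow (E := E) φ ∧ (∀ x, flowGenerator (E := E) φ x ≠ 0) ∧
  ∃ (g : RiemMetric E M) (Es Eu : ∀ x : M, Submodule ℝ (TangentSpace 𝓘(ℝ, E) x)),
    (∀ x, IsInternalTriple (Submodule.span ℝ {flowGenerator φ x}) (Es x) (Eu x)) ∧
    (∀ t x, ∀ v ∈ Es x, flowDeriv φ t x v ∈ Es (φ t x)) ∧
    (∀ t x, ∀ v ∈ Eu x, flowDeriv φ t x v ∈ Eu (φ t x)) ∧
    ∃ C c : ℝ, 0 < C ∧ 0 < c ∧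
      (∀ t, 0 ≤ t → ∀ x, ∀ v ∈ Es x,
        g.nrm (flowDeriv φ t x v) ≤ C * Real.exp (-c * t) * g.nrm v) ∧
      (∀ t, 0 ≤ t → ∀ x, ∀ v ∈ Eu x,
        g.nrm (flowDeriv φ (-t) x v) ≤ C * Real.exp (-c * t) * g.nrm v)

/-- A distribution `D` on `M` is integrable: through every point `u` there passes an integral
manifold, i.e. there is a `C¹` immersion `f` of a neighbourhood `W` of `0 ∈ ℝᵏ` with `f 0 = u` whose
tangent space at each `f w` is exactly `D (f w)`. -/
def IsIntegrableDistribution (D : ∀ u : M, Submodule ℝ (TangentSpace 𝓘(ℝ, E) u)) : Prop :=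
  ∀ u : M, ∃ (k : ℕ) (W : Set (EuclideanSpace ℝ (Fin k))) (f : EuclideanSpace ℝ (Fin k) → M),
    IsOpen W ∧ 0 ∈ W ∧ f 0 = u ∧
    ContMDiffOn 𝓘(ℝ, EuclideanSpace ℝ (Fin k)) 𝓘(ℝ, E) 1 f W ∧
    ∀ w ∈ W,
      Function.Injective (mfderiv 𝓘(ℝ, EuclideanSpace ℝ (Fin k)) 𝓘(ℝ, E) f w) ∧
      (mfderiv 𝓘(ℝ, EuclideanSpace ℝ (Fin k)) 𝓘(ℝ, E) f w).range = D (f w)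

/-- A 1-form with values in a fixed vector space `𝔤`, read in the preferred chart at `u`. -/
def oneFormInChart {𝔤 : Type*} [NormedAddCommGroup 𝔤] [NormedSpace ℝ 𝔤]
    (θ : ∀ u : M, TangentSpace 𝓘(ℝ, E) u →L[ℝ] 𝔤) (u : M) : E → (E →L[ℝ] 𝔤) := fun y =>
  (θ ((extChartAt 𝓘(ℝ, E) u).symm y)).comp
    (mfderiv 𝓘(ℝ, E) 𝓘(ℝ, E) (extChartAt 𝓘(ℝ, E) u).symm y)

/-- The exterior derivative of a vector-valued 1-form, `dθ(v, w) = (D_v θ)(w) - (D_w θ)(v)` in a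
chart. It is computed at `u` in the preferred chart at `u`, which is the chart through which
`TangentSpace 𝓘(ℝ, E) u` is identified with `E`. -/
def extDerivOneForm {𝔤 : Type*} [NormedAddCommGroup 𝔤] [NormedSpace ℝ 𝔤]
    (θ : ∀ u : M, TangentSpace 𝓘(ℝ, E) u →L[ℝ] 𝔤) (u : M) (v w : TangentSpace 𝓘(ℝ, E) u) : 𝔤 :=
  (fderiv ℝ (oneFormInChart θ u) (extChartAt 𝓘(ℝ, E) u u) : E → (E →L[ℝ] 𝔤)) v w -
    (fderiv ℝ (oneFormInChart θ u) (extChartAt 𝓘(ℝ, E) u u) : E → (E →L[ℝ] 𝔤)) w v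

end Flows

/-! ## Principal bundles and principal extensions -/

/-- A smooth principal `G`-bundle `P → N`, with a right action of `G` on `P`. -/
structure SmoothPrincipalBundle
    (EN : Type*) [NormedAddCommGroup EN] [NormedSpace ℝ EN]
    (EG : Type*) [NormedAddCommGroup EG] [NormedSpace ℝ EG]
    (EP : Type*) [NormedAddCommGroup EP] [NormedSpace ℝ EP]
    (N : Type*) [TopologicalSpace N] [ChartedSpace EN N]
    (G : Type*) [TopologicalSpace G] [ChartedSpace EG G] [Group G]
    (P : Type*) [TopologicalSpace P] [ChartedSpace EP P] where
  /-- The projection `π : P → N`. -/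
  proj : P → N
  /-- The right action `(u, a) ↦ u · a`. -/
  act : P → G → P
  contMDiff_proj : ContMDiff 𝓘(ℝ, EP) 𝓘(ℝ, EN) ∞ proj
  contMDiff_act :
    ContMDiff (𝓘(ℝ, EP).prod 𝓘(ℝ, EG)) 𝓘(ℝ, EP) ∞ (fun p : P × G => act p.1 p.2)
  act_one : ∀ u, act u 1 = u
  act_mul : ∀ u a b, act u (a * b) = act (act u a) b
  proj_act : ∀ u a, proj (act u a) = proj u
  /-- Local triviality: over an open set `U` around `x` there are a smooth section `s` and a smooth
  map `τ` such that `(y, a) ↦ s y · a` and `u ↦ (π u, τ u)` are inverse bijections between `U × G`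
  and `π⁻¹ U`. -/
  locally_trivial : ∀ x : N, ∃ (U : Set N) (s : N → P) (τ : P → G), IsOpen U ∧ x ∈ U ∧
    ContMDiffOn 𝓘(ℝ, EN) 𝓘(ℝ, EP) ∞ s U ∧
    ContMDiffOn 𝓘(ℝ, EP) 𝓘(ℝ, EG) ∞ τ (proj ⁻¹' U) ∧
    (∀ y ∈ U, proj (s y) = y) ∧
    (∀ u ∈ proj ⁻¹' U, act (s (proj u)) (τ u) = u) ∧
    (∀ y ∈ U, ∀ a, τ (act (s y) a) = a)

section Principal

variable {EN : Type*} [NormedAddCommGroup EN] [NormedSpace ℝ EN]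
  {EG : Type*} [NormedAddCommGroup EG] [NormedSpace ℝ EG]
  {EP : Type*} [NormedAddCommGroup EP] [NormedSpace ℝ EP]
  {N : Type*} [TopologicalSpace N] [ChartedSpace EN N]
  {G : Type*} [TopologicalSpace G] [ChartedSpace EG G] [Group G]
  {P : Type*} [TopologicalSpace P] [ChartedSpace EP P]

namespace SmoothPrincipalBundle

variable (B : SmoothPrincipalBundle EN EG EP N G P)

/-- The differential `dπ` at `u`. -/
def projDeriv (u : P) : TangentSpace 𝓘(ℝ, EP) u →L[ℝ] TangentSpace 𝓘(ℝ, EN) (B.proj u) :=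
  mfderiv 𝓘(ℝ, EP) 𝓘(ℝ, EN) B.proj u

/-- The vertical space `ker dπ` at `u`. -/
def vertical (u : P) : Submodule ℝ (TangentSpace 𝓘(ℝ, EP) u) := (B.projDeriv u).ker

/-- The differential of the right translation `R_a` at `u`. -/
def rightDeriv (a : G) (u : P) :
    TangentSpace 𝓘(ℝ, EP) u →L[ℝ] TangentSpace 𝓘(ℝ, EP) (B.act u a) :=
  mfderiv 𝓘(ℝ, EP) 𝓘(ℝ, EP) (fun p => B.act p a) u

/-- The fundamental vector field `A^*` of `A ∈ 𝔤 = T_1 G`: the image of `A` under the differential at the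
identity of the orbit map `a ↦ u · a`. -/
def fundamental (A : EG) (u : P) : TangentSpace 𝓘(ℝ, EP) u :=
  (mfderiv 𝓘(ℝ, EG) 𝓘(ℝ, EP) (fun a : G => B.act u a) 1 : EG → EP) A

/-- `Φ` is a smooth principal extension of the flow `φ`. -/
def IsPrincipalExtension (φ : Flow ℝ N) (Φ : Flow ℝ P) : Prop :=
  IsSmoothFlow (E := EP) Φ ∧ (∀ t u, B.proj (Φ t u) = φ t (B.proj u)) ∧
    ∀ t u a, Φ t (B.act u a) = B.act (Φ t u) a

/-- A Riemannian metric on `P` is right-invariant. -/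
def IsRightInvariant [IsManifold 𝓘(ℝ, EP) ∞ P] (g : RiemMetric EP P) : Prop :=
  ∀ (a : G) (u : P) (v w : TangentSpace 𝓘(ℝ, EP) u),
    g.inner (B.act u a) (B.rightDeriv a u v) (B.rightDeriv a u w) = g.inner u v w

/-- The central space `E_c = ℝX ⊕ ker dπ` of a principal extension, `X` its generator. -/
def central (Φ : Flow ℝ P) (u : P) : Submodule ℝ (TangentSpace 𝓘(ℝ, EP) u) :=
  Submodule.span ℝ {flowGenerator Φ u} ⊔ B.vertical u

/-- The stable and unstable bundles of a partially hyperbolic principal extension `Φ`: for some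
right-invariant Riemannian metric on `P`, one has a `dΦ_t`-invariant dominated decomposition
`TP = E_s ⊕ E_c ⊕ E_u` with `E_c = ℝX ⊕ ker dπ`, with `E_s` (resp. `E_u`) uniformly exponentially
contracted in forward (resp. backward) time, exponentially more than every central vector. If `Φ`
acts isometrically between the fibres, then the domination follows from the contraction.
The pair `(E_s, E_u)` is uniquely determined by `Φ`. -/
def IsPartiallyHyperbolicSplitting [IsManifold 𝓘(ℝ, EP) ∞ P] (Φ : Flow ℝ P)
    (Es Eu : ∀ u : P, Submodule ℝ (TangentSpace 𝓘(ℝ, EP) u)) : Prop :=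
  (∀ u, IsInternalTriple (Es u) (B.central Φ u) (Eu u)) ∧
  (∀ t u, ∀ v ∈ Es u, flowDeriv Φ t u v ∈ Es (Φ t u)) ∧
  (∀ t u, ∀ v ∈ Eu u, flowDeriv Φ t u v ∈ Eu (Φ t u)) ∧
  ∃ g : RiemMetric EP P, B.IsRightInvariant g ∧
    ∃ C c : ℝ, 0 < C ∧ 0 < c ∧
      (∀ t, 0 ≤ t → ∀ u, ∀ v ∈ Es u,
        g.nrm (flowDeriv Φ t u v) ≤ C * Real.exp (-c * t) * g.nrm v) ∧
      (∀ t, 0 ≤ t → ∀ u, ∀ v ∈ Eu u,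
        g.nrm (flowDeriv Φ (-t) u v) ≤ C * Real.exp (-c * t) * g.nrm v) ∧
      (∀ t, 0 ≤ t → ∀ u, ∀ v ∈ Es u, ∀ w ∈ B.central Φ u,
        g.nrm (flowDeriv Φ t u v) * g.nrm w ≤
          C * Real.exp (-c * t) * g.nrm v * g.nrm (flowDeriv Φ t u w)) ∧
      (∀ t, 0 ≤ t → ∀ u, ∀ v ∈ Eu u, ∀ w ∈ B.central Φ u,
        g.nrm (flowDeriv Φ (-t) u v) * g.nrm w ≤
          C * Real.exp (-c * t) * g.nrm v * g.nrm (flowDeriv Φ (-t) u w))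

/-- The dynamical horizontal distribution `ℍ = E_s ⊕ E_u ⊕ ℝX` of a partially hyperbolic principal
extension. -/
def IsDynamicalHorizontal [IsManifold 𝓘(ℝ, EP) ∞ P] (Φ : Flow ℝ P)
    (ℍ : ∀ u : P, Submodule ℝ (TangentSpace 𝓘(ℝ, EP) u)) : Prop :=
  ∃ Es Eu : ∀ u : P, Submodule ℝ (TangentSpace 𝓘(ℝ, EP) u),
    B.IsPartiallyHyperbolicSplitting Φ Es Eu ∧
    ∀ u, ℍ u = Es u ⊔ Eu u ⊔ Submodule.span ℝ {flowGenerator Φ u}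

/-- The bracket of the Lie algebra `𝔤 = T_1 G` of `G`, on the model space `EG` of `G`, which is the
vector space underlying `GroupLieAlgebra 𝓘(ℝ, EG) G = TangentSpace 𝓘(ℝ, EG) (1 : G)`. -/
def lieAlgBracket (EG : Type*) [NormedAddCommGroup EG] [NormedSpace ℝ EG]
    (G : Type*) [TopologicalSpace G] [ChartedSpace EG G] [Group G] (A A' : EG) : EG :=
  (Bracket.bracket (L := GroupLieAlgebra 𝓘(ℝ, EG) G) (M := GroupLieAlgebra 𝓘(ℝ, EG) G) A A' :
    GroupLieAlgebra 𝓘(ℝ, EG) G)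

/-- A 1-form on `P` with values in the Lie algebra `𝔤 = T_1 G` (with its vector space `EG`). -/
abbrev LieAlgForm (EG EP P : Type*) [NormedAddCommGroup EG] [NormedSpace ℝ EG]
    [NormedAddCommGroup EP] [NormedSpace ℝ EP] [TopologicalSpace P] [ChartedSpace EP P] :=
  ∀ u : P, TangentSpace 𝓘(ℝ, EP) u →L[ℝ] EG

/-- `Θ` is the form associated to the distribution `ℍ`: it vanishes on `ℍ` and `Θ(A^*) = A`. -/
def IsFormOf (ℍ : ∀ u : P, Submodule ℝ (TangentSpace 𝓘(ℝ, EP) u))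
    (Θ : LieAlgForm EG EP P) : Prop :=
  (∀ u, ∀ v ∈ ℍ u, Θ u v = 0) ∧
    ∀ (u : P) (A : EG), Θ u (B.fundamental A u) = A

/-- The 1-form `Θ` is of class `C¹`, as a function on the tangent bundle of `P`. -/
def IsC1Form [IsManifold 𝓘(ℝ, EP) ∞ P] (Θ : LieAlgForm EG EP P) : Prop :=
  haveI : IsManifold 𝓘(ℝ, EP) 1 P := IsManifold.of_le (n := ∞) (by norm_cast)
  ContMDiff 𝓘(ℝ, EP).tangent 𝓘(ℝ, EG) 1 (fun v : TangentBundle 𝓘(ℝ, EP) P => Θ v.1 v.2)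

/-- The curvature form `Ω(Y, Z) = dΘ(Y, Z) + [Θ(Y), Θ(Z)]` on `P`. -/
def curvatureForm (_B : SmoothPrincipalBundle EN EG EP N G P) (Θ : LieAlgForm EG EP P) (u : P)
    (Y Z : TangentSpace 𝓘(ℝ, EP) u) : EG :=
  extDerivOneForm Θ u Y Z + lieAlgBracket EG G (Θ u Y) (Θ u Z)

/-- The horizontal lift at `u` of `y ∈ T_{π u} N`: the vector `Y` with `dπ Y = y` and `Θ Y = 0`. -/
def horizontalLift (Θ : LieAlgForm EG EP P) (u : P)
    (y : TangentSpace 𝓘(ℝ, EN) (B.proj u)) : TangentSpace 𝓘(ℝ, EP) u :=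
  Function.invFun (fun Y : TangentSpace 𝓘(ℝ, EP) u => (B.projDeriv u Y, Θ u Y)) (y, 0)

/-- The curvature `ω`, the 2-form on `N` with values in the adjoint bundle `Ad(P) = P ×_Ad 𝔤` that
is induced by `Ω`. It is given by its components: a point `u` over `x` identifies `Ad(P)_x` with
`𝔤`, through `A ↦ [u, A]`, and `ω_x(y, z) = [u, curvature Θ u y z]`. -/
def curvature (Θ : LieAlgForm EG EP P) (u : P)
    (y z : TangentSpace 𝓘(ℝ, EN) (B.proj u)) : EG :=
  B.curvatureForm Θ u (B.horizontalLift Θ u y) (B.horizontalLift Θ u z)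

end SmoothPrincipalBundle

/-! ## Flat flows -/

/-- `q` is a universal covering of the manifold `N`, as a smooth manifold. -/
structure IsUniversalCovering {N' : Type*} [TopologicalSpace N'] [ChartedSpace EN N']
    (q : N' → N) : Prop where
  simplyConnected : SimplyConnectedSpace N'
  isCoveringMap : IsCoveringMap q
  isLocalDiffeomorph : IsLocalDiffeomorph 𝓘(ℝ, EN) 𝓘(ℝ, EN) ∞ q

/-- The group of deck transformations of `q : N' → N`. For the universal covering this is `π₁(N)`
in its action on the universal cover. -/
def deckGroup {N' N : Type*} [TopologicalSpace N'] (q : N' → N) : Subgroup (N' ≃ₜ N') where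
  carrier := {γ | ∀ x, q (γ x) = q x}
  mul_mem' := by
    intro a b ha hb x
    exact (ha (b x)).trans (hb x)
  one_mem' := fun _ => rfl
  inv_mem' := by
    intro a ha x
    have h := ha (a⁻¹ x)
    rw [← h]
    congr 1
    exact a.apply_symm_apply x

/-- The principal extension `Φ` of `φ` is flat: `(P, Φ)` is the flat flow of a representation
`ρ : π₁(N) → G`. Here `φ'` is the lift of the flow `φ` to the universal cover `N'`, the group
`π₁(N)` acts on `N' × G` by `γ · (x, a) = (γ x, ρ(γ) a)`, and the flow `(x, a) ↦ (φ'_t x, a)`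
descends to the quotient `N' ×_ρ G`. The map `F` is the composition of the quotient map
`N' × G → N' ×_ρ G` with an isomorphism of principal bundles `N' ×_ρ G → P`, of class `C¹`, which
covers the identity of `N` and conjugates the flows: its fibres are the orbits of `π₁(N)`, and it is
a surjective local diffeomorphism. -/
def SmoothPrincipalBundle.IsFlatFlow (B : SmoothPrincipalBundle EN EG EP N G P)
    {N' : Type*} [TopologicalSpace N'] [ChartedSpace EN N'] (q : N' → N)
    (φ : Flow ℝ N) (Φ : Flow ℝ P) : Prop :=
  ∃ (φ' : Flow ℝ N') (ρ : deckGroup q →* G) (F : N' × G → P),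
    (∀ t x, q (φ' t x) = φ t (q x)) ∧
    IsLocalDiffeomorph (𝓘(ℝ, EN).prod 𝓘(ℝ, EG)) 𝓘(ℝ, EP) 1 F ∧
    Function.Surjective F ∧
    (∀ x y a b, F (x, a) = F (y, b) ↔ ∃ γ : deckGroup q, y = γ.1 x ∧ b = ρ γ * a) ∧
    (∀ x a, B.proj (F (x, a)) = q x) ∧
    (∀ x a b, F (x, a * b) = B.act (F (x, a)) b) ∧
    (∀ t x a, Φ t (F (x, a)) = F (φ' t x, a))

end Principal

end

/-!
The three conditions are proved equivalent in the cycle `1 → 2 → 3 → 1`.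

`1 → 2` and the local part of `2 → 3` are the Frobenius theorem for the kernel of `Θ`, and need
care since `Θ` is only `C¹`. The curvature vanishes if and only if `dΘ` vanishes on horizontal
vectors (`IsFormOf.curvature_eq_zero_iff`). In a chart, the horizontal lifts form a `C¹` family of
linear maps `L p` with `dπ ∘ L p = id` and `Θ ∘ L p = 0`, and a section `s` is horizontal if it
solves the total differential equation `Ds = L(s)`. A solution is then `C²`, and the symmetry of
its second derivative is the vanishing of `dΘ` (`extDerivOneForm_eq_zero_of_integrable`; an
integral manifold of `ℍ` is such a section, by the inverse function theorem). Conversely, if the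
symmetry holds then the solutions along the rays from a point fit together to a solution
(`exists_hasFDerivAt_eq_of_symmetric`, `exists_isHorizontalSection`).

The distribution `ℍ` is invariant under right translations, since the stable and unstable bundles
of the dominated splitting are characterised by contraction and domination
(`act_mem_of_splitting`). So the translates of horizontal sections are horizontal, and any
horizontal map is locally such a translate (`IsHorizontalSection.eventually_eq_act`). In the
topology for which the horizontal sections are open embeddings, `P → N` therefore is a covering
(`isCoveringMap_leafProj`). The universal covering `q : N' → N` lifts to a map `σ` to this
covering, which is determined by its value at one point; comparing `σ` with `σ ∘ γ` for a deck
transformation `γ` gives the representation `ρ`, and `(x, a) ↦ σ x · a` is the required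
isomorphism. The generator of `Φ` is horizontal, so the orbits of `Φ` are lifts of the orbits of
`φ`, and uniqueness of lifts shows that `σ` intertwines the flows
(`isFlatFlow_of_isHorizontalSection`).

For `3 → 1`, let `σ` be the restriction to `N' × {1}` of the given isomorphism `F`, or one of its
translates. It has to be shown that the image of `dσ` is `ℍ`. As `N` is compact and the metric on
`P` is right-invariant, the vectors `dσ y` are bounded in terms of any vectors of `P` with the
same projection, with a constant that does not depend on the point
(`IsDevelopingSection.exists_metricNorm_le`). If `v` is in `E_s`, and `k` is the vector in the
image of `dσ` with the same projection, then `|dΦ_t k| ≤ K |dΦ_t v|`, as `σ` intertwines the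
flows; the vertical vector `k - v` obeys a similar bound, and therefore vanishes by domination.
The same applies to `E_u` in backward time (`IsDevelopingSection.exists_modelDeriv_eq`).
-/

noncomputable section

/-! ### Total differential equations in a vector space -/

section Frobenius

open Metric Set Filter Topology

variable {E : Type*} [NormedAddCommGroup E] [NormedSpace ℝ E]
  {F : Type*} [NormedAddCommGroup F] [NormedSpace ℝ F]

/-- The Picard–Lindelöf theorem, recording that the solution stays in the ball in which the vector
field is controlled. -/
theorem IsPicardLindelof.exists_hasDerivWithinAt_mem_closedBall [CompleteSpace E]
    {f : ℝ → E → E} {tmin tmax : ℝ} {t₀ : Icc tmin tmax} {x₀ x : E} {a r L K : NNReal}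
    (hf : IsPicardLindelof f t₀ x₀ a r L K) (hx : x ∈ closedBall x₀ r) :
    ∃ α : ℝ → E, α t₀ = x ∧ (∀ t, α t ∈ closedBall x₀ a) ∧
      ∀ t ∈ Icc tmin tmax, HasDerivWithinAt α (f t (α t)) (Icc tmin tmax) t := by
  obtain ⟨α, hα⟩ := ODE.FunSpace.exists_isFixedPt_next hf hx
  refine ⟨α.compProj, by rw [ODE.FunSpace.compProj_val, ← hα, ODE.FunSpace.next_apply₀],
    fun t => α.compProj_mem_closedBall hf.mul_max_le, fun t ht ↦ ?_⟩
  apply ODE.hasDerivWithinAt_picard_Icc t₀.2 hf.continuousOn_uncurry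
    α.continuous_compProj.continuousOn (fun _ ht' ↦ α.compProj_mem_closedBall hf.mul_max_le)
    x ht |>.congr_of_mem _ ht
  intro t' ht'
  nth_rw 1 [← hα]
  rw [ODE.FunSpace.compProj_of_mem ht', ODE.FunSpace.next_apply]

/-- On a compact convex set, the first order Taylor expansion of a `C¹` map is uniform. -/
theorem exists_forall_norm_sub_sub_fderiv_le {G : Type*} [NormedAddCommGroup G] [NormedSpace ℝ G]
    {f : E → G} {B : Set E} (hB : IsCompact B) (hBc : Convex ℝ B)
    (hf : ∀ p ∈ B, DifferentiableAt ℝ f p) (hf' : ContinuousOn (fderiv ℝ f) B)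
    {ε : ℝ} (hε : 0 < ε) :
    ∃ δ > 0, ∀ p ∈ B, ∀ p' ∈ B, ‖p' - p‖ < δ →
      ‖f p' - f p - fderiv ℝ f p (p' - p)‖ ≤ ε * ‖p' - p‖ := by
  have hu := hB.uniformContinuousOn_of_continuous hf'
  obtain ⟨δ, hδ, h⟩ := Metric.uniformContinuousOn_iff.1 hu ε hε
  refine ⟨δ, hδ, fun p hp p' hp' hpp => ?_⟩
  have hc : Convex ℝ (B ∩ ball p δ) := hBc.inter (convex_ball p δ)
  refine hc.norm_image_sub_le_of_norm_hasFDerivWithin_le' (f' := fderiv ℝ f)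
    (fun z hz => (hf z hz.1).hasFDerivAt.hasFDerivWithinAt) (fun z hz => ?_)
    ⟨hp, mem_ball_self hδ⟩ ⟨hp', by rwa [mem_ball, dist_eq_norm]⟩
  rw [← dist_eq_norm]
  exact (h z hz.1 p hp hz.2).le

/-- The radial solutions of `Ds = L(s)`: the value at time one of the solution of
`γ' = L(γ) x`, `γ 0 = p₀` has derivative `L` with respect to `x`, by comparison of the solution for
`x + h` with the curve `γ + t L(γ) h`. -/
theorem hasFDerivAt_of_radial [FiniteDimensional ℝ E] {L : E → F →L[ℝ] E} {B : Set E}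
    (hB : IsCompact B) (hBc : Convex ℝ B)
    (hL : ∀ p ∈ B, DifferentiableAt ℝ L p) (hL' : ContinuousOn (fderiv ℝ L) B)
    (hsym : ∀ p ∈ B, ∀ h k, fderiv ℝ L p (L p h) k = fderiv ℝ L p (L p k) h)
    {p₀ : E} {K : NNReal} {a : ℝ} (ha : 0 < a) (hK : ∀ p ∈ B, ‖fderiv ℝ L p‖ ≤ K)
    {b : ℝ} (hab : closedBall p₀ (a + b) ⊆ B)
    {V : Set F} (hV : IsOpen V) (γ : F → ℝ → E) (h0 : ∀ x ∈ V, γ x 0 = p₀)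
    (hγB : ∀ x ∈ V, ∀ t, γ x t ∈ closedBall p₀ b)
    (hγ : ∀ x ∈ V, ∀ t ∈ Icc (0 : ℝ) 1,
      HasDerivWithinAt (γ x) (L (γ x t) x) (Icc (0 : ℝ) 1) t) {x : F} (hx : x ∈ V) :
    HasFDerivAt (fun x => γ x 1) (L (γ x 1)) x := by
  have hbB : closedBall p₀ b ⊆ B := (closedBall_subset_closedBall (by linarith)).trans hab
  have hγB' : ∀ x ∈ V, ∀ t, γ x t ∈ B := fun x hx t => hbB (hγB x hx t)
  have hLc : ContinuousOn L B := fun p hp => (hL p hp).continuousAt.continuousWithinAt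
  obtain ⟨M, hM⟩ : ∃ M, ∀ p ∈ B, ‖L p‖ ≤ M := hB.exists_bound_of_continuousOn hLc
  set M' : ℝ := max M 1
  have hM' : ∀ p ∈ B, ‖L p‖ ≤ M' := fun p hp => (hM p hp).trans (le_max_left _ _)
  have hMpos : 0 < M' := lt_of_lt_of_le one_pos (le_max_right _ _)
  have hlip : LipschitzOnWith K L B :=
    hBc.lipschitzOnWith_of_nnnorm_hasFDerivWithin_le
      (fun p hp => (hL p hp).hasFDerivAt.hasFDerivWithinAt) (fun p hp => by exact_mod_cast hK p hp)
  rw [hasFDerivAt_iff_isLittleO_nhds_zero, Asymptotics.isLittleO_iff]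
  intro c hc
  -- a common Lipschitz constant, positive, of the vector fields `p ↦ L p (x + h)`, `‖h‖ ≤ 1`
  set Λ : NNReal := K * (‖x‖₊ + 1) + 1
  have hΛ : (Λ : ℝ) = K * (‖x‖ + 1) + 1 := by simp [Λ]
  have hΛpos : (0 : ℝ) < Λ := by rw [hΛ]; positivity
  set Q : ℝ := (Real.exp Λ - 1) / Λ
  have hQ : 0 < Q := div_pos (by linarith [Real.add_one_lt_exp hΛpos.ne']) hΛpos
  set ε : ℝ := c / (2 * Q * M' * (‖x‖ + 1))
  have hε : 0 < ε := by positivity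
  obtain ⟨δ, hδ, hT⟩ := exists_forall_norm_sub_sub_fderiv_le hB hBc hL hL' hε
  have hρ : 0 < min (min 1 (min (δ / M') (a / M'))) (c / (2 * Q * (K + 1) * M')) := by
    have : (0 : ℝ) ≤ K := K.2
    positivity
  have hVh : ∀ᶠ h in 𝓝 (0 : F), x + h ∈ V := by
    have : Tendsto (fun h : F => x + h) (𝓝 0) (𝓝 x) := by
      simpa using (continuous_const.add continuous_id).tendsto (0 : F) (f := fun h : F => x + h)
    exact this (hV.mem_nhds hx)
  filter_upwards [hVh, ball_mem_nhds (0 : F) hρ] with h hh hhρ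
  rw [mem_ball_zero_iff] at hhρ
  simp only [lt_min_iff] at hhρ
  obtain ⟨⟨hh1, hhδ, hha⟩, hhc⟩ := hhρ
  rw [lt_div_iff₀ hMpos] at hhδ hha
  have hIci : ∀ (f : ℝ → E) (f' : E) (t : ℝ), t ∈ Ico (0 : ℝ) 1 →
      HasDerivWithinAt f f' (Icc 0 1) t → HasDerivWithinAt f f' (Ici t) t := fun f f' t ht hf =>
    (hf.mono (Icc_subset_Icc_left ht.1)).mono_of_mem_nhdsWithin (Icc_mem_nhdsGE ht.2)
  set η : ℝ → E := fun t => γ x t + t • L (γ x t) h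
  set η' : ℝ → E := fun t =>
    L (γ x t) x + (t • fderiv ℝ L (γ x t) (L (γ x t) x) h + (1 : ℝ) • L (γ x t) h)
  have hη : ∀ t ∈ Icc (0 : ℝ) 1, HasDerivWithinAt η (η' t) (Icc 0 1) t := by
    intro t ht
    have h1 := hγ x hx t ht
    have h2 : HasDerivWithinAt (fun t => L (γ x t)) (fderiv ℝ L (γ x t) (L (γ x t) x))
        (Icc 0 1) t := (hL _ (hγB' x hx t)).hasFDerivAt.comp_hasDerivWithinAt t h1
    have h3 : HasDerivWithinAt (fun t => L (γ x t) h) (fderiv ℝ L (γ x t) (L (γ x t) x) h)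
        (Icc 0 1) t := by
      have := h2.clm_apply (hasDerivWithinAt_const t (Icc (0 : ℝ) 1) h)
      simpa using this
    exact h1.add ((hasDerivWithinAt_id t _).smul h3)
  have hηB : ∀ t ∈ Icc (0 : ℝ) 1, η t ∈ B ∧ ‖η t - γ x t‖ ≤ M' * ‖h‖ := by
    intro t ht
    have h1 : ‖η t - γ x t‖ ≤ M' * ‖h‖ := by
      simp only [η, add_sub_cancel_left, norm_smul, Real.norm_eq_abs, abs_of_nonneg ht.1]
      calc t * ‖L (γ x t) h‖ ≤ 1 * ‖L (γ x t) h‖ := by gcongr; exact ht.2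
        _ ≤ M' * ‖h‖ := by
          rw [one_mul]
          exact (L (γ x t)).le_of_opNorm_le (hM' _ (hγB' x hx t)) h
    refine ⟨hab ?_, h1⟩
    have h2 := hγB x hx t
    rw [mem_closedBall, dist_eq_norm] at h2 ⊢
    calc ‖η t - p₀‖ = ‖(η t - γ x t) + (γ x t - p₀)‖ := by congr 1; abel
      _ ≤ ‖η t - γ x t‖ + ‖γ x t - p₀‖ := norm_add_le _ _
      _ ≤ a + b := by nlinarith
  set e : ℝ := c / Q * ‖h‖
  have hηe : ∀ t ∈ Ico (0 : ℝ) 1, dist (η' t) (L (η t) (x + h)) ≤ e := by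
    intro t ht
    have ht' : t ∈ Icc (0 : ℝ) 1 := Ico_subset_Icc_self ht
    have hp := hγB' x hx t
    set p := γ x t with hpdef
    obtain ⟨hq, hqp⟩ := hηB t ht'
    have hsub : η t - p = t • L p h := by simp [η, hpdef]
    have h1 := hT p hp (η t) hq (lt_of_le_of_lt hqp (by rw [mul_comm]; exact hhδ))
    have key : η' t - L (η t) (x + h) =
        -((L (η t) - L p - fderiv ℝ L p (η t - p)) (x + h)) - t • fderiv ℝ L p (L p h) h := by
      have hs := hsym p hp h x
      simp only [η', hsub, map_smul, sub_apply,
        smul_apply, map_add, ← hpdef, hs, one_smul]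
      abel
    rw [dist_eq_norm, key]
    have hK0 : (0 : ℝ) ≤ K := K.2
    have e1 : ‖(L (η t) - L p - fderiv ℝ L p (η t - p)) (x + h)‖ ≤
        ε * (M' * ‖h‖) * (‖x‖ + 1) := by
      refine (ContinuousLinearMap.le_opNorm _ _).trans ?_
      gcongr
      · exact h1.trans (by gcongr)
      · exact (norm_add_le _ _).trans (by gcongr)
    have e2 : ‖t • fderiv ℝ L p (L p h) h‖ ≤ K * (M' * ‖h‖) * ‖h‖ := by
      rw [norm_smul, Real.norm_eq_abs, abs_of_nonneg ht.1]
      have : ‖fderiv ℝ L p (L p h) h‖ ≤ K * (M' * ‖h‖) * ‖h‖ := by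
        refine (ContinuousLinearMap.le_opNorm _ _).trans ?_
        gcongr
        refine (ContinuousLinearMap.le_opNorm _ _).trans ?_
        gcongr
        · exact hK p hp
        · exact (L p).le_of_opNorm_le (hM' p hp) h
      calc t * _ ≤ 1 * ‖fderiv ℝ L p (L p h) h‖ := by gcongr; exact ht.2.le
        _ ≤ _ := by rwa [one_mul]
    refine (norm_sub_le _ _).trans ?_
    rw [norm_neg]
    have e3 : ε * (M' * ‖h‖) * (‖x‖ + 1) = c / Q * ‖h‖ / 2 := by
      simp only [ε]; field_simp
    have e4 : K * (M' * ‖h‖) * ‖h‖ ≤ c / Q * ‖h‖ / 2 := by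
      calc K * (M' * ‖h‖) * ‖h‖ ≤ (K + 1) * (M' * (c / (2 * Q * (K + 1) * M'))) * ‖h‖ := by
            gcongr; linarith
        _ = c / Q * ‖h‖ / 2 := by field_simp
    simp only [e]
    linarith
  have hcont : ∀ y ∈ V, ContinuousOn (γ y) (Icc 0 1) := fun y hy t ht =>
    (hγ y hy t ht).continuousWithinAt
  have hlip' : ∀ t ∈ Ico (0 : ℝ) 1, LipschitzOnWith Λ (fun p => L p (x + h)) B := by
    intro t _
    refine LipschitzOnWith.of_dist_le_mul fun p hp q hq => ?_
    rw [dist_eq_norm, ← sub_apply]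
    refine (ContinuousLinearMap.le_opNorm _ _).trans ?_
    have h1 := hlip.dist_le_mul p hp q hq
    rw [dist_eq_norm] at h1
    calc ‖L p - L q‖ * ‖x + h‖ ≤ (K * dist p q) * (‖x‖ + 1) := by
          gcongr
          exact (norm_add_le _ _).trans (by gcongr)
      _ ≤ Λ * dist p q := by
        rw [hΛ]; nlinarith [dist_nonneg (x := p) (y := q)]
  have hG := dist_le_of_approx_trajectories_ODE_of_mem (δ := 0) (εf := 0) (εg := e)
    (f := γ (x + h)) (f' := fun t => L (γ (x + h) t) (x + h)) (g := η) (g' := η')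
    (v := fun _ p => L p (x + h)) (s := fun _ => B) hlip' (hcont _ hh)
    (fun t ht => hIci _ _ t ht (hγ _ hh t (Ico_subset_Icc_self ht)))
    (fun t _ => by simp) (fun t _ => hγB' _ hh t)
    (fun t ht => (hη t ht).continuousWithinAt)
    (fun t ht => hIci _ _ t ht (hη t (Ico_subset_Icc_self ht)))
    hηe (fun t ht => (hηB t (Ico_subset_Icc_self ht)).1)
    (by simp [η, h0 _ hh, h0 _ hx]) 1 (by simp)
  rw [gronwallBound_of_K_ne_0 hΛpos.ne', dist_eq_norm] at hG
  have : γ (x + h) 1 - γ x 1 - L (γ x 1) h = γ (x + h) 1 - η 1 := by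
    simp only [η, one_smul]; abel
  rw [this]
  refine hG.trans (le_of_eq ?_)
  simp only [e, zero_mul, zero_add, sub_zero, mul_one]
  have hQ' : Real.exp Λ - 1 = Q * Λ := by simp only [Q]; field_simp
  rw [hQ']
  field_simp

/-- **Frobenius theorem** for total differential equations `Ds = L(s)` with `L` of class `C¹`,
under the integrability condition that `DL(p)(L p h) k` is symmetric in `h` and `k`. -/
theorem exists_hasFDerivAt_eq_of_symmetric [FiniteDimensional ℝ E]
    {L : E → F →L[ℝ] E} {U : Set E} (hU : IsOpen U) (hL : ContDiffOn ℝ 1 L U)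
    (hsym : ∀ p ∈ U, ∀ h k, fderiv ℝ L p (L p h) k = fderiv ℝ L p (L p k) h)
    {p₀ : E} (hp₀ : p₀ ∈ U) :
    ∃ (V : Set F) (s : F → E), IsOpen V ∧ 0 ∈ V ∧ s 0 = p₀ ∧
      ∀ x ∈ V, s x ∈ U ∧ HasFDerivAt s (L (s x)) x := by
  obtain ⟨a, ha, haU⟩ : ∃ a > 0, closedBall p₀ a ⊆ U :=
    nhds_basis_closedBall.mem_iff.1 (hU.mem_nhds hp₀)
  set B := closedBall p₀ a
  have hB : IsCompact B := isCompact_closedBall p₀ a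
  have hBc : Convex ℝ B := convex_closedBall p₀ a
  have hLd : ∀ p ∈ B, DifferentiableAt ℝ L p := fun p hp =>
    (hL.differentiableOn one_ne_zero p (haU hp)).differentiableAt (hU.mem_nhds (haU hp))
  have hLc : ContinuousOn (fderiv ℝ L) B :=
    (hL.continuousOn_fderiv_of_isOpen hU le_rfl).mono haU
  obtain ⟨K₁, hK₁⟩ : ∃ K₁, ∀ p ∈ B, ‖fderiv ℝ L p‖ ≤ K₁ :=
    hB.exists_bound_of_continuousOn (E := E →L[ℝ] F →L[ℝ] E) (f := fderiv ℝ L) hLc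
  set K : NNReal := K₁.toNNReal
  have hK : ∀ p ∈ B, ‖fderiv ℝ L p‖ ≤ K := fun p hp => (hK₁ p hp).trans (Real.le_coe_toNNReal _)
  obtain ⟨M₁, hM₁⟩ : ∃ M₁, ∀ p ∈ B, ‖L p‖ ≤ M₁ := hB.exists_bound_of_continuousOn
    (fun p hp => (hLd p hp).continuousAt.continuousWithinAt : ContinuousOn L B)
  set M : NNReal := M₁.toNNReal + 1
  have hM : ∀ p ∈ B, ‖L p‖ ≤ M := fun p hp => (hM₁ p hp).trans
    ((Real.le_coe_toNNReal _).trans (by simp [M]))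
  have hMpos : (0 : ℝ) < M := by simp only [M]; positivity
  have hlip : LipschitzOnWith K L B :=
    hBc.lipschitzOnWith_of_nnnorm_hasFDerivWithin_le
      (fun p hp => (hLd p hp).hasFDerivAt.hasFDerivWithinAt)
      (fun p hp => by exact_mod_cast hK p hp)
  set b : NNReal := (a / 2).toNNReal
  have hb : (b : ℝ) = a / 2 := Real.coe_toNNReal _ (by positivity)
  have hbB : closedBall p₀ (b : ℝ) ⊆ B := closedBall_subset_closedBall (by rw [hb]; linarith)
  set V : Set F := ball 0 (a / 2 / M)
  have hsol : ∀ x ∈ V, ∃ α : ℝ → E, α 0 = p₀ ∧ (∀ t, α t ∈ closedBall p₀ (b : ℝ)) ∧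
      ∀ t ∈ Icc (0 : ℝ) 1, HasDerivWithinAt α (L (α t) x) (Icc (0 : ℝ) 1) t := by
    intro x hx
    rw [mem_ball_zero_iff, lt_div_iff₀ hMpos] at hx
    have hPL : IsPicardLindelof (fun _ p => L p x) (tmin := 0) (tmax := 1) ⟨0, by simp⟩ p₀ b 0
        (M * ‖x‖₊) (K * ‖x‖₊) := by
      refine IsPicardLindelof.of_time_independent (fun p hp => ?_) ?_ ?_
      · simpa using (L p).le_of_opNorm_le (hM p (hbB hp)) x
      · refine LipschitzOnWith.of_dist_le_mul fun p hp q hq => ?_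
        rw [dist_eq_norm, ← sub_apply]
        refine (ContinuousLinearMap.le_opNorm _ _).trans ?_
        have h1 := hlip.dist_le_mul p (hbB hp) q (hbB hq)
        rw [dist_eq_norm] at h1
        calc ‖L p - L q‖ * ‖x‖ ≤ (K * dist p q) * ‖x‖ := by gcongr
          _ = _ := by push_cast; ring
      · simp only [hb]
        simp
        linarith
    exact hPL.exists_hasDerivWithinAt_mem_closedBall (mem_closedBall_self (by simp))
  choose! γ h0 hγB hγ using hsol
  have h0V : (0 : F) ∈ V := mem_ball_self (by positivity)
  refine ⟨V, fun x => γ x 1, isOpen_ball, h0V, ?_, fun x hx => ⟨haU (hbB (hγB x hx 1)), ?_⟩⟩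
  · have hd := hγ 0 h0V
    have := constant_of_has_deriv_right_zero (f := γ 0) (a := 0) (b := 1)
      (fun t ht => (hd t ht).continuousWithinAt) (fun t ht => by
        have h1 := hd t (Ico_subset_Icc_self ht)
        rw [map_zero] at h1
        exact (h1.mono (Icc_subset_Icc_left ht.1)).mono_of_mem_nhdsWithin (Icc_mem_nhdsGE ht.2))
      1 (by simp)
    exact this.trans (h0 0 h0V)
  · refine hasFDerivAt_of_radial hB hBc hLd hLc (fun p hp => hsym p (haU hp)) (a := a / 2)
      (by positivity) hK (b := a / 2) (p₀ := p₀) (by simp [B]) isOpen_ball γ h0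
      (fun x hx t => ?_) hγ hx
    rw [← hb]; exact hγB x hx t

end Frobenius

/-! ### Horizontal lifts of a connection read in charts -/

section HorizontalLift

open Metric Set Filter Topology

variable {E : Type*} [NormedAddCommGroup E] [NormedSpace ℝ E]
  {F : Type*} [NormedAddCommGroup F] [NormedSpace ℝ F]
  {G : Type*} [NormedAddCommGroup G] [NormedSpace ℝ G]

/-- The horizontal lift `F → E` at `p` for a projection `pr : E → F` and a form `θ` on `E` with
values in `G`: the vector `L p h` is determined by `D pr (L p h) = h` and `θ (L p h) = 0`, when
`(D pr, θ)` is bijective at `p`. -/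
def modelLift (pr : E → F) (θ : E → E →L[ℝ] G) (p : E) : F →L[ℝ] E :=
  ((fderiv ℝ pr p).prod (θ p)).inverse ∘L ContinuousLinearMap.inl ℝ F G

variable {pr : E → F} {θ : E → E →L[ℝ] G} {p : E}

theorem isInvertible_of_bijective [FiniteDimensional ℝ E] {A : E →L[ℝ] F}
    (h : Function.Bijective A) : A.IsInvertible :=
  ⟨(LinearEquiv.ofBijective (A : E →ₗ[ℝ] F) h).toContinuousLinearEquiv, by ext; rfl⟩

theorem prod_modelLift [FiniteDimensional ℝ E]
    (h : Function.Bijective ((fderiv ℝ pr p).prod (θ p))) (k : F) :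
    (fderiv ℝ pr p).prod (θ p) (modelLift pr θ p k) = (k, 0) := by
  obtain ⟨e, he⟩ := isInvertible_of_bijective h
  simp only [modelLift, ← he, ContinuousLinearMap.inverse_equiv, ContinuousLinearMap.comp_apply]
  simp

theorem fderiv_modelLift [FiniteDimensional ℝ E]
    (h : Function.Bijective ((fderiv ℝ pr p).prod (θ p))) (k : F) :
    fderiv ℝ pr p (modelLift pr θ p k) = k :=
  congrArg Prod.fst (prod_modelLift h k)

theorem form_modelLift [FiniteDimensional ℝ E]
    (h : Function.Bijective ((fderiv ℝ pr p).prod (θ p))) (k : F) :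
    θ p (modelLift pr θ p k) = 0 :=
  congrArg Prod.snd (prod_modelLift h k)

theorem eq_modelLift [FiniteDimensional ℝ E]
    (h : Function.Bijective ((fderiv ℝ pr p).prod (θ p))) {v : E} (hv : θ p v = 0) :
    v = modelLift pr θ p (fderiv ℝ pr p v) := by
  apply h.1
  rw [prod_modelLift h]
  simp [hv]

theorem contDiffAt_modelLift [FiniteDimensional ℝ E] (hpr : ContDiffAt ℝ 2 pr p)
    (hθ : ContDiffAt ℝ 1 θ p) (h : Function.Bijective ((fderiv ℝ pr p).prod (θ p))) :
    ContDiffAt ℝ 1 (modelLift pr θ) p := by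
  have h1 : ContDiffAt ℝ 1 (fun p => (fderiv ℝ pr p).prod (θ p)) p := by
    have hD : ContDiffAt ℝ 1 (fderiv ℝ pr) p := hpr.fderiv_right (by norm_num)
    have hl : ContDiffAt ℝ 1 (fun _ : E => ContinuousLinearMap.inl ℝ F G) p := contDiffAt_const
    have hr : ContDiffAt ℝ 1 (fun _ : E => ContinuousLinearMap.inr ℝ F G) p := contDiffAt_const
    have h0 : ContDiffAt ℝ 1 (fun p => ContinuousLinearMap.inl ℝ F G ∘L fderiv ℝ pr p +
        ContinuousLinearMap.inr ℝ F G ∘L θ p) p :=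
      (hl.clm_comp hD).add (hr.clm_comp hθ)
    refine h0.congr_of_eventuallyEq (Filter.Eventually.of_forall fun p => ?_)
    ext v <;> simp
  have h2 : ContDiffAt ℝ 1 ContinuousLinearMap.inverse ((fderiv ℝ pr p).prod (θ p)) :=
    (isInvertible_of_bijective h).contDiffAt_map_inverse
  have h3 : ContDiffAt ℝ 1 (fun p => ((fderiv ℝ pr p).prod (θ p)).inverse) p :=
    ContDiffAt.comp (F := E →L[ℝ] F × G) (g := ContinuousLinearMap.inverse)
      (f := fun p => (fderiv ℝ pr p).prod (θ p)) p h2 h1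
  have h4 : ContDiffAt ℝ 1 (fun _ : E => ContinuousLinearMap.inl ℝ F G) p := contDiffAt_const
  exact h3.clm_comp h4

/-- Differentiating `D pr ∘ L = id` and `θ ∘ L = 0` along a horizontal vector shows that the
integrability condition on the lift `L` is the vanishing of `dθ` on horizontal vectors. -/
theorem fderiv_modelLift_symm_iff [FiniteDimensional ℝ E] (hpr : ContDiffAt ℝ 2 pr p)
    (hθ : ContDiffAt ℝ 1 θ p)
    (hb : ∀ᶠ p in 𝓝 p, Function.Bijective ((fderiv ℝ pr p).prod (θ p))) (h k : F) :
    fderiv ℝ (modelLift pr θ) p (modelLift pr θ p h) k =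
      fderiv ℝ (modelLift pr θ) p (modelLift pr θ p k) h ↔
    fderiv ℝ θ p (modelLift pr θ p h) (modelLift pr θ p k) =
      fderiv ℝ θ p (modelLift pr θ p k) (modelLift pr θ p h) := by
  have hbp := hb.self_of_nhds
  have hL := (contDiffAt_modelLift hpr hθ hbp).differentiableAt one_ne_zero
  set L := modelLift pr θ
  have hD : DifferentiableAt ℝ (fderiv ℝ pr) p :=
    (hpr.fderiv_right (m := 1) (by norm_num)).differentiableAt one_ne_zero
  have hθd := hθ.differentiableAt one_ne_zero
  -- derivative of the two defining identities of `L` in the direction `v`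
  have e1 : ∀ (v : E) (k : F),
      fderiv ℝ (fderiv ℝ pr) p v (L p k) + fderiv ℝ pr p (fderiv ℝ L p v k) = 0 := by
    intro v k
    have h1 : HasFDerivAt (fun q => fderiv ℝ pr q (L q k)) _ p :=
      hD.hasFDerivAt.clm_apply (hL.hasFDerivAt.clm_apply (hasFDerivAt_const k p))
    have h2 : HasFDerivAt (fun q => fderiv ℝ pr q (L q k)) (0 : E →L[ℝ] F) p :=
      (hasFDerivAt_const k p).congr_of_eventuallyEq
        (hb.mono fun q hq => fderiv_modelLift hq k)
    have h3 := congrArg (fun T : E →L[ℝ] F => T v) (h1.unique h2)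
    simp at h3
    rw [← h3]; abel
  have e2 : ∀ (v : E) (k : F), fderiv ℝ θ p v (L p k) + θ p (fderiv ℝ L p v k) = 0 := by
    intro v k
    have h1 : HasFDerivAt (fun q => θ q (L q k)) _ p :=
      hθd.hasFDerivAt.clm_apply (hL.hasFDerivAt.clm_apply (hasFDerivAt_const k p))
    have h2 : HasFDerivAt (fun q => θ q (L q k)) (0 : E →L[ℝ] G) p :=
      (hasFDerivAt_const 0 p).congr_of_eventuallyEq (hb.mono fun q hq => form_modelLift hq k)
    have h3 := congrArg (fun T : E →L[ℝ] G => T v) (h1.unique h2)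
    simp at h3
    rw [← h3]; abel
  have hsymm : ∀ v w, fderiv ℝ (fderiv ℝ pr) p v w = fderiv ℝ (fderiv ℝ pr) p w v :=
    fun v w => (hpr.isSymmSndFDerivAt (by simp)) v w
  constructor
  · intro hs
    have a1 := e2 (L p h) k
    have a2 := e2 (L p k) h
    rw [hs] at a1
    exact add_right_cancel (a1.trans a2.symm)
  · intro hs
    apply hbp.1
    have a1 := e2 (L p h) k
    have a2 := e2 (L p k) h
    have b1 := e1 (L p h) k
    have b2 := e1 (L p k) h
    rw [hs] at a1
    rw [hsymm] at b1
    exact Prod.ext (add_left_cancel (b1.trans b2.symm)) (add_left_cancel (a1.trans a2.symm))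

/-- Local horizontal sections of `pr` exist, if `dθ` vanishes on horizontal vectors. -/
theorem exists_horizontal_section_model [FiniteDimensional ℝ E] {U : Set E} (hU : IsOpen U)
    (hpr : ContDiffOn ℝ 2 pr U) (hθ : ContDiffOn ℝ 1 θ U)
    (hb : ∀ p ∈ U, Function.Bijective ((fderiv ℝ pr p).prod (θ p)))
    (hd : ∀ p ∈ U, ∀ v w, θ p v = 0 → θ p w = 0 → fderiv ℝ θ p v w = fderiv ℝ θ p w v)
    {p₀ : E} (hp₀ : p₀ ∈ U) :
    ∃ (V : Set F) (s : F → E), IsOpen V ∧ pr p₀ ∈ V ∧ s (pr p₀) = p₀ ∧ ContDiffOn ℝ 1 s V ∧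
      ∀ y ∈ V, s y ∈ U ∧ pr (s y) = y ∧ ∀ h, θ (s y) (fderiv ℝ s y h) = 0 := by
  have hpr' : ∀ p ∈ U, ContDiffAt ℝ 2 pr p := fun p hp => hpr.contDiffAt (hU.mem_nhds hp)
  have hθ' : ∀ p ∈ U, ContDiffAt ℝ 1 θ p := fun p hp => hθ.contDiffAt (hU.mem_nhds hp)
  have hL : ContDiffOn ℝ 1 (modelLift pr θ) U := fun p hp =>
    (contDiffAt_modelLift (hpr' p hp) (hθ' p hp) (hb p hp)).contDiffWithinAt
  obtain ⟨V₀, s₀, hV₀, h0V, hs0, hs⟩ := exists_hasFDerivAt_eq_of_symmetric hU hL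
    (fun p hp h k => (fderiv_modelLift_symm_iff (hpr' p hp) (hθ' p hp)
      (Filter.eventually_of_mem (hU.mem_nhds hp) hb) h k).2
      (hd p hp _ _ (form_modelLift (hb p hp) h) (form_modelLift (hb p hp) k))) hp₀
  obtain ⟨r, hr, hrV⟩ := Metric.isOpen_iff.1 hV₀ 0 h0V
  have hs' : ∀ y ∈ ball (pr p₀) r, s₀ (y - pr p₀) ∈ U ∧ HasFDerivAt (fun y => s₀ (y - pr p₀))
      (modelLift pr θ (s₀ (y - pr p₀))) y := by
    intro y hy
    have hy' : y - pr p₀ ∈ V₀ := hrV (by simpa [dist_eq_norm] using hy)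
    obtain ⟨h1, h2⟩ := hs _ hy'
    refine ⟨h1, ?_⟩
    have h3 := h2.comp y ((hasFDerivAt_id y).sub_const (pr p₀))
    rwa [ContinuousLinearMap.comp_id] at h3
  have hcont : ContinuousOn (fun y => s₀ (y - pr p₀)) (ball (pr p₀) r) := fun y hy =>
    (hs' y hy).2.continuousAt.continuousWithinAt
  refine ⟨ball (pr p₀) r, fun y => s₀ (y - pr p₀), isOpen_ball, mem_ball_self hr, by simpa, ?_,
    fun y hy => ⟨(hs' y hy).1, ?_, fun h => ?_⟩⟩
  · rw [show (1 : WithTop ℕ∞) = 0 + 1 from rfl, contDiffOn_succ_iff_fderiv_of_isOpen isOpen_ball]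
    refine ⟨fun y hy => (hs' y hy).2.differentiableAt.differentiableWithinAt, by simp, ?_⟩
    rw [contDiffOn_zero]
    refine ContinuousOn.congr (f := fun y => modelLift pr θ (s₀ (y - pr p₀))) ?_
      fun y hy => (hs' y hy).2.fderiv
    exact hL.continuousOn.comp hcont fun y hy => (hs' y hy).1
  · -- `pr ∘ s - id` has zero derivative on the ball
    have hz : ∀ y ∈ ball (pr p₀) r,
        HasFDerivWithinAt (fun y => pr (s₀ (y - pr p₀)) - y) (0 : F →L[ℝ] F)
          (ball (pr p₀) r) y := by
      intro y hy
      obtain ⟨h1, h2⟩ := hs' y hy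
      have h3 := ((hpr' _ h1).differentiableAt two_ne_zero).hasFDerivAt.comp y h2
      have h4 := (h3.sub (hasFDerivAt_id y)).hasFDerivWithinAt (s := ball (pr p₀) r)
      have h5 : fderiv ℝ pr (s₀ (y - pr p₀)) ∘L modelLift pr θ (s₀ (y - pr p₀)) -
          ContinuousLinearMap.id ℝ F = 0 := by
        ext k
        simp [fderiv_modelLift (hb _ h1)]
      rw [h5] at h4
      exact h4
    have := (convex_ball (pr p₀) r).is_const_of_fderivWithin_eq_zero (𝕜 := ℝ)
      (fun y hy => (hz y hy).differentiableWithinAt)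
      (fun y hy => (hz y hy).fderivWithin (isOpen_ball.uniqueDiffWithinAt hy)) hy (mem_ball_self hr)
    simpa [hs0, sub_eq_zero] using this
  · rw [(hs' y hy).2.fderiv]
    exact form_modelLift (hb _ (hs' y hy).1) h

/-- If an immersion `f` with horizontal differential projects to a local diffeomorphism, then `dθ`
vanishes on horizontal vectors. The map `f` is only of class `C¹`, but, as a section of `pr`, it
solves `Ds = L(s)`, so that it is of class `C²` and its second derivative is symmetric. -/
theorem fderiv_form_symm_of_horizontal [FiniteDimensional ℝ E] [FiniteDimensional ℝ F]
    {K : Type*} [NormedAddCommGroup K] [NormedSpace ℝ K] [FiniteDimensional ℝ K]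
    (hpr : ContDiffAt ℝ 2 pr p) (hθ : ContDiffAt ℝ 1 θ p)
    (hb : ∀ᶠ p in 𝓝 p, Function.Bijective ((fderiv ℝ pr p).prod (θ p)))
    {f : K → E} {w₀ : K} (hf : ContDiffAt ℝ 1 f w₀) (hf0 : f w₀ = p)
    (hfθ : ∀ᶠ w in 𝓝 w₀, ∀ k, θ (f w) (fderiv ℝ f w k) = 0)
    (hfb : Function.Bijective (fun k => fderiv ℝ pr p (fderiv ℝ f w₀ k)))
    {v w : E} (hv : θ p v = 0) (hw : θ p w = 0) :
    fderiv ℝ θ p v w = fderiv ℝ θ p w v := by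
  subst hf0
  have hbp := hb.self_of_nhds
  rw [eq_modelLift hbp hv, eq_modelLift hbp hw, ← fderiv_modelLift_symm_iff hpr hθ hb]
  have hprd : DifferentiableAt ℝ pr (f w₀) := hpr.differentiableAt two_ne_zero
  have hfd := hf.differentiableAt one_ne_zero
  obtain ⟨e, he⟩ := isInvertible_of_bijective (A := (fderiv ℝ pr (f w₀)).comp (fderiv ℝ f w₀)) hfb
  have hc : ContDiffAt ℝ 1 (pr ∘ f) w₀ := (hpr.of_le (by norm_num)).comp w₀ hf
  have hcd : HasFDerivAt (pr ∘ f) (e : K →L[ℝ] F) w₀ := by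
    rw [he]; exact hprd.hasFDerivAt.comp w₀ hfd.hasFDerivAt
  set κ := hc.localInverse hcd one_ne_zero
  have hκ : ContDiffAt ℝ 1 κ (pr (f w₀)) := hc.to_localInverse hcd one_ne_zero
  have hκ0 : κ (pr (f w₀)) = w₀ := hc.localInverse_apply_image hcd one_ne_zero
  have hκt : Tendsto κ (𝓝 (pr (f w₀))) (𝓝 w₀) := by
    have := hκ.continuousAt.tendsto; rwa [hκ0] at this
  have hinv : ∀ᶠ y in 𝓝 (pr (f w₀)), pr (f (κ y)) = y :=
    (hc.hasStrictFDerivAt' hcd one_ne_zero).eventually_right_inverse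
  have hft : Tendsto (fun y => f (κ y)) (𝓝 (pr (f w₀))) (𝓝 (f w₀)) :=
    hf.continuousAt.tendsto.comp hκt
  have hev : ∀ᶠ y in 𝓝 (pr (f w₀)),
      HasFDerivAt (fun y => f (κ y)) (modelLift pr θ (f (κ y))) y := by
    filter_upwards [hinv.eventually_nhds, hκt.eventually hfθ, hft.eventually hb,
      hκ.eventually (by simp), hκt.eventually (hf.eventually (by simp)),
      hft.eventually (hpr.eventually (by simp))] with y h1 h2 h3 h4 h5 h6
    have d1 := (h5.differentiableAt one_ne_zero).hasFDerivAt.comp y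
      (h4.differentiableAt one_ne_zero).hasFDerivAt
    have d2 := (h6.differentiableAt two_ne_zero).hasFDerivAt.comp y d1
    have d3 := d2.unique ((hasFDerivAt_id y).congr_of_eventuallyEq h1)
    convert! d1 using 1
    ext k
    refine ((eq_modelLift h3 (v := fderiv ℝ f (κ y) (fderiv ℝ κ y k)) (h2 _)).trans ?_).symm
    congr 1
    exact congrArg (fun T : F →L[ℝ] F => T k) d3
  have hL := ((contDiffAt_modelLift hpr hθ hbp).differentiableAt one_ne_zero).hasFDerivAt
  have hs := hev.self_of_nhds
  have hL' : HasFDerivAt (modelLift pr θ) (fderiv ℝ (modelLift pr θ) (f w₀)) (f (κ (pr (f w₀)))) := by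
    rwa [hκ0]
  have h2 := hL'.comp (pr (f w₀)) hs
  have := second_derivative_symmetric_of_eventually hev h2
  rw [hκ0] at this
  exact this _ _

end HorizontalLift

/-! ### Vertical and horizontal vectors on a principal bundle -/

section PrincipalCalculus

open Filter Topology

variable {EN : Type*} [NormedAddCommGroup EN] [NormedSpace ℝ EN]
  {EG : Type*} [NormedAddCommGroup EG] [NormedSpace ℝ EG]
  {EP : Type*} [NormedAddCommGroup EP] [NormedSpace ℝ EP]
  {N : Type*} [TopologicalSpace N] [ChartedSpace EN N]
  {G : Type*} [TopologicalSpace G] [ChartedSpace EG G] [Group G]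
  {P : Type*} [TopologicalSpace P] [ChartedSpace EP P]

namespace SmoothPrincipalBundle

variable (B : SmoothPrincipalBundle EN EG EP N G P)

theorem mdifferentiableAt_proj (u : P) : MDifferentiableAt 𝓘(ℝ, EP) 𝓘(ℝ, EN) B.proj u :=
  (B.contMDiff_proj u).mdifferentiableAt (by simp)

theorem mdifferentiableAt_act (p : P × G) :
    MDifferentiableAt (𝓘(ℝ, EP).prod 𝓘(ℝ, EG)) 𝓘(ℝ, EP) (fun p : P × G => B.act p.1 p.2) p :=
  (B.contMDiff_act p).mdifferentiableAt (by simp)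

theorem contMDiff_act_left (a : G) :
    ContMDiff 𝓘(ℝ, EP) 𝓘(ℝ, EP) ∞ (fun u => B.act u a) :=
  B.contMDiff_act.comp (contMDiff_id.prodMk contMDiff_const)

theorem contMDiff_act_right (u : P) :
    ContMDiff 𝓘(ℝ, EG) 𝓘(ℝ, EP) ∞ (fun a => B.act u a) :=
  B.contMDiff_act.comp (contMDiff_const.prodMk contMDiff_id)

theorem mdifferentiableAt_act_left (a : G) (u : P) :
    MDifferentiableAt 𝓘(ℝ, EP) 𝓘(ℝ, EP) (fun u => B.act u a) u :=
  (B.contMDiff_act_left a u).mdifferentiableAt (by simp)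

theorem mdifferentiableAt_act_right (u : P) (a : G) :
    MDifferentiableAt 𝓘(ℝ, EG) 𝓘(ℝ, EP) (fun a => B.act u a) a :=
  (B.contMDiff_act_right u a).mdifferentiableAt (by simp)

theorem act_inv_act (u : P) (a : G) : B.act (B.act u a) a⁻¹ = u := by
  rw [← B.act_mul, mul_inv_cancel, B.act_one]

theorem act_act_inv (u : P) (a : G) : B.act (B.act u a⁻¹) a = u := by
  rw [← B.act_mul, inv_mul_cancel, B.act_one]

theorem exists_act_eq {u v : P} (h : B.proj u = B.proj v) : ∃ a, B.act u a = v := by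
  obtain ⟨U, s, τ, -, hx, -, -, -, h1, -⟩ := B.locally_trivial (B.proj u)
  have hu := h1 u hx
  have hv := h1 v (show B.proj v ∈ U from h ▸ hx)
  refine ⟨(τ u)⁻¹ * τ v, ?_⟩
  rw [B.act_mul]
  have h3 : B.act u (τ u)⁻¹ = s (B.proj u) :=
    (congrArg (fun p => B.act p (τ u)⁻¹) hu).symm.trans (B.act_inv_act _ _)
  rw [h3, h, hv]

theorem act_left_injective (u : P) : Function.Injective (B.act u) := by
  obtain ⟨U, s, τ, -, hx, -, -, -, h1, h2⟩ := B.locally_trivial (B.proj u)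
  intro a b hab
  have hu := h1 u hx
  rw [← hu, ← B.act_mul, ← B.act_mul] at hab
  have := congrArg τ hab
  rw [h2 _ hx, h2 _ hx] at this
  exact mul_left_cancel this

theorem act_eq_self_iff (u : P) (a : G) : B.act u a = u ↔ a = 1 := by
  constructor
  · intro h
    apply B.act_left_injective u
    rw [h, B.act_one]
  · rintro rfl; exact B.act_one u

theorem proj_surjective : Function.Surjective B.proj := by
  intro x
  obtain ⟨U, s, τ, -, hx, -, -, h1, -⟩ := B.locally_trivial x
  exact ⟨s x, h1 x hx⟩

theorem projDeriv_fundamental (A : EG) (u : P) : B.projDeriv u (B.fundamental A u) = 0 := by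
  have h1 : HasMFDerivAt 𝓘(ℝ, EG) 𝓘(ℝ, EP) (fun a : G => B.act u a) 1
    (mfderiv 𝓘(ℝ, EG) 𝓘(ℝ, EP) (fun a : G => B.act u a) 1) :=
    (B.mdifferentiableAt_act_right u 1).hasMFDerivAt
  have h2 := (B.mdifferentiableAt_proj (B.act u 1)).hasMFDerivAt.comp 1 h1
  have h3 : (B.proj ∘ fun a : G => B.act u a) = fun _ => B.proj u := by
    ext a; exact B.proj_act u a
  rw [h3] at h2
  have h4 := hasMFDerivAt_unique h2 (hasMFDerivAt_const (B.proj u) (1 : G))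
  have h5 := congrArg (fun T : EG →L[ℝ] EN => T A) h4
  have h6 : (mfderiv 𝓘(ℝ, EP) 𝓘(ℝ, EN) B.proj (B.act u 1) : EP →L[ℝ] EN)
      ((mfderiv 𝓘(ℝ, EG) 𝓘(ℝ, EP) (fun a : G => B.act u a) 1 : EG →L[ℝ] EP) A) = 0 := h5
  rw [B.act_one] at h6
  exact h6

theorem projDeriv_surjective (u : P) : Function.Surjective (B.projDeriv u) := by
  obtain ⟨U, s, τ, hU, hx, hs, -, h1, h2, -⟩ := B.locally_trivial (B.proj u)
  have hsd : MDifferentiableAt 𝓘(ℝ, EN) 𝓘(ℝ, EP) s (B.proj u) :=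
    (hs.contMDiffAt (hU.mem_nhds hx)).mdifferentiableAt (by simp)
  have hs2 : MDifferentiableAt 𝓘(ℝ, EN) 𝓘(ℝ, EP) (fun y => B.act (s y) (τ u)) (B.proj u) :=
    (B.mdifferentiableAt_act_left (τ u) _).comp (B.proj u) hsd
  have h3 : HasMFDerivAt 𝓘(ℝ, EN) 𝓘(ℝ, EN) (fun y => B.proj (B.act (s y) (τ u))) (B.proj u) _ :=
    (B.mdifferentiableAt_proj _).hasMFDerivAt.comp (B.proj u) hs2.hasMFDerivAt
  have h4 : HasMFDerivAt 𝓘(ℝ, EN) 𝓘(ℝ, EN) (fun y => B.proj (B.act (s y) (τ u))) (B.proj u)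
      (ContinuousLinearMap.id ℝ EN) := by
    refine (hasMFDerivAt_id (B.proj u)).congr_of_eventuallyEq ?_
    filter_upwards [hU.mem_nhds hx] with y hy
    rw [B.proj_act, h1 y hy]; rfl
  have h5 := hasMFDerivAt_unique h3 h4
  intro y
  have h6 := congrArg (fun T : EN →L[ℝ] EN => T y) h5
  have h7 : (mfderiv 𝓘(ℝ, EP) 𝓘(ℝ, EN) B.proj (B.act (s (B.proj u)) (τ u)) : EP →L[ℝ] EN)
      ((mfderiv 𝓘(ℝ, EN) 𝓘(ℝ, EP) (fun y => B.act (s y) (τ u)) (B.proj u) : EN →L[ℝ] EP) y)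
      = y := h6
  rw [h2 u hx] at h7
  exact ⟨_, h7⟩

/-- A vertical vector is a fundamental vector: differentiate `u = s (π u) · τ u`. -/
theorem exists_fundamental_eq [LieGroup 𝓘(ℝ, EG) ∞ G] (u : P) {w : TangentSpace 𝓘(ℝ, EP) u}
    (hw : B.projDeriv u w = 0) : ∃ A, B.fundamental A u = w := by
  obtain ⟨U, s, τ, hU, hx, hs, hτ, h1, h2, -⟩ := B.locally_trivial (B.proj u)
  have hUP : IsOpen (B.proj ⁻¹' U) := hU.preimage B.contMDiff_proj.continuous
  have hsd : MDifferentiableAt 𝓘(ℝ, EN) 𝓘(ℝ, EP) s (B.proj u) :=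
    (hs.contMDiffAt (hU.mem_nhds hx)).mdifferentiableAt (by simp)
  have hτd : MDifferentiableAt 𝓘(ℝ, EP) 𝓘(ℝ, EG) τ u :=
    (hτ.contMDiffAt (hUP.mem_nhds hx)).mdifferentiableAt (by simp)
  have e1 := hsd.hasMFDerivAt.comp u (B.mdifferentiableAt_proj u).hasMFDerivAt
  have e2 := e1.prodMk hτd.hasMFDerivAt
  have e3 := (B.mdifferentiableAt_act ((s ∘ B.proj) u, τ u)).hasMFDerivAt.comp u e2
  have e4 := hasMFDerivAt_unique e3 ((hasMFDerivAt_id u).congr_of_eventuallyEq (by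
    filter_upwards [hUP.mem_nhds hx] with v hv
    exact h2 v hv))
  have e5 := congrArg (fun T : EP →L[ℝ] EP => T w) e4
  have e6 : (mfderiv (𝓘(ℝ, EP).prod 𝓘(ℝ, EG)) 𝓘(ℝ, EP) (fun p : P × G => B.act p.1 p.2)
      (s (B.proj u), τ u) : EP × EG →L[ℝ] EP)
      ((mfderiv 𝓘(ℝ, EN) 𝓘(ℝ, EP) s (B.proj u) : EN →L[ℝ] EP) (B.projDeriv u w),
        (mfderiv 𝓘(ℝ, EP) 𝓘(ℝ, EG) τ u : EP →L[ℝ] EG) w) = w := e5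
  rw [hw] at e6
  set A₀ : EG := (mfderiv 𝓘(ℝ, EP) 𝓘(ℝ, EG) τ u : EP →L[ℝ] EG) w
  have e7 := mfderiv_prod_eq_add_apply (B.mdifferentiableAt_act (s (B.proj u), τ u))
    (v := ((0 : EP), A₀))
  have e8 : (mfderiv 𝓘(ℝ, EG) 𝓘(ℝ, EP) (fun a => B.act (s (B.proj u)) a) (τ u) : EG →L[ℝ] EP) A₀
      = w := by
    rw [← e6]
    erw [map_zero]
    refine Eq.trans ?_ e7.symm
    erw [map_zero, zero_add]
  -- left translation by `(τ u)⁻¹` moves the orbit map of `s (π u)` to that of `u`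
  have f1 : HasMFDerivAt 𝓘(ℝ, EG) 𝓘(ℝ, EG) (fun b : G => (τ u)⁻¹ * b) (τ u)
      (mfderiv 𝓘(ℝ, EG) 𝓘(ℝ, EG) (fun b : G => (τ u)⁻¹ * b) (τ u)) :=
    ((contMDiff_mul_left (I := 𝓘(ℝ, EG)) (n := ∞) (a := (τ u)⁻¹) (τ u)).mdifferentiableAt
      (by simp)).hasMFDerivAt
  have f2 : HasMFDerivAt 𝓘(ℝ, EG) 𝓘(ℝ, EP) (fun a => B.act u a) ((τ u)⁻¹ * τ u)
      (mfderiv 𝓘(ℝ, EG) 𝓘(ℝ, EP) (fun a => B.act u a) (1 : G) : EG →L[ℝ] EP) := by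
    rw [inv_mul_cancel]
    exact (B.mdifferentiableAt_act_right u 1).hasMFDerivAt
  have f3 := f2.comp (τ u) f1
  have f4 : ((fun a => B.act u a) ∘ fun b : G => (τ u)⁻¹ * b) =
      fun a => B.act (s (B.proj u)) a := by
    ext b
    simp only [Function.comp]
    rw [B.act_mul]
    congr 1
    exact (congrArg (fun p => B.act p (τ u)⁻¹) (h2 u hx)).symm.trans (B.act_inv_act _ _)
  rw [f4] at f3
  have f5 := f3.mfderiv
  refine ⟨(mfderiv 𝓘(ℝ, EG) 𝓘(ℝ, EG) (fun b : G => (τ u)⁻¹ * b) (τ u) : EG →L[ℝ] EG) A₀, ?_⟩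
  rw [← e8]
  exact (congrArg (fun T : EG →L[ℝ] EP => T A₀) f5).symm

variable {ℍ : ∀ u : P, Submodule ℝ (TangentSpace 𝓘(ℝ, EP) u)} {Θ : LieAlgForm EG EP P}

variable {B} in
/-- The tangent space splits by `(dπ, Θ)`. -/
theorem IsFormOf.bijective [LieGroup 𝓘(ℝ, EG) ∞ G] (hΘ : B.IsFormOf ℍ Θ) (u : P) :
    Function.Bijective (fun w : TangentSpace 𝓘(ℝ, EP) u => (B.projDeriv u w, Θ u w)) := by
  constructor
  · rw [show (fun w : TangentSpace 𝓘(ℝ, EP) u => (B.projDeriv u w, Θ u w)) =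
      (B.projDeriv u).prod (Θ u) from rfl, injective_iff_map_eq_zero]
    intro w hw
    have h1 : B.projDeriv u w = 0 := congrArg Prod.fst hw
    have h2 : Θ u w = 0 := congrArg Prod.snd hw
    obtain ⟨A, rfl⟩ := B.exists_fundamental_eq u h1
    rw [hΘ.2] at h2
    subst h2
    exact map_zero (mfderiv 𝓘(ℝ, EG) 𝓘(ℝ, EP) (fun a : G => B.act u a) 1 : EG →L[ℝ] EP)
  · rintro ⟨y, A⟩
    obtain ⟨w, hw⟩ := B.projDeriv_surjective u y
    refine ⟨w + B.fundamental (A - Θ u w) u, Prod.ext ?_ ?_⟩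
    · simp only [map_add, B.projDeriv_fundamental, hw, add_zero]
    · simp only [map_add, hΘ.2, add_sub_cancel]

variable {B} in
theorem IsFormOf.eq_of_projDeriv_eq [LieGroup 𝓘(ℝ, EG) ∞ G] (hΘ : B.IsFormOf ℍ Θ) {u : P}
    {v w : TangentSpace 𝓘(ℝ, EP) u} (h : B.projDeriv u v = B.projDeriv u w)
    (hv : Θ u v = 0) (hw : Θ u w = 0) : v = w :=
  (hΘ.bijective u).1 (Prod.ext h (hv.trans hw.symm))

variable {B} in
theorem IsFormOf.exists_horizontal [LieGroup 𝓘(ℝ, EG) ∞ G] (hΘ : B.IsFormOf ℍ Θ) (u : P)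
    (y : TangentSpace 𝓘(ℝ, EN) (B.proj u)) :
    ∃ w : TangentSpace 𝓘(ℝ, EP) u, B.projDeriv u w = y ∧ Θ u w = 0 := by
  obtain ⟨w, hw⟩ := (hΘ.bijective u).2 (y, 0)
  exact ⟨w, congrArg Prod.fst hw, congrArg Prod.snd hw⟩

/-- The kernel of `Θ` is `ℍ`. -/
theorem form_eq_zero_iff [IsManifold 𝓘(ℝ, EP) ∞ P] [LieGroup 𝓘(ℝ, EG) ∞ G] {Φ : Flow ℝ P}
    (hℍ : B.IsDynamicalHorizontal Φ ℍ) (hΘ : B.IsFormOf ℍ Θ) (u : P)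
    (w : TangentSpace 𝓘(ℝ, EP) u) : Θ u w = 0 ↔ w ∈ ℍ u := by
  refine ⟨fun hw => ?_, hΘ.1 u w⟩
  obtain ⟨Es, Eu, ⟨hT, -⟩, hH⟩ := hℍ
  have htop : w ∈ (Es u ⊔ B.central Φ u) ⊔ Eu u := by
    rw [(hT u).2.sup_eq_top]; trivial
  obtain ⟨x, hx, vu, hvu, rfl⟩ := Submodule.mem_sup.1 htop
  obtain ⟨vs, hvs, vc, hvc, rfl⟩ := Submodule.mem_sup.1 hx
  obtain ⟨vX, hvX, vV, hvV, rfl⟩ := Submodule.mem_sup.1 hvc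
  have hs : vs ∈ ℍ u := by rw [hH]; exact Submodule.mem_sup_left (Submodule.mem_sup_left hvs)
  have hu : vu ∈ ℍ u := by rw [hH]; exact Submodule.mem_sup_left (Submodule.mem_sup_right hvu)
  have hX : vX ∈ ℍ u := by rw [hH]; exact Submodule.mem_sup_right hvX
  obtain ⟨A, rfl⟩ := B.exists_fundamental_eq u (w := vV) hvV
  simp only [map_add, hΘ.1 u _ hs, hΘ.1 u _ hu, hΘ.1 u _ hX, hΘ.2, zero_add, add_zero] at hw
  subst hw
  have h0 : B.fundamental (0 : EG) u = 0 :=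
    map_zero (mfderiv 𝓘(ℝ, EG) 𝓘(ℝ, EP) (fun a : G => B.act u a) 1 : EG →L[ℝ] EP)
  rw [h0, add_zero]
  exact add_mem (add_mem hs hX) hu

end SmoothPrincipalBundle

end PrincipalCalculus

/-! ### Differentials as maps between the model spaces -/

section ModelDeriv

open Filter Topology

variable {E : Type*} [NormedAddCommGroup E] [NormedSpace ℝ E]
  {M : Type*} [TopologicalSpace M] [ChartedSpace E M]
  {E' : Type*} [NormedAddCommGroup E'] [NormedSpace ℝ E']
  {M' : Type*} [TopologicalSpace M'] [ChartedSpace E' M']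
  {E'' : Type*} [NormedAddCommGroup E''] [NormedSpace ℝ E'']
  {M'' : Type*} [TopologicalSpace M''] [ChartedSpace E'' M'']

variable (E E') in
/-- The differential of `f` at `x`, as a linear map between the model spaces, with which the tangent
spaces are identified. -/
def modelDeriv (f : M → M') (x : M) : E →L[ℝ] E' := mfderiv 𝓘(ℝ, E) 𝓘(ℝ, E') f x

/-- A 1-form, as a function with values in the linear maps on the model space. -/
def modelForm {𝔤 : Type*} [NormedAddCommGroup 𝔤] [NormedSpace ℝ 𝔤]
    (θ : ∀ u : M, TangentSpace 𝓘(ℝ, E) u →L[ℝ] 𝔤) : M → E →L[ℝ] 𝔤 := fun u => θ u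

theorem modelDeriv_comp {g : M' → M''} {f : M → M'} (x : M)
    (hg : MDifferentiableAt 𝓘(ℝ, E') 𝓘(ℝ, E'') g (f x))
    (hf : MDifferentiableAt 𝓘(ℝ, E) 𝓘(ℝ, E') f x) :
    modelDeriv E E'' (fun x => g (f x)) x = (modelDeriv E' E'' g (f x)).comp (modelDeriv E E' f x) :=
  mfderiv_comp x hg hf

theorem modelDeriv_comp_apply {g : M' → M''} {f : M → M'} (x : M)
    (hg : MDifferentiableAt 𝓘(ℝ, E') 𝓘(ℝ, E'') g (f x))
    (hf : MDifferentiableAt 𝓘(ℝ, E) 𝓘(ℝ, E') f x) (v : E) :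
    modelDeriv E E'' (fun x => g (f x)) x v = modelDeriv E' E'' g (f x) (modelDeriv E E' f x v) := by
  rw [modelDeriv_comp x hg hf]; rfl

theorem modelDeriv_congr {f g : M → M'} {x : M} (h : f =ᶠ[𝓝 x] g) :
    modelDeriv E E' f x = modelDeriv E E' g x :=
  h.mfderiv_eq

@[simp]
theorem modelDeriv_id (x : M) : modelDeriv E E (fun x : M => x) x = ContinuousLinearMap.id ℝ E :=
  mfderiv_id

theorem modelDeriv_const (c : M') (x : M) : modelDeriv E E' (fun _ : M => c) x = 0 :=
  mfderiv_const

theorem modelDeriv_eq_fderiv (f : E → E') (x : E) : modelDeriv E E' f x = fderiv ℝ f x :=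
  mfderiv_eq_fderiv

/-- The differential of a map which is locally the identity. -/
theorem modelDeriv_eq_id {f : M → M} {x : M} (h : ∀ᶠ y in 𝓝 x, f y = y) :
    modelDeriv E E f x = ContinuousLinearMap.id ℝ E := by
  rw [modelDeriv_congr (g := fun y => y) h, modelDeriv_id]

/-- The differential of a left inverse is a left inverse of the differential. -/
theorem modelDeriv_modelDeriv_of_leftInverse {g : M' → M} {f : M → M'} (x : M)
    (h : ∀ᶠ y in 𝓝 x, g (f y) = y)
    (hg : MDifferentiableAt 𝓘(ℝ, E') 𝓘(ℝ, E) g (f x))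
    (hf : MDifferentiableAt 𝓘(ℝ, E) 𝓘(ℝ, E') f x) (v : E) :
    modelDeriv E' E g (f x) (modelDeriv E E' f x v) = v := by
  rw [← modelDeriv_comp_apply x hg hf, modelDeriv_eq_id h]; rfl

end ModelDeriv

/-! ### Forms read in charts -/

section ChartReading

open Filter Topology

variable {E : Type*} [NormedAddCommGroup E] [NormedSpace ℝ E]
  {M : Type*} [TopologicalSpace M] [ChartedSpace E M]

variable {𝔤 : Type*} [NormedAddCommGroup 𝔤] [NormedSpace ℝ 𝔤]
  {θ : ∀ u : M, TangentSpace 𝓘(ℝ, E) u →L[ℝ] 𝔤}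

theorem oneFormInChart_apply (x : M) (p v : E) : oneFormInChart θ x p v =
    modelForm θ ((extChartAt 𝓘(ℝ, E) x).symm p)
      (modelDeriv E E (extChartAt 𝓘(ℝ, E) x).symm p v) := rfl

variable [IsManifold 𝓘(ℝ, E) ∞ M]

theorem mdifferentiableAt_extChartAt_symm' {x : M} {p : E} (hp : p ∈ (extChartAt 𝓘(ℝ, E) x).target) :
    MDifferentiableAt 𝓘(ℝ, E) 𝓘(ℝ, E) (extChartAt 𝓘(ℝ, E) x).symm p := by
  have := mdifferentiableWithinAt_extChartAt_symm (I := 𝓘(ℝ, E)) hp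
  rwa [modelWithCornersSelf_coe, Set.range_id, mdifferentiableWithinAt_univ] at this

theorem mdifferentiableAt_extChartAt'' {x u : M} (hu : u ∈ (extChartAt 𝓘(ℝ, E) x).source) :
    MDifferentiableAt 𝓘(ℝ, E) 𝓘(ℝ, E) (extChartAt 𝓘(ℝ, E) x) u :=
  mdifferentiableAt_extChartAt (by rwa [extChartAt_source] at hu)

theorem modelDeriv_extChartAt_symm {x : M} {p : E} (hp : p ∈ (extChartAt 𝓘(ℝ, E) x).target)
    (v : E) :
    modelDeriv E E (extChartAt 𝓘(ℝ, E) x) ((extChartAt 𝓘(ℝ, E) x).symm p)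
      (modelDeriv E E (extChartAt 𝓘(ℝ, E) x).symm p v) = v := by
  refine modelDeriv_modelDeriv_of_leftInverse p ?_
    (mdifferentiableAt_extChartAt'' ((extChartAt 𝓘(ℝ, E) x).map_target hp))
    (mdifferentiableAt_extChartAt_symm' hp) v
  filter_upwards [(isOpen_extChartAt_target (I := 𝓘(ℝ, E)) x).mem_nhds hp] with q hq
  exact (extChartAt 𝓘(ℝ, E) x).right_inv hq

theorem modelDeriv_symm_extChartAt {x u : M} (hu : u ∈ (extChartAt 𝓘(ℝ, E) x).source)
    (v : E) :
    modelDeriv E E (extChartAt 𝓘(ℝ, E) x).symm (extChartAt 𝓘(ℝ, E) x u)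
      (modelDeriv E E (extChartAt 𝓘(ℝ, E) x) u v) = v := by
  refine modelDeriv_modelDeriv_of_leftInverse u ?_
    (mdifferentiableAt_extChartAt_symm' ((extChartAt 𝓘(ℝ, E) x).map_source hu))
    (mdifferentiableAt_extChartAt'' hu) v
  filter_upwards [(isOpen_extChartAt_source (I := 𝓘(ℝ, E)) x).mem_nhds hu] with q hq
  exact (extChartAt 𝓘(ℝ, E) x).left_inv hq

theorem modelDeriv_extChartAt_self (u : M) (v : E) :
    modelDeriv E E (extChartAt 𝓘(ℝ, E) u) u v = v := by
  have h := mfderiv_extChartAt_self (I := 𝓘(ℝ, E)) (x := u)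
  exact congrArg (fun T : E →L[ℝ] E => T v) h

theorem oneFormInChart_modelDeriv {x u : M} (hu : u ∈ (extChartAt 𝓘(ℝ, E) x).source) (v : E) :
    oneFormInChart θ x (extChartAt 𝓘(ℝ, E) x u) (modelDeriv E E (extChartAt 𝓘(ℝ, E) x) u v) =
      modelForm θ u v := by
  rw [oneFormInChart_apply, modelDeriv_symm_extChartAt hu, (extChartAt 𝓘(ℝ, E) x).left_inv hu]

theorem oneFormInChart_self (u : M) (v : E) :
    oneFormInChart θ u (extChartAt 𝓘(ℝ, E) u u) v = modelForm θ u v := by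
  have h := oneFormInChart_modelDeriv (θ := θ) (mem_extChartAt_source (I := 𝓘(ℝ, E)) u) v
  rwa [modelDeriv_extChartAt_self] at h

/-- A form which is `C¹` as a function on the tangent bundle is `C¹` in charts. -/
theorem contDiffOn_oneFormInChart [FiniteDimensional ℝ E]
    (hθ : ContMDiff 𝓘(ℝ, E).tangent 𝓘(ℝ, 𝔤) 1 (fun v : TangentBundle 𝓘(ℝ, E) M => θ v.1 v.2))
    (x : M) : ContDiffOn ℝ 1 (oneFormInChart θ x) (extChartAt 𝓘(ℝ, E) x).target := by
  have hopen := isOpen_extChartAt_target (I := 𝓘(ℝ, E)) x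
  rw [contDiffOn_clm_apply]
  intro v
  have h1 := (contMDiffOn_extChartAt_symm (I := 𝓘(ℝ, E)) (n := ∞) x).contMDiffOn_tangentMapWithin
    (m := 1) (by norm_cast) hopen.uniqueMDiffOn
  have h2 : ContMDiff 𝓘(ℝ, E) 𝓘(ℝ, E).tangent 1
      (fun y => (⟨y, v⟩ : TangentBundle 𝓘(ℝ, E) E)) :=
    contMDiff_vectorSpace_iff_contDiff.2 contDiff_const
  have h3 := h1.comp h2.contMDiffOn (s := (extChartAt 𝓘(ℝ, E) x).target) (fun y hy => hy)
  rw [← contMDiffOn_iff_contDiffOn]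
  refine (hθ.comp_contMDiffOn h3).congr fun y hy => ?_
  simp only [Function.comp, tangentMapWithin]
  rw [mfderivWithin_of_isOpen hopen hy]
  rfl

/-- The vanishing of `dθ` on `ker θ`, in terms of an arbitrary chart. The transition map `ψ` to
the preferred chart at a point pulls back one reading of `θ` to the other, and the term with the
second derivative of `ψ` is symmetric. -/
theorem fderiv_oneFormInChart_symm [FiniteDimensional ℝ E]
    (hθ : ContMDiff 𝓘(ℝ, E).tangent 𝓘(ℝ, 𝔤) 1 (fun v : TangentBundle 𝓘(ℝ, E) M => θ v.1 v.2))
    (hd : ∀ (u : M) (v w : E), modelForm θ u v = 0 → modelForm θ u w = 0 →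
      extDerivOneForm θ u v w = 0)
    (x : M) {p : E} (hp : p ∈ (extChartAt 𝓘(ℝ, E) x).target) {v w : E}
    (hv : oneFormInChart θ x p v = 0) (hw : oneFormInChart θ x p w = 0) :
    fderiv ℝ (oneFormInChart θ x) p v w = fderiv ℝ (oneFormInChart θ x) p w v := by
  set c := extChartAt 𝓘(ℝ, E) x with hc
  set u := c.symm p with hu
  set c' := extChartAt 𝓘(ℝ, E) u with hc'
  set ψ : E → E := fun y => c' (c.symm y)
  have hopen : IsOpen c.target := isOpen_extChartAt_target x
  have hcs : ContinuousAt c.symm p :=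
    (mdifferentiableAt_extChartAt_symm' hp).continuousAt
  have hΩ : ∀ᶠ y in 𝓝 p, y ∈ c.target ∧ c.symm y ∈ c'.source := by
    have h1 : ∀ᶠ y in 𝓝 p, y ∈ c.target := hopen.mem_nhds hp
    exact h1.and (hcs.eventually (extChartAt_source_mem_nhds u))
  have hψ : ContDiffAt ℝ 2 ψ p := by
    rw [← contMDiffAt_iff_contDiffAt]
    have h1 : ContMDiffAt 𝓘(ℝ, E) 𝓘(ℝ, E) 2 c.symm p :=
      (contMDiffOn_extChartAt_symm x).contMDiffAt (hopen.mem_nhds hp)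
    exact (contMDiffAt_extChartAt (I := 𝓘(ℝ, E)) (n := 2) (x := u)).comp p h1
  have hψp : ψ p = c' u := rfl
  have hθψ : ∀ᶠ y in 𝓝 p, oneFormInChart θ x y = (oneFormInChart θ u (ψ y)).comp (fderiv ℝ ψ y) := by
    filter_upwards [hΩ] with y hy
    ext k
    rw [ContinuousLinearMap.comp_apply, ← modelDeriv_eq_fderiv,
      modelDeriv_comp_apply y (mdifferentiableAt_extChartAt'' hy.2)
        (mdifferentiableAt_extChartAt_symm' hy.1), oneFormInChart_modelDeriv hy.2,
      oneFormInChart_apply]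
  have hθu : DifferentiableAt ℝ (oneFormInChart θ u) (ψ p) :=
    ((contDiffOn_oneFormInChart hθ u).contDiffAt
      ((isOpen_extChartAt_target u).mem_nhds (mem_extChartAt_target u))).differentiableAt one_ne_zero
  have hψ1 : DifferentiableAt ℝ ψ p := hψ.differentiableAt two_ne_zero
  have hψ2 : DifferentiableAt ℝ (fderiv ℝ ψ) p :=
    ContDiffAt.differentiableAt (n := 1) (hψ.fderiv_right (by norm_num)) one_ne_zero
  have hder : HasFDerivAt (fun y => (oneFormInChart θ u (ψ y)).comp (fderiv ℝ ψ y)) _ p :=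
    (hθu.hasFDerivAt.comp p hψ1.hasFDerivAt).clm_comp hψ2.hasFDerivAt
  have hfd := (hder.congr_of_eventuallyEq hθψ).fderiv
  have hp0 := hθψ.self_of_nhds
  have hsymm : fderiv ℝ (fderiv ℝ ψ) p v w = fderiv ℝ (fderiv ℝ ψ) p w v :=
    (hψ.isSymmSndFDerivAt (by simp)) v w
  rw [hp0] at hv hw
  have hv' : modelForm θ u (fderiv ℝ ψ p v) = 0 := by rw [← oneFormInChart_self]; exact hv
  have hw' : modelForm θ u (fderiv ℝ ψ p w) = 0 := by rw [← oneFormInChart_self]; exact hw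
  have key : fderiv ℝ (oneFormInChart θ u) (c' u) (fderiv ℝ ψ p v) (fderiv ℝ ψ p w) =
      fderiv ℝ (oneFormInChart θ u) (c' u) (fderiv ℝ ψ p w) (fderiv ℝ ψ p v) :=
    sub_eq_zero.1 (hd u (fderiv ℝ ψ p v) (fderiv ℝ ψ p w) hv' hw')
  rw [hfd]
  simp [hsymm, hψp, key]

end ChartReading

section BundleChart

open Filter Topology

variable {EN : Type*} [NormedAddCommGroup EN] [NormedSpace ℝ EN]
  {EG : Type*} [NormedAddCommGroup EG] [NormedSpace ℝ EG]
  {EP : Type*} [NormedAddCommGroup EP] [NormedSpace ℝ EP]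
  {N : Type*} [TopologicalSpace N] [ChartedSpace EN N]
  {G : Type*} [TopologicalSpace G] [ChartedSpace EG G] [Group G]
  {P : Type*} [TopologicalSpace P] [ChartedSpace EP P]

namespace SmoothPrincipalBundle

variable (B : SmoothPrincipalBundle EN EG EP N G P)

/-- The projection read in the preferred charts at `u` and at `π u`. -/
def projInChart (u : P) : EP → EN := fun p =>
  extChartAt 𝓘(ℝ, EN) (B.proj u) (B.proj ((extChartAt 𝓘(ℝ, EP) u).symm p))

/-- The open set on which the projection is read in charts. -/
def chartDomain (u : P) : Set EP :=
  (extChartAt 𝓘(ℝ, EP) u).target ∩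
    (extChartAt 𝓘(ℝ, EP) u).symm ⁻¹' (B.proj ⁻¹' (extChartAt 𝓘(ℝ, EN) (B.proj u)).source)

theorem isOpen_chartDomain (u : P) : IsOpen (B.chartDomain u) :=
  (continuousOn_extChartAt_symm u).isOpen_inter_preimage (isOpen_extChartAt_target u)
    ((isOpen_extChartAt_source (B.proj u)).preimage B.contMDiff_proj.continuous)

theorem mem_chartDomain (u : P) : extChartAt 𝓘(ℝ, EP) u u ∈ B.chartDomain u := by
  refine ⟨mem_extChartAt_target u, ?_⟩
  rw [Set.mem_preimage, extChartAt_to_inv u]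
  exact mem_extChartAt_source (B.proj u)

variable [IsManifold 𝓘(ℝ, EN) ∞ N] [IsManifold 𝓘(ℝ, EP) ∞ P]

theorem contDiffOn_projInChart (u : P) : ContDiffOn ℝ 2 (B.projInChart u) (B.chartDomain u) := by
  rw [← contMDiffOn_iff_contDiffOn]
  have h1 : ContMDiffOn 𝓘(ℝ, EP) 𝓘(ℝ, EN) 2 (B.proj ∘ (extChartAt 𝓘(ℝ, EP) u).symm)
      (B.chartDomain u) :=
    (B.contMDiff_proj.of_le (by norm_cast)).comp_contMDiffOn
      ((contMDiffOn_extChartAt_symm (I := 𝓘(ℝ, EP)) u).mono Set.inter_subset_left)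
  have h2 : ContMDiffOn 𝓘(ℝ, EN) 𝓘(ℝ, EN) 2 (extChartAt 𝓘(ℝ, EN) (B.proj u))
      (extChartAt 𝓘(ℝ, EN) (B.proj u)).source := by
    rw [extChartAt_source]; exact contMDiffOn_extChartAt
  exact h2.comp h1 fun p hp => hp.2

theorem fderiv_projInChart {u : P} {p : EP} (hp : p ∈ B.chartDomain u) (v : EP) :
    fderiv ℝ (B.projInChart u) p v =
      modelDeriv EN EN (extChartAt 𝓘(ℝ, EN) (B.proj u)) (B.proj ((extChartAt 𝓘(ℝ, EP) u).symm p))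
      (modelDeriv EP EN B.proj ((extChartAt 𝓘(ℝ, EP) u).symm p)
      (modelDeriv EP EP (extChartAt 𝓘(ℝ, EP) u).symm p v)) := by
  have h1 := mdifferentiableAt_extChartAt_symm' (E := EP) hp.1
  have h2 := B.mdifferentiableAt_proj ((extChartAt 𝓘(ℝ, EP) u).symm p)
  rw [← modelDeriv_eq_fderiv, ← modelDeriv_comp_apply p h2 h1]
  exact modelDeriv_comp_apply p (g := extChartAt 𝓘(ℝ, EN) (B.proj u))
    (f := fun p => B.proj ((extChartAt 𝓘(ℝ, EP) u).symm p))
    (mdifferentiableAt_extChartAt'' (E := EN) hp.2) (h2.comp p h1) v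

variable {ℍ : ∀ u : P, Submodule ℝ (TangentSpace 𝓘(ℝ, EP) u)} {Θ : LieAlgForm EG EP P}

variable {B} in
theorem IsFormOf.bijective_inChart [LieGroup 𝓘(ℝ, EG) ∞ G] (hΘ : B.IsFormOf ℍ Θ) (u : P)
    {p : EP} (hp : p ∈ B.chartDomain u) :
    Function.Bijective ((fderiv ℝ (B.projInChart u) p).prod (oneFormInChart Θ u p)) := by
  have hb : Function.Bijective (fun w : EP =>
      (modelDeriv EP EN B.proj ((extChartAt 𝓘(ℝ, EP) u).symm p) w,
        modelForm Θ ((extChartAt 𝓘(ℝ, EP) u).symm p) w)) := hΘ.bijective _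
  have hP : Function.Bijective (modelDeriv EP EP (extChartAt 𝓘(ℝ, EP) u).symm p) := by
    refine Function.bijective_iff_has_inverse.2
      ⟨modelDeriv EP EP (extChartAt 𝓘(ℝ, EP) u) ((extChartAt 𝓘(ℝ, EP) u).symm p),
        modelDeriv_extChartAt_symm hp.1, fun v => ?_⟩
    have h := modelDeriv_symm_extChartAt ((extChartAt 𝓘(ℝ, EP) u).map_target hp.1) v
    rwa [(extChartAt 𝓘(ℝ, EP) u).right_inv hp.1] at h
  have hN : Function.Bijective (modelDeriv EN EN (extChartAt 𝓘(ℝ, EN) (B.proj u))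
      (B.proj ((extChartAt 𝓘(ℝ, EP) u).symm p))) := by
    refine Function.bijective_iff_has_inverse.2 ⟨modelDeriv EN EN (extChartAt 𝓘(ℝ, EN) (B.proj u)).symm
      (extChartAt 𝓘(ℝ, EN) (B.proj u) (B.proj ((extChartAt 𝓘(ℝ, EP) u).symm p))),
        modelDeriv_symm_extChartAt hp.2, fun v => ?_⟩
    have h := modelDeriv_extChartAt_symm ((extChartAt 𝓘(ℝ, EN) (B.proj u)).map_source hp.2) v
    rwa [(extChartAt 𝓘(ℝ, EN) (B.proj u)).left_inv hp.2] at h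
  have := (hN.prodMap (Function.bijective_id (α := EG))).comp (hb.comp hP)
  convert! this using 1
  ext v
  · exact B.fderiv_projInChart hp v
  · rfl

end SmoothPrincipalBundle

end BundleChart

/-! ### Vanishing curvature, integral manifolds and horizontal sections -/

section Curvature

open Filter Topology Set

variable {EN : Type*} [NormedAddCommGroup EN] [NormedSpace ℝ EN]
  {EG : Type*} [NormedAddCommGroup EG] [NormedSpace ℝ EG]
  {EP : Type*} [NormedAddCommGroup EP] [NormedSpace ℝ EP]
  {N : Type*} [TopologicalSpace N] [ChartedSpace EN N]
  {G : Type*} [TopologicalSpace G] [ChartedSpace EG G] [Group G]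
  {P : Type*} [TopologicalSpace P] [ChartedSpace EP P]

namespace SmoothPrincipalBundle

variable (B : SmoothPrincipalBundle EN EG EP N G P)
  {ℍ : ∀ u : P, Submodule ℝ (TangentSpace 𝓘(ℝ, EP) u)} {Θ : LieAlgForm EG EP P}

theorem lieAlgBracket_zero : lieAlgBracket EG G 0 0 = 0 := by
  change (Bracket.bracket (0 : GroupLieAlgebra 𝓘(ℝ, EG) G) (0 : GroupLieAlgebra 𝓘(ℝ, EG) G)) = 0
  rw [GroupLieAlgebra.bracket_def, VectorField.mlieBracket_self]
  rfl

variable {B} in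
/-- The curvature vanishes if and only if `dΘ` vanishes on horizontal vectors: the bracket term of
`Ω` vanishes there. -/
theorem IsFormOf.curvature_eq_zero_iff [LieGroup 𝓘(ℝ, EG) ∞ G] (hΘ : B.IsFormOf ℍ Θ) :
    (∀ u (y z : TangentSpace 𝓘(ℝ, EN) (B.proj u)), B.curvature Θ u y z = 0) ↔
    ∀ (u : P) (v w : EP), modelForm Θ u v = 0 → modelForm Θ u w = 0 →
      extDerivOneForm Θ u v w = 0 := by
  have hlift : ∀ (u : P) (y : TangentSpace 𝓘(ℝ, EN) (B.proj u)),
      (B.projDeriv u (B.horizontalLift Θ u y), Θ u (B.horizontalLift Θ u y)) = (y, (0 : EG)) :=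
    fun u y => Function.invFun_eq ((hΘ.bijective u).2 (y, 0))
  have hcurv : ∀ (u : P) (v w : EP), modelForm Θ u v = 0 → modelForm Θ u w = 0 →
      B.curvatureForm Θ u v w = extDerivOneForm Θ u v w := by
    intro u v w hv hw
    change extDerivOneForm Θ u v w +
      lieAlgBracket EG G (modelForm Θ u v) (modelForm Θ u w) = _
    rw [hv, hw, lieAlgBracket_zero, add_zero]
  constructor
  · intro h u v w hv hw
    have e : ∀ v : EP, modelForm Θ u v = 0 →
        B.horizontalLift Θ u (modelDeriv EP EN B.proj u v) = v := fun v hv =>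
      hΘ.eq_of_projDeriv_eq (congrArg Prod.fst (hlift u _)) (congrArg Prod.snd (hlift u _)) hv
    have h1 := h u (modelDeriv EP EN B.proj u v) (modelDeriv EP EN B.proj u w)
    change B.curvatureForm Θ u (B.horizontalLift Θ u (modelDeriv EP EN B.proj u v))
      (B.horizontalLift Θ u (modelDeriv EP EN B.proj u w)) = 0 at h1
    rw [e v hv, e w hw] at h1
    exact (hcurv u v w hv hw).symm.trans h1
  · intro h u y z
    have hy : modelForm Θ u (B.horizontalLift Θ u y) = 0 := congrArg Prod.snd (hlift u y)
    have hz : modelForm Θ u (B.horizontalLift Θ u z) = 0 := congrArg Prod.snd (hlift u z)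
    exact (hcurv u _ _ hy hz).trans (h u _ _ hy hz)

variable [IsManifold 𝓘(ℝ, EN) ∞ N] [IsManifold 𝓘(ℝ, EP) ∞ P] [FiniteDimensional ℝ EP]
  [FiniteDimensional ℝ EN]

/-- If `ℍ = ker Θ` is integrable then `dΘ` vanishes on `ℍ`. -/
theorem extDerivOneForm_eq_zero_of_integrable [LieGroup 𝓘(ℝ, EG) ∞ G] (hΘ : B.IsFormOf ℍ Θ)
    (hker : ∀ (u : P) (w : TangentSpace 𝓘(ℝ, EP) u), Θ u w = 0 ↔ w ∈ ℍ u)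
    (hΘ1 : IsC1Form Θ) (hint : IsIntegrableDistribution ℍ) (u : P) (v w : EP)
    (hv : modelForm Θ u v = 0) (hw : modelForm Θ u w = 0) : extDerivOneForm Θ u v w = 0 := by
  obtain ⟨k, W, f, hW, h0, rfl, hf, himm⟩ := hint u
  set u := f 0
  set c := extChartAt 𝓘(ℝ, EP) u with hc
  have hfm : ∀ w ∈ W, ContMDiffAt 𝓘(ℝ, EuclideanSpace ℝ (Fin k)) 𝓘(ℝ, EP) 1 f w := fun w hw =>
    hf.contMDiffAt (hW.mem_nhds hw)
  have hsrc : ∀ᶠ w in 𝓝 (0 : EuclideanSpace ℝ (Fin k)), w ∈ W ∧ f w ∈ c.source := by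
    have h1 : ∀ᶠ w in 𝓝 (0 : EuclideanSpace ℝ (Fin k)), w ∈ W := hW.mem_nhds h0
    exact h1.and ((hfm 0 h0).continuousAt.eventually (extChartAt_source_mem_nhds (I := 𝓘(ℝ, EP)) u))
  have hder : ∀ᶠ w in 𝓝 (0 : EuclideanSpace ℝ (Fin k)), ∀ v, fderiv ℝ (fun w => c (f w)) w v =
      modelDeriv EP EP c (f w) (modelDeriv (EuclideanSpace ℝ (Fin k)) EP f w v) := by
    filter_upwards [hsrc] with w hw v
    rw [← modelDeriv_eq_fderiv, modelDeriv_comp_apply w (mdifferentiableAt_extChartAt'' hw.2)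
      ((hfm w hw.1).mdifferentiableAt one_ne_zero)]
  have hhor : ∀ w ∈ W, ∀ v : EuclideanSpace ℝ (Fin k),
      modelForm Θ (f w) (modelDeriv (EuclideanSpace ℝ (Fin k)) EP f w v) = 0 := by
    intro w hw v
    have : (modelDeriv (EuclideanSpace ℝ (Fin k)) EP f w v : EP) ∈ ℍ (f w) := by
      rw [← (himm w hw).2]
      exact ⟨v, rfl⟩
    exact (hker _ _).2 this
  have hp : c u ∈ B.chartDomain u := B.mem_chartDomain u
  have hpn := (B.isOpen_chartDomain u).mem_nhds hp
  have hsymm := fderiv_form_symm_of_horizontal (pr := B.projInChart u) (θ := oneFormInChart Θ u)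
    (p := c u) (f := fun w => c (f w)) (w₀ := 0) (v := v) (w := w)
    ((B.contDiffOn_projInChart u).contDiffAt hpn)
    ((contDiffOn_oneFormInChart hΘ1 u).contDiffAt
      ((isOpen_extChartAt_target u).mem_nhds (mem_extChartAt_target u)))
    (Filter.eventually_of_mem hpn fun p hp => hΘ.bijective_inChart u hp)
    (by
      rw [← contMDiffAt_iff_contDiffAt]
      exact (contMDiffAt_extChartAt (I := 𝓘(ℝ, EP)) (n := 1) (x := u)).comp 0 (hfm 0 h0))
    rfl
    (by
      filter_upwards [hsrc, hder] with w hw hd v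
      rw [hd v, oneFormInChart_modelDeriv hw.2, hhor w hw.1])
    (by
      have hd := hder.self_of_nhds
      have e : ∀ v, fderiv ℝ (B.projInChart u) (c u) (fderiv ℝ (fun w => c (f w)) 0 v) =
          modelDeriv EP EN B.proj u (modelDeriv (EuclideanSpace ℝ (Fin k)) EP f 0 v) := by
        intro v
        rw [hd v, B.fderiv_projInChart hp, modelDeriv_symm_extChartAt (mem_extChartAt_source u),
          hc, extChartAt_to_inv, modelDeriv_extChartAt_self]
      simp only [e]
      constructor
      · intro v₁ v₂ h12
        apply (himm 0 h0).1
        exact hΘ.eq_of_projDeriv_eq h12 (hhor 0 h0 v₁) (hhor 0 h0 v₂)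
      · intro y
        obtain ⟨w, hw1, hw2⟩ := hΘ.exists_horizontal u y
        rw [hker, ← (himm 0 h0).2] at hw2
        obtain ⟨v, rfl⟩ := hw2
        exact ⟨v, hw1⟩)
    (by rw [hc, oneFormInChart_self]; exact hv) (by rw [hc, oneFormInChart_self]; exact hw)
  exact sub_eq_zero.2 hsymm

omit [IsManifold 𝓘(ℝ, EN) ∞ N] [IsManifold 𝓘(ℝ, EP) ∞ P] [FiniteDimensional ℝ EP]
  [FiniteDimensional ℝ EN] in
variable (Θ) in
/-- `s` is a horizontal `C¹` section of the bundle over the open set `U`. -/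
structure IsHorizontalSection (U : Set N) (s : N → P) : Prop where
  isOpen : IsOpen U
  contMDiffOn : ContMDiffOn 𝓘(ℝ, EN) 𝓘(ℝ, EP) 1 s U
  proj_eq : ∀ y ∈ U, B.proj (s y) = y
  horizontal : ∀ y ∈ U, ∀ v, modelForm Θ (s y) (modelDeriv EN EP s y v) = 0

omit [FiniteDimensional ℝ EN] in
/-- If `dΘ` vanishes on horizontal vectors, there is a horizontal section through every point. -/
theorem exists_isHorizontalSection [LieGroup 𝓘(ℝ, EG) ∞ G] (hΘ : B.IsFormOf ℍ Θ)
    (hΘ1 : IsC1Form Θ) (hd : ∀ (u : P) (v w : EP), modelForm Θ u v = 0 → modelForm Θ u w = 0 →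
      extDerivOneForm Θ u v w = 0) (u : P) :
    ∃ (U : Set N) (s : N → P), B.IsHorizontalSection Θ U s ∧ B.proj u ∈ U ∧ s (B.proj u) = u := by
  set c := extChartAt 𝓘(ℝ, EP) u with hc
  set cN := extChartAt 𝓘(ℝ, EN) (B.proj u) with hcN
  have hpr : B.projInChart u (c u) = cN (B.proj u) := by
    rw [projInChart, hc, extChartAt_to_inv]
  obtain ⟨V, s, hV, h0V, hs0, hs1, hs⟩ := exists_horizontal_section_model
    (B.isOpen_chartDomain u) (B.contDiffOn_projInChart u)
    ((contDiffOn_oneFormInChart hΘ1 u).mono inter_subset_left)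
    (fun p hp => hΘ.bijective_inChart u hp)
    (fun p hp v w hv hw => fderiv_oneFormInChart_symm hΘ1 hd u hp.1 hv hw) (B.mem_chartDomain u)
  rw [← hc, hpr] at h0V hs0
  set U : Set N := cN.source ∩ cN ⁻¹' V
  have hU : IsOpen U :=
    (continuousOn_extChartAt (B.proj u)).isOpen_inter_preimage (isOpen_extChartAt_source _) hV
  have hsV : ContMDiffOn 𝓘(ℝ, EN) 𝓘(ℝ, EP) 1 s V := contMDiffOn_iff_contDiffOn.2 hs1
  have hcNm : ContMDiffOn 𝓘(ℝ, EN) 𝓘(ℝ, EN) 1 cN cN.source := by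
    rw [hcN, extChartAt_source]; exact contMDiffOn_extChartAt
  have hcm : ContMDiffOn 𝓘(ℝ, EP) 𝓘(ℝ, EP) 1 c.symm c.target := contMDiffOn_extChartAt_symm u
  have hsm : ContMDiffOn 𝓘(ℝ, EN) 𝓘(ℝ, EP) 1 (fun y => s (cN y)) U :=
    hsV.comp (hcNm.mono inter_subset_left) fun y hy => hy.2
  refine ⟨U, fun y => c.symm (s (cN y)), ⟨hU, ?_, ?_, ?_⟩, ⟨mem_extChartAt_source _, h0V⟩, ?_⟩
  · exact hcm.comp hsm fun y hy => (hs _ hy.2).1.1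
  · intro y hy
    obtain ⟨h1, h2, -⟩ := hs _ hy.2
    exact cN.injOn h1.2 hy.1 h2
  · intro y hy v
    obtain ⟨h1, -, h3⟩ := hs _ hy.2
    have d1 : MDifferentiableAt 𝓘(ℝ, EN) 𝓘(ℝ, EP) (fun y => s (cN y)) y :=
      (hsm.contMDiffAt (hU.mem_nhds hy)).mdifferentiableAt one_ne_zero
    rw [modelDeriv_comp_apply (g := c.symm) (f := fun y => s (cN y)) y
      (mdifferentiableAt_extChartAt_symm' h1.1) d1,
      modelDeriv_comp_apply y ((hsV.contMDiffAt (hV.mem_nhds hy.2)).mdifferentiableAt one_ne_zero)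
      (mdifferentiableAt_extChartAt'' hy.1), ← oneFormInChart_apply, modelDeriv_eq_fderiv]
    exact h3 _
  · change c.symm (s (cN (B.proj u))) = u
    rw [hs0, hc, extChartAt_to_inv]

end SmoothPrincipalBundle

end Curvature

/-! ### Right invariance of the horizontal distribution -/

section Domination

open Filter Topology

theorem tendsto_exp_neg_mul_atTop {c : ℝ} (hc : 0 < c) :
    Tendsto (fun t : ℝ => Real.exp (-c * t)) atTop (𝓝 0) := by
  have : Tendsto (fun t : ℝ => -(c * t)) atTop atBot :=
    tendsto_neg_atTop_atBot.comp (tendsto_id.const_mul_atTop hc)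
  exact (Real.tendsto_exp_atBot.comp this).congr fun t => by simp only [Function.comp, neg_mul]

/-- In a dominated splitting `s + k + x`, a vector that is exponentially contracted, and dominated by
the central direction, lies in the stable direction. The family `n t` stands for the norms of the
images at time `t`. No bound on angles is needed, because `x` eventually dominates `k`. -/
theorem eq_zero_of_dominated {V : Type*} [AddCommGroup V] {n : ℝ → V → ℝ} {C c K : ℝ} (hc : 0 < c)
    (hC : 0 < C) (h_add : ∀ t v w, n t (v + w) ≤ n t v + n t w) (h_neg : ∀ t v, n t (-v) = n t v)
    (h_nonneg : ∀ t v, 0 ≤ n t v) (h_pos : ∀ t v, v ≠ 0 → 0 < n t v) {s k x : V}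
    (hs1 : ∀ t, 0 ≤ t → n t s ≤ C * Real.exp (-c * t) * n 0 s)
    (hs2 : ∀ t, 0 ≤ t → n t s * n 0 k ≤ C * Real.exp (-c * t) * n 0 s * n t k)
    (hx1 : ∀ t, 0 ≤ t → n 0 x ≤ C * Real.exp (-c * t) * n t x)
    (hx2 : ∀ t, 0 ≤ t → n 0 x * n t k ≤ C * Real.exp (-c * t) * n t x * n 0 k)
    (hv1 : ∀ t, 0 ≤ t → n t (s + k + x) ≤ K * Real.exp (-c * t))
    (hv2 : ∀ t, 0 ≤ t → n t (s + k + x) * n 0 k ≤ K * Real.exp (-c * t) * n t k) :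
    k = 0 ∧ x = 0 := by
  have hexp := tendsto_exp_neg_mul_atTop hc
  have hsmall : ∀ a b : ℝ, 0 < a → ∃ t, 0 ≤ t ∧ b * Real.exp (-c * t) < a ∧
      Real.exp (-c * t) < 1 := by
    intro a b ha
    have h1 : Tendsto (fun t : ℝ => b * Real.exp (-c * t)) atTop (𝓝 0) := by
      simpa using hexp.const_mul b
    exact ((eventually_ge_atTop 0).and ((h1.eventually_lt_const ha).and
      (hexp.eventually_lt_const one_pos))).exists
  set K' := |K| + C * n 0 s
  have hK' : 0 ≤ K' := add_nonneg (abs_nonneg _) (mul_nonneg hC.le (h_nonneg _ _))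
  -- the vector `k + x` obeys the same bounds
  have hsub : ∀ t, n t (k + x) ≤ n t (s + k + x) + n t s := fun t => by
    have := h_add t (s + k + x) (-s)
    rw [h_neg] at this
    convert this using 2
    abel
  have hy1 : ∀ t, 0 ≤ t → n t (k + x) ≤ K' * Real.exp (-c * t) := by
    intro t ht
    have h1 := hsub t
    have h2 := hv1 t ht
    have h3 := hs1 t ht
    have h4 : K * Real.exp (-c * t) ≤ |K| * Real.exp (-c * t) := by gcongr; exact le_abs_self K
    simp only [K']
    nlinarith
  have hx : x = 0 := by
    by_contra hx
    have ha := h_pos 0 x hx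
    set a := n 0 x
    obtain ⟨t, ht, hb, hE1⟩ := hsmall a (2 * (C * n 0 k) + 2 * C * K') ha
    set e := Real.exp (-c * t)
    have he : 0 < e := Real.exp_pos _
    have hk0 := h_nonneg 0 k
    have hnx := h_nonneg t x
    have h1 : n t x ≤ n t (k + x) + n t k := by
      have := h_add t (k + x) (-k)
      rw [h_neg] at this
      convert this using 2
      abel
    have h2 := hx2 t ht
    have h3 := hx1 t ht
    have h4 := hy1 t ht
    have hp1 : 0 ≤ C * K' * e := by positivity
    have hp2 : 0 ≤ C * n 0 k * e := by positivity
    have h5 : n t x ≤ 2 * (K' * e) := by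
      have : C * e * n t x * n 0 k ≤ (a / 2) * n t x := by nlinarith
      have : a * n t x ≤ a * (K' * e) + (a / 2) * n t x := by nlinarith
      nlinarith
    have h6 : a ≤ C * e * (2 * (K' * e)) := h3.trans (by gcongr)
    have h7 : C * e * (2 * (K' * e)) ≤ 2 * C * K' * e := by
      have : 0 ≤ 2 * (C * K' * e) * (1 - e) := mul_nonneg (by linarith) (by linarith)
      nlinarith
    nlinarith
  refine ⟨?_, hx⟩
  subst hx
  by_contra hk
  have ha := h_pos 0 k hk
  obtain ⟨t, ht, hb, -⟩ := hsmall (n 0 k) K' ha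
  have hkt := h_pos t k hk
  have h1 := hsub t
  rw [add_zero, add_zero] at h1
  have h2 := hv2 t ht
  rw [add_zero] at h2
  have h3 := hs2 t ht
  have h4 : K * Real.exp (-c * t) ≤ |K| * Real.exp (-c * t) := by gcongr; exact le_abs_self K
  have h5 : n t k * n 0 k ≤ K' * Real.exp (-c * t) * n t k := by
    simp only [K']
    nlinarith
  nlinarith

end Domination

section MetricNorm

variable {E : Type*} [NormedAddCommGroup E] [NormedSpace ℝ E]
  {M : Type*} [TopologicalSpace M] [ChartedSpace E M] [IsManifold 𝓘(ℝ, E) ∞ M]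

/-- The norm of a Riemannian metric at `x`, as a function on the model space. -/
def metricNorm (g : RiemMetric E M) (x : M) (v : E) : ℝ := g.nrm (x := x) v

theorem metricNorm_nonneg (g : RiemMetric E M) (x : M) (v : E) : 0 ≤ metricNorm g x v :=
  Real.sqrt_nonneg _

theorem metricNorm_pos (g : RiemMetric E M) (x : M) {v : E} (hv : v ≠ 0) : 0 < metricNorm g x v :=
  Real.sqrt_pos.2 (g.pos x v hv)

theorem metricNorm_neg (g : RiemMetric E M) (x : M) (v : E) :
    metricNorm g x (-v) = metricNorm g x v := by
  let b : E →L[ℝ] E →L[ℝ] ℝ := g.inner x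
  have : b (-v) (-v) = b v v := by simp
  exact congrArg Real.sqrt this

theorem metricNorm_add_le (g : RiemMetric E M) (x : M) (v w : E) :
    metricNorm g x (v + w) ≤ metricNorm g x v + metricNorm g x w := by
  let c : InnerProductSpace.Core ℝ (TangentSpace 𝓘(ℝ, E) x) := g.toRiemannianMetric.toCore x
  let i : NormedAddCommGroup (TangentSpace 𝓘(ℝ, E) x) := c.toNormedAddCommGroup
  exact norm_add_le (E := TangentSpace 𝓘(ℝ, E) x) v w

end MetricNorm

section Invariance

variable {EN : Type*} [NormedAddCommGroup EN] [NormedSpace ℝ EN]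
  {EG : Type*} [NormedAddCommGroup EG] [NormedSpace ℝ EG]
  {EP : Type*} [NormedAddCommGroup EP] [NormedSpace ℝ EP]
  {N : Type*} [TopologicalSpace N] [ChartedSpace EN N]
  {G : Type*} [TopologicalSpace G] [ChartedSpace EG G] [Group G]
  {P : Type*} [TopologicalSpace P] [ChartedSpace EP P]

theorem IsSmoothFlow.mdifferentiableAt {Φ : Flow ℝ P} (h : IsSmoothFlow (E := EP) Φ) (t : ℝ)
    (u : P) : MDifferentiableAt 𝓘(ℝ, EP) 𝓘(ℝ, EP) (Φ t) u := by
  have : ContMDiff 𝓘(ℝ, EP) 𝓘(ℝ, EP) ∞ (fun u => Φ t u) :=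
    ContMDiff.comp (g := fun p : ℝ × P => Φ p.1 p.2) h (contMDiff_const.prodMk contMDiff_id)
  exact (this u).mdifferentiableAt (by simp)

theorem IsSmoothFlow.mdifferentiableAt_time {Φ : Flow ℝ P} (h : IsSmoothFlow (E := EP) Φ) (t : ℝ)
    (u : P) : MDifferentiableAt 𝓘(ℝ, ℝ) 𝓘(ℝ, EP) (fun t => Φ t u) t := by
  have : ContMDiff 𝓘(ℝ, ℝ) 𝓘(ℝ, EP) ∞ (fun t => Φ t u) :=
    ContMDiff.comp (g := fun p : ℝ × P => Φ p.1 p.2) h (contMDiff_id.prodMk contMDiff_const)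
  exact (this t).mdifferentiableAt (by simp)

/-- The generator of a flow, in the model space. -/
def modelGenerator (EP : Type*) [NormedAddCommGroup EP] [NormedSpace ℝ EP]
    {P : Type*} [TopologicalSpace P] [ChartedSpace EP P] (Φ : Flow ℝ P) (u : P) : EP :=
  modelDeriv ℝ EP (fun t => Φ t u) 0 1

theorem modelDeriv_flow_neg {Φ : Flow ℝ P} (h : IsSmoothFlow (E := EP) Φ) (t : ℝ) (u : P) (v : EP) :
    modelDeriv EP EP (Φ (-t)) (Φ t u) (modelDeriv EP EP (Φ t) u v) = v :=
  modelDeriv_modelDeriv_of_leftInverse u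
    (Filter.Eventually.of_forall fun y => by rw [← Φ.map_add, neg_add_cancel, Φ.map_zero_apply])
    (h.mdifferentiableAt _ _) (h.mdifferentiableAt _ _) v

/-- A map which intertwines two flows maps one generator to the other. -/
theorem modelDeriv_modelGenerator {E : Type*} [NormedAddCommGroup E] [NormedSpace ℝ E]
    {M : Type*} [TopologicalSpace M] [ChartedSpace E M] {Φ : Flow ℝ P} {φ : Flow ℝ M} {f : P → M}
    (h : IsSmoothFlow (E := EP) Φ) (u : P) (hf : MDifferentiableAt 𝓘(ℝ, EP) 𝓘(ℝ, E) f u)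
    (hfφ : ∀ t, f (Φ t u) = φ t (f u)) :
    modelDeriv EP E f u (modelGenerator EP Φ u) = modelGenerator E φ (f u) := by
  have hf' : MDifferentiableAt 𝓘(ℝ, EP) 𝓘(ℝ, E) f (Φ 0 u) := by rwa [Φ.map_zero_apply]
  have h1 := modelDeriv_comp_apply (f := fun t => Φ t u) (0 : ℝ) hf'
    (h.mdifferentiableAt_time 0 u) 1
  rw [Φ.map_zero_apply] at h1
  rw [modelGenerator, ← h1, modelGenerator]
  simp only [hfφ]

namespace SmoothPrincipalBundle

variable (B : SmoothPrincipalBundle EN EG EP N G P)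

theorem modelDeriv_act_act_inv (a : G) (u : P) (v : EP) :
    modelDeriv EP EP (fun u => B.act u a) u
      (modelDeriv EP EP (fun u => B.act u a⁻¹) (B.act u a) v) = v := by
  have := modelDeriv_modelDeriv_of_leftInverse (g := fun u => B.act u a)
    (f := fun u => B.act u a⁻¹) (B.act u a)
    (Filter.Eventually.of_forall fun y => B.act_act_inv y a)
    (B.mdifferentiableAt_act_left _ _) (B.mdifferentiableAt_act_left _ _) v
  rwa [B.act_inv_act] at this

theorem modelDeriv_proj_act (a : G) (u : P) (v : EP) :
    modelDeriv EP EN B.proj (B.act u a) (modelDeriv EP EP (fun u => B.act u a) u v) =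
      modelDeriv EP EN B.proj u v := by
  rw [← modelDeriv_comp_apply (f := fun u => B.act u a) u (B.mdifferentiableAt_proj _)
    (B.mdifferentiableAt_act_left a u)]
  simp only [B.proj_act]

variable {φ : Flow ℝ N} {Φ : Flow ℝ P}

variable {B} in
theorem IsPrincipalExtension.modelDeriv_proj_flow (hΦ : B.IsPrincipalExtension φ Φ)
    (hφ : IsSmoothFlow (E := EN) φ) (t : ℝ) (u : P) (v : EP) :
    modelDeriv EP EN B.proj (Φ t u) (modelDeriv EP EP (Φ t) u v) =
      modelDeriv EN EN (φ t) (B.proj u) (modelDeriv EP EN B.proj u v) := by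
  rw [← modelDeriv_comp_apply u (B.mdifferentiableAt_proj _) (hΦ.1.mdifferentiableAt t u),
    ← modelDeriv_comp_apply u (hφ.mdifferentiableAt t _) (B.mdifferentiableAt_proj _)]
  simp only [hΦ.2.1]

variable {B} in
theorem IsPrincipalExtension.modelDeriv_flow_act (hΦ : B.IsPrincipalExtension φ Φ) (t : ℝ) (a : G)
    (u : P) (v : EP) :
    modelDeriv EP EP (Φ t) (B.act u a) (modelDeriv EP EP (fun u => B.act u a) u v) =
      modelDeriv EP EP (fun u => B.act u a) (Φ t u) (modelDeriv EP EP (Φ t) u v) := by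
  rw [← modelDeriv_comp_apply (f := fun u => B.act u a) u (hΦ.1.mdifferentiableAt t _)
    (B.mdifferentiableAt_act_left a u),
    ← modelDeriv_comp_apply (g := fun u => B.act u a) u (B.mdifferentiableAt_act_left a _)
    (hΦ.1.mdifferentiableAt t u)]
  simp only [hΦ.2.2]

variable (Φ) in
theorem mem_central_iff (u : P) (w : EP) : w ∈ B.central Φ u ↔
    ∃ r : ℝ, modelDeriv EP EN B.proj u (w - r • modelGenerator EP Φ u) = 0 := by
  constructor
  · intro h
    obtain ⟨x, hx, y, hy, rfl⟩ := (Submodule.mem_sup (R := ℝ) (M := TangentSpace 𝓘(ℝ, EP) u)).1 h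
    obtain ⟨r, rfl⟩ := (Submodule.mem_span_singleton (R := ℝ) (M := TangentSpace 𝓘(ℝ, EP) u)).1 hx
    refine ⟨r, ?_⟩
    have : modelDeriv EP EN B.proj u y = 0 := hy
    exact (congrArg (modelDeriv EP EN B.proj u) (add_sub_cancel_left (G := EP) _ _)).trans this
  · rintro ⟨r, hr⟩
    refine (Submodule.mem_sup (R := ℝ) (M := TangentSpace 𝓘(ℝ, EP) u)).2
      ⟨r • flowGenerator Φ u,
      (Submodule.mem_span_singleton (R := ℝ) (M := TangentSpace 𝓘(ℝ, EP) u)).2 ⟨r, rfl⟩,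
      (w - r • modelGenerator EP Φ u : EP), hr, ?_⟩
    exact add_sub_cancel (G := EP) _ _

variable {B} in
theorem IsPrincipalExtension.flow_mem_central (hΦ : B.IsPrincipalExtension φ Φ)
    (hφ : IsSmoothFlow (E := EN) φ) (t : ℝ) {u : P} {w : EP} (hw : w ∈ B.central Φ u) :
    modelDeriv EP EP (Φ t) u w ∈ B.central Φ (Φ t u) := by
  rw [mem_central_iff] at hw ⊢
  obtain ⟨r, hr⟩ := hw
  refine ⟨r, ?_⟩
  rw [← modelDeriv_modelGenerator hΦ.1 u (hΦ.1.mdifferentiableAt t u)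
    (fun s => by rw [← Φ.map_add, ← Φ.map_add, add_comm]), ← map_smul, ← map_sub,
    hΦ.modelDeriv_proj_flow hφ, hr, map_zero]

variable {B} in
theorem IsPrincipalExtension.act_mem_central (hΦ : B.IsPrincipalExtension φ Φ) (a : G) {u : P}
    {w : EP} (hw : w ∈ B.central Φ u) :
    modelDeriv EP EP (fun u => B.act u a) u w ∈ B.central Φ (B.act u a) := by
  rw [mem_central_iff] at hw ⊢
  obtain ⟨r, hr⟩ := hw
  refine ⟨r, ?_⟩
  rw [← modelDeriv_modelGenerator (f := fun u => B.act u a) hΦ.1 u (B.mdifferentiableAt_act_left a u)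
    (fun s => (hΦ.2.2 s u a).symm), ← map_smul, ← map_sub, B.modelDeriv_proj_act, hr]

variable [IsManifold 𝓘(ℝ, EP) ∞ P]

variable {B} in
theorem metricNorm_act {g : RiemMetric EP P} (hg : B.IsRightInvariant g) (a : G) (u : P) (v : EP) :
    metricNorm g (B.act u a) (modelDeriv EP EP (fun u => B.act u a) u v) = metricNorm g u v :=
  congrArg Real.sqrt (hg a u v v)

/-- The bundles `E_s` and `E_u` are invariant under right translations. -/
theorem act_mem_of_splitting {φ : Flow ℝ N} {Φ : Flow ℝ P} (hφ : IsSmoothFlow (E := EN) φ)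
    (hΦ : B.IsPrincipalExtension φ Φ)
    {Es Eu : ∀ u : P, Submodule ℝ (TangentSpace 𝓘(ℝ, EP) u)}
    (h : B.IsPartiallyHyperbolicSplitting Φ Es Eu) (a : G) (u : P) (v : EP) :
    (v ∈ Es u → modelDeriv EP EP (fun u => B.act u a) u v ∈ Es (B.act u a)) ∧
    (v ∈ Eu u → modelDeriv EP EP (fun u => B.act u a) u v ∈ Eu (B.act u a)) := by
  obtain ⟨hT, hs, hu, g, hg, C, c, hC, hc, hs1, hu1, hs2, hu2⟩ := h
  -- the norm of the image at time `t`
  let n : P → ℝ → EP → ℝ := fun u t w => metricNorm g (Φ t u) (modelDeriv EP EP (Φ t) u w)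
  have hadd : ∀ u t w w', n u t (w + w') ≤ n u t w + n u t w' := fun u t w w' => by
    simp only [n, map_add]; exact metricNorm_add_le _ _ _ _
  have hneg : ∀ u t w, n u t (-w) = n u t w := fun u t w => by
    simp only [n, map_neg, metricNorm_neg]
  have hinj : ∀ u t (w : EP), w ≠ 0 → modelDeriv EP EP (Φ t) u w ≠ 0 := fun u t w hw h0 =>
    hw (by rw [← modelDeriv_flow_neg hΦ.1 t u w, h0, map_zero])
  have hpos : ∀ u t w, w ≠ 0 → 0 < n u t w := fun u t w hw => metricNorm_pos _ _ (hinj u t w hw)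
  have hn0 : ∀ u w, n u 0 w = metricNorm g u w := fun u w => by
    have : (Φ 0 : P → P) = fun x => x := by ext x; exact Φ.map_zero_apply x
    simp only [n, this, modelDeriv_id]; rfl
  have hact : ∀ t w, n (B.act u a) t (modelDeriv EP EP (fun u => B.act u a) u w) = n u t w := by
    intro t w
    simp only [n]
    rw [hΦ.modelDeriv_flow_act, hΦ.2.2, metricNorm_act hg]
  have hcen : ∀ k : EP, k ∈ B.central Φ (B.act u a) → ∃ k' : EP, k' ∈ B.central Φ u ∧
      modelDeriv EP EP (fun u => B.act u a) u k' = k := by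
    intro k hk
    refine ⟨modelDeriv EP EP (fun u => B.act u a⁻¹) (B.act u a) k, ?_,
      B.modelDeriv_act_act_inv a u k⟩
    have := hΦ.act_mem_central a⁻¹ hk
    rwa [B.act_inv_act] at this
  -- the estimates at time zero in terms of the point at time `t`
  have hflow0 : ∀ u t w, metricNorm g (Φ (-t) (Φ t u))
      (modelDeriv EP EP (Φ (-t)) (Φ t u) (modelDeriv EP EP (Φ t) u w)) = metricNorm g u w := by
    intro u t w
    rw [modelDeriv_flow_neg hΦ.1, ← Φ.map_add, neg_add_cancel, Φ.map_zero_apply]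
  have hflow0' : ∀ u t w, metricNorm g (Φ t (Φ (-t) u))
      (modelDeriv EP EP (Φ t) (Φ (-t) u) (modelDeriv EP EP (Φ (-t)) u w)) = metricNorm g u w := by
    intro u t w
    have := hflow0 u (-t) w
    rwa [neg_neg] at this
  have hdec : ∀ w : EP, ∃ ws wc wu : EP, ws ∈ Es (B.act u a) ∧ wc ∈ B.central Φ (B.act u a) ∧
      wu ∈ Eu (B.act u a) ∧ ws + wc + wu = w := by
    intro w
    have htop : (w : TangentSpace 𝓘(ℝ, EP) (B.act u a)) ∈
        (Es (B.act u a) ⊔ B.central Φ (B.act u a)) ⊔ Eu (B.act u a) := by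
      rw [(hT _).2.sup_eq_top]; exact trivial
    obtain ⟨x, hx, wu, hwu, rfl⟩ :=
      (Submodule.mem_sup (R := ℝ) (M := TangentSpace 𝓘(ℝ, EP) (B.act u a))).1 htop
    obtain ⟨ws, hws, wc, hwc, rfl⟩ :=
      (Submodule.mem_sup (R := ℝ) (M := TangentSpace 𝓘(ℝ, EP) (B.act u a))).1 hx
    exact ⟨ws, wc, wu, hws, hwc, hwu, rfl⟩
  obtain ⟨ws, wc, wu, hws, hwc, hwu, hw⟩ := hdec (modelDeriv EP EP (fun u => B.act u a) u v)
  obtain ⟨k, hk, rfl⟩ := hcen wc hwc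
  set wk := modelDeriv EP EP (fun u => B.act u a) u k
  set u' := B.act u a
  rw [← hw]
  constructor
  · intro hv
    obtain ⟨h1, h2⟩ := eq_zero_of_dominated (n := n u') (K := C * n u 0 v) hc hC (hadd u')
      (hneg u') (fun t w => metricNorm_nonneg _ _ _) (hpos u') (s := ws) (k := wk) (x := wu)
      (fun t ht => by rw [hn0]; exact hs1 t ht u' ws hws)
      (fun t ht => by rw [hn0, hn0]; exact hs2 t ht u' ws hws wk hwc)
      (fun t ht => by
        have := hu1 t ht (Φ t u') _ (hu t u' wu hwu)
        rw [hn0, ← hflow0 u' t wu]; exact this)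
      (fun t ht => by
        have := hu2 t ht (Φ t u') _ (hu t u' wu hwu) (modelDeriv EP EP (Φ t) u' wk)
          (hΦ.flow_mem_central hφ t hwc)
        rw [hn0, hn0, ← hflow0 u' t wu, ← hflow0 u' t wk]; exact this)
      (fun t ht => by
        rw [hw, hact, hn0]
        refine (hs1 t ht u v hv).trans (le_of_eq ?_)
        change C * Real.exp (-c * t) * metricNorm g u v = _
        ring)
      (fun t ht => by
        rw [hw, hact, hact, hact, hn0, hn0]
        refine (hs2 t ht u v hv k hk).trans (le_of_eq ?_)
        change C * Real.exp (-c * t) * metricNorm g u v * n u t k = _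
        ring)
    have h3 : ws + wk + wu = ws := by rw [h1, h2, add_zero, add_zero]
    rw [h3]
    exact hws
  · intro hv
    obtain ⟨h1, h2⟩ := eq_zero_of_dominated (n := fun t => n u' (-t)) (K := C * n u 0 v) hc hC
      (fun t => hadd u' (-t))
      (fun t => hneg u' (-t)) (fun t w => metricNorm_nonneg _ _ _) (fun t => hpos u' (-t))
      (s := wu) (k := wk) (x := ws)
      (fun t ht => by rw [neg_zero, hn0]; exact hu1 t ht u' wu hwu)
      (fun t ht => by rw [neg_zero, hn0, hn0]; exact hu2 t ht u' wu hwu wk hwc)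
      (fun t ht => by
        have := hs1 t ht (Φ (-t) u') _ (hs (-t) u' ws hws)
        rw [neg_zero, hn0, ← hflow0' u' t ws]; exact this)
      (fun t ht => by
        have := hs2 t ht (Φ (-t) u') _ (hs (-t) u' ws hws) (modelDeriv EP EP (Φ (-t)) u' wk)
          (hΦ.flow_mem_central hφ (-t) hwc)
        rw [neg_zero, hn0, hn0, ← hflow0' u' t ws, ← hflow0' u' t wk]; exact this)
      (fun t ht => by
        rw [show wu + wk + ws = ws + wk + wu by abel, hw, hact, hn0]
        refine (hu1 t ht u v hv).trans (le_of_eq ?_)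
        change C * Real.exp (-c * t) * metricNorm g u v = _
        ring)
      (fun t ht => by
        rw [show wu + wk + ws = ws + wk + wu by abel, hw, neg_zero, hact, hact, hact, hn0, hn0]
        refine (hu2 t ht u v hv k hk).trans (le_of_eq ?_)
        change C * Real.exp (-c * t) * metricNorm g u v * n u (-t) k = _
        ring)
    have h3 : ws + wk + wu = wu := by rw [h1, h2, zero_add, zero_add]
    rw [h3]
    exact hwu

/-- The dynamical horizontal distribution is invariant under right translations. -/
theorem act_mem_horizontal {φ : Flow ℝ N} {Φ : Flow ℝ P} (hφ : IsSmoothFlow (E := EN) φ)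
    (hΦ : B.IsPrincipalExtension φ Φ)
    {ℍ : ∀ u : P, Submodule ℝ (TangentSpace 𝓘(ℝ, EP) u)} (hℍ : B.IsDynamicalHorizontal Φ ℍ)
    (a : G) (u : P) {v : EP} (hv : v ∈ ℍ u) :
    modelDeriv EP EP (fun u => B.act u a) u v ∈ ℍ (B.act u a) := by
  obtain ⟨Es, Eu, h, hH⟩ := hℍ
  rw [hH] at hv ⊢
  obtain ⟨x, hx, y, hy, rfl⟩ := (Submodule.mem_sup (R := ℝ) (M := TangentSpace 𝓘(ℝ, EP) u)).1 hv
  obtain ⟨ws, hws, wu, hwu, rfl⟩ :=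
    (Submodule.mem_sup (R := ℝ) (M := TangentSpace 𝓘(ℝ, EP) u)).1 hx
  obtain ⟨r, rfl⟩ := (Submodule.mem_span_singleton (R := ℝ) (M := TangentSpace 𝓘(ℝ, EP) u)).1 hy
  have h1 := (B.act_mem_of_splitting hφ hΦ h a u ws).1 hws
  have h2 := (B.act_mem_of_splitting hφ hΦ h a u wu).2 hwu
  have h3 : modelDeriv EP EP (fun u => B.act u a) u (r • modelGenerator EP Φ u) =
      r • modelGenerator EP Φ (B.act u a) := by
    rw [map_smul, modelDeriv_modelGenerator (f := fun u => B.act u a) hΦ.1 u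
      (B.mdifferentiableAt_act_left a u) (fun s => (hΦ.2.2 s u a).symm)]
  have h4 : ∀ x y : EP, modelDeriv EP EP (fun u => B.act u a) u
      (x + y + r • modelGenerator EP Φ u) =
      modelDeriv EP EP (fun u => B.act u a) u x + modelDeriv EP EP (fun u => B.act u a) u y +
        r • modelGenerator EP Φ (B.act u a) := fun x y => by
    rw [map_add, h3, map_add]
  refine (Submodule.mem_sup (R := ℝ) (M := TangentSpace 𝓘(ℝ, EP) (B.act u a))).2
    ⟨_, (Submodule.mem_sup (R := ℝ) (M := TangentSpace 𝓘(ℝ, EP) (B.act u a))).2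
      ⟨_, h1, _, h2, rfl⟩, _, (Submodule.mem_span_singleton (R := ℝ)
        (M := TangentSpace 𝓘(ℝ, EP) (B.act u a))).2 ⟨r, rfl⟩, (h4 ws wu).symm⟩

end SmoothPrincipalBundle

end Invariance

/-! ### Horizontal maps and translates of horizontal sections -/

section HorizontalMaps

open Filter Topology Set

variable {EN : Type*} [NormedAddCommGroup EN] [NormedSpace ℝ EN]
  {EG : Type*} [NormedAddCommGroup EG] [NormedSpace ℝ EG]
  {EP : Type*} [NormedAddCommGroup EP] [NormedSpace ℝ EP]
  {N : Type*} [TopologicalSpace N] [ChartedSpace EN N]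
  {G : Type*} [TopologicalSpace G] [ChartedSpace EG G] [Group G]
  {P : Type*} [TopologicalSpace P] [ChartedSpace EP P]
  {E : Type*} [NormedAddCommGroup E] [NormedSpace ℝ E]
  {M : Type*} [TopologicalSpace M] [ChartedSpace E M]

/-- A map whose differential vanishes near a point is constant near that point. -/
theorem eventually_eq_of_modelDeriv_eq_zero {E' M' : Type*} [NormedAddCommGroup E']
    [NormedSpace ℝ E'] [TopologicalSpace M'] [ChartedSpace E' M'] [IsManifold 𝓘(ℝ, E) ∞ M]
    [IsManifold 𝓘(ℝ, E') ∞ M'] {f : M → M'} {m₀ : M}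
    (hf : ∀ᶠ m in 𝓝 m₀, MDifferentiableAt 𝓘(ℝ, E) 𝓘(ℝ, E') f m)
    (hf' : ∀ᶠ m in 𝓝 m₀, modelDeriv E E' f m = 0) : ∀ᶠ m in 𝓝 m₀, f m = f m₀ := by
  set c := extChartAt 𝓘(ℝ, E) m₀
  set c' := extChartAt 𝓘(ℝ, E') (f m₀)
  have hall : ∀ᶠ m in 𝓝 m₀, MDifferentiableAt 𝓘(ℝ, E) 𝓘(ℝ, E') f m ∧ modelDeriv E E' f m = 0 ∧
      f m ∈ c'.source := by
    have := hf.self_of_nhds.continuousAt.eventually (extChartAt_source_mem_nhds (I := 𝓘(ℝ, E')) (f m₀))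
    exact hf.and (hf'.and this)
  have hs : ContinuousAt c.symm (c m₀) := continuousAt_extChartAt_symm m₀
  have hs0 : c.symm (c m₀) = m₀ := extChartAt_to_inv m₀
  have hE : ∀ᶠ p in 𝓝 (c m₀), p ∈ c.target ∧ MDifferentiableAt 𝓘(ℝ, E) 𝓘(ℝ, E') f (c.symm p) ∧
      modelDeriv E E' f (c.symm p) = 0 ∧ f (c.symm p) ∈ c'.source := by
    rw [← hs0] at hall
    exact Filter.Eventually.and ((isOpen_extChartAt_target m₀).mem_nhds (mem_extChartAt_target m₀))
      (hs.eventually hall)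
  obtain ⟨r, hr, hball⟩ := Metric.eventually_nhds_iff_ball.1 hE
  have hd : ∀ p ∈ Metric.ball (c m₀) r, HasFDerivAt (fun p => c' (f (c.symm p))) (0 : E →L[ℝ] E') p := by
    intro p hp
    obtain ⟨h1, h2, h3, h4⟩ := hball p hp
    have d1 : MDifferentiableAt 𝓘(ℝ, E) 𝓘(ℝ, E') (fun p => f (c.symm p)) p :=
      MDifferentiableAt.comp p h2 (mdifferentiableAt_extChartAt_symm' h1)
    have d2 : MDifferentiableAt 𝓘(ℝ, E) 𝓘(ℝ, E') (fun p => c' (f (c.symm p))) p :=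
      MDifferentiableAt.comp p (mdifferentiableAt_extChartAt'' h4) d1
    have d3 : modelDeriv E E' (fun p => c' (f (c.symm p))) p = 0 := by
      rw [modelDeriv_comp (g := c') p (mdifferentiableAt_extChartAt'' h4) d1,
        modelDeriv_comp (g := f) p h2 (mdifferentiableAt_extChartAt_symm' h1), h3,
        ContinuousLinearMap.zero_comp, ContinuousLinearMap.comp_zero]
    rw [modelDeriv_eq_fderiv] at d3
    rw [← d3]
    exact (mdifferentiableAt_iff_differentiableAt.1 d2).hasFDerivAt
  have hc : ∀ᶠ m in 𝓝 m₀, m ∈ c.source ∧ c m ∈ Metric.ball (c m₀) r :=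
    Filter.Eventually.and (extChartAt_source_mem_nhds m₀)
      ((continuousAt_extChartAt m₀).eventually (Metric.ball_mem_nhds _ hr))
  filter_upwards [hc] with m ⟨h1, h2⟩
  have h3 := (convex_ball (c m₀) r).is_const_of_fderivWithin_eq_zero (𝕜 := ℝ)
    (f := fun p => c' (f (c.symm p)))
    (fun p hp => (hd p hp).differentiableAt.differentiableWithinAt)
    (fun p hp => by
      rw [fderivWithin_of_isOpen Metric.isOpen_ball hp]; exact (hd p hp).fderiv)
    h2 (Metric.mem_ball_self hr)
  have h4 := (hball _ h2).2.2.2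
  simp only [c.left_inv h1, hs0] at h3 h4
  exact c'.injOn h4 (mem_extChartAt_source _) h3

namespace SmoothPrincipalBundle

variable (B : SmoothPrincipalBundle EN EG EP N G P) {Θ : LieAlgForm EG EP P}

variable (Θ) in
/-- The kernel of `Θ` is invariant under right translations. -/
def HasInvariantKernel : Prop :=
  ∀ (a : G) (u : P) (v : EP), modelForm Θ u v = 0 →
    modelForm Θ (B.act u a) (modelDeriv EP EP (fun u => B.act u a) u v) = 0

variable (E Θ) in
/-- The map `h` is differentiable and tangent to the kernel of `Θ` at all points near `m₀`. -/
def IsHorizontalNear (_B : SmoothPrincipalBundle EN EG EP N G P) (h : M → P) (m₀ : M) : Prop :=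
  ∀ᶠ m in 𝓝 m₀, MDifferentiableAt 𝓘(ℝ, E) 𝓘(ℝ, EP) h m ∧
    ∀ v, modelForm Θ (h m) (modelDeriv E EP h m v) = 0

variable {B}

theorem IsHorizontalSection.mdifferentiableAt {U : Set N} {s : N → P}
    (hs : B.IsHorizontalSection Θ U s) {y : N} (hy : y ∈ U) :
    MDifferentiableAt 𝓘(ℝ, EN) 𝓘(ℝ, EP) s y :=
  (hs.contMDiffOn.contMDiffAt (hs.isOpen.mem_nhds hy)).mdifferentiableAt one_ne_zero

theorem IsHorizontalSection.isHorizontalNear {U : Set N} {s : N → P}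
    (hs : B.IsHorizontalSection Θ U s) {y : N} (hy : y ∈ U) : B.IsHorizontalNear EN Θ s y := by
  filter_upwards [hs.isOpen.mem_nhds hy] with z hz
  exact ⟨hs.mdifferentiableAt hz, hs.horizontal z hz⟩

theorem IsHorizontalSection.act {U : Set N} {s : N → P} (hs : B.IsHorizontalSection Θ U s)
    (hB : B.HasInvariantKernel Θ) (a : G) :
    B.IsHorizontalSection Θ U (fun y => B.act (s y) a) where
  isOpen := hs.isOpen
  contMDiffOn := ((B.contMDiff_act_left a).of_le (by norm_cast)).comp_contMDiffOn hs.contMDiffOn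
  proj_eq y hy := by rw [B.proj_act, hs.proj_eq y hy]
  horizontal y hy v := by
    rw [modelDeriv_comp_apply (g := fun u => B.act u a) y (B.mdifferentiableAt_act_left a _)
      (hs.mdifferentiableAt hy)]
    exact hB a _ _ (hs.horizontal y hy v)

variable (B) in
/-- Near two given points of a fibre, the element `δ` with `v = u · δ(u, v)` depends smoothly on the
points `u` and `v` of a common fibre. -/
theorem exists_contMDiffOn_translation [LieGroup 𝓘(ℝ, EG) ∞ G] (x : N) :
    ∃ (U : Set N) (δ : P × P → G), IsOpen U ∧ x ∈ U ∧
      ContMDiffOn (𝓘(ℝ, EP).prod 𝓘(ℝ, EP)) 𝓘(ℝ, EG) ∞ δ ((B.proj ⁻¹' U) ×ˢ (B.proj ⁻¹' U)) ∧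
      ∀ u, B.proj u ∈ U → ∀ a, δ (u, B.act u a) = a := by
  obtain ⟨U, s, τ, hU, hx, hs, hτ, h1, h2, h3⟩ := B.locally_trivial x
  refine ⟨U, fun p => (τ p.1)⁻¹ * τ p.2, hU, hx, ?_, ?_⟩
  · have d1 : ContMDiffOn (𝓘(ℝ, EP).prod 𝓘(ℝ, EP)) 𝓘(ℝ, EG) ∞ (fun p : P × P => τ p.1)
        ((B.proj ⁻¹' U) ×ˢ (B.proj ⁻¹' U)) := hτ.comp contMDiffOn_fst fun p hp => hp.1
    have d2 : ContMDiffOn (𝓘(ℝ, EP).prod 𝓘(ℝ, EP)) 𝓘(ℝ, EG) ∞ (fun p : P × P => τ p.2)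
        ((B.proj ⁻¹' U) ×ˢ (B.proj ⁻¹' U)) := hτ.comp contMDiffOn_snd fun p hp => hp.2
    exact d1.inv.mul d2
  · intro u hu a
    change (τ u)⁻¹ * τ (B.act u a) = a
    conv_lhs => rw [← h2 u hu, h3 _ hu, ← B.act_mul, h3 _ hu]
    group

variable {ℍ : ∀ u : P, Submodule ℝ (TangentSpace 𝓘(ℝ, EP) u)}

/-- A horizontal map is locally the composition of its projection with a translate of a given
horizontal section. -/
theorem IsHorizontalSection.eventually_eq_act [IsManifold 𝓘(ℝ, E) ∞ M] [LieGroup 𝓘(ℝ, EG) ∞ G]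
    (hΘ : B.IsFormOf ℍ Θ) (hB : B.HasInvariantKernel Θ) {U : Set N} {s : N → P}
    (hs : B.IsHorizontalSection Θ U s) {h : M → P} {m₀ : M}
    (hh : B.IsHorizontalNear E Θ h m₀) (hm₀ : B.proj (h m₀) ∈ U) :
    ∃ a, ∀ᶠ m in 𝓝 m₀, h m = B.act (s (B.proj (h m))) a := by
  obtain ⟨W, δ, hW, hm₀W, hδ, hδa⟩ := B.exists_contMDiffOn_translation (B.proj (h m₀))
  have hc : ContinuousAt (fun m => B.proj (h m)) m₀ :=
    B.contMDiff_proj.continuous.continuousAt.comp hh.self_of_nhds.1.continuousAt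
  have hev : ∀ᶠ m in 𝓝 m₀, (MDifferentiableAt 𝓘(ℝ, E) 𝓘(ℝ, EP) h m ∧
      ∀ v, modelForm Θ (h m) (modelDeriv E EP h m v) = 0) ∧ B.proj (h m) ∈ U ∩ W :=
    hh.and (hc.eventually ((hs.isOpen.inter hW).mem_nhds ⟨hm₀, hm₀W⟩))
  -- the element `c m` with `h m = s (π (h m)) · c m` has vanishing derivative
  set σ : M → P := fun m => s (B.proj (h m)) with hσ
  set c : M → G := fun m => δ (σ m, h m) with hcdef
  have hact : ∀ m, B.proj (h m) ∈ U ∩ W → h m = B.act (σ m) (c m) := by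
    intro m hm
    obtain ⟨a, ha⟩ := B.exists_act_eq (hs.proj_eq _ hm.1)
    have : c m = a := by
      rw [hcdef]; dsimp only
      rw [← ha]
      exact hδa _ (by rw [hs.proj_eq _ hm.1]; exact hm.2) a
    rw [this]; exact ha.symm
  have hder : ∀ m, (MDifferentiableAt 𝓘(ℝ, E) 𝓘(ℝ, EP) h m ∧
      ∀ v, modelForm Θ (h m) (modelDeriv E EP h m v) = 0) ∧ B.proj (h m) ∈ U ∩ W →
      MDifferentiableAt 𝓘(ℝ, E) 𝓘(ℝ, EG) c m ∧ modelDeriv E EG c m = 0 := by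
    rintro m ⟨⟨h1, h2⟩, h3⟩
    have hπ : MDifferentiableAt 𝓘(ℝ, E) 𝓘(ℝ, EN) (fun m => B.proj (h m)) m :=
      (B.mdifferentiableAt_proj _).comp m h1
    have dσ : MDifferentiableAt 𝓘(ℝ, E) 𝓘(ℝ, EP) σ m :=
      MDifferentiableAt.comp (g := s) m (hs.mdifferentiableAt h3.1) hπ
    set k : M → P := fun m' => B.act (σ m') (c m) with hk
    have dk : MDifferentiableAt 𝓘(ℝ, E) 𝓘(ℝ, EP) k m :=
      MDifferentiableAt.comp (g := fun u => B.act u (c m)) m (B.mdifferentiableAt_act_left _ _) dσ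
    have hkm : k m = h m := (hact m h3).symm
    have hU' : ∀ᶠ m' in 𝓝 m, B.proj (h m') ∈ U ∩ W :=
      hπ.continuousAt.eventually ((hs.isOpen.inter hW).mem_nhds h3)
    -- `h` and `k` have the same derivative at `m`: both are horizontal, over the same map
    have hkv : ∀ v, modelDeriv E EP k m v = modelDeriv E EP h m v := by
      intro v
      have e1 : modelForm Θ (h m) (modelDeriv E EP k m v) = 0 := by
        rw [← hkm, hk, modelDeriv_comp_apply (g := fun u => B.act u (c m)) (f := σ) m
          (B.mdifferentiableAt_act_left _ _) dσ]
        refine hB _ _ _ ?_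
        rw [hσ, modelDeriv_comp_apply (g := s) m (hs.mdifferentiableAt h3.1) hπ]
        exact hs.horizontal _ h3.1 _
      have e2 : modelDeriv EP EN B.proj (h m) (modelDeriv E EP k m v) =
          modelDeriv EP EN B.proj (h m) (modelDeriv E EP h m v) := by
        rw [← modelDeriv_comp_apply m (B.mdifferentiableAt_proj _) h1, ← hkm,
          ← modelDeriv_comp_apply m (B.mdifferentiableAt_proj _) dk]
        refine congrArg (fun T : E →L[ℝ] EN => T v) (modelDeriv_congr ?_)
        filter_upwards [hU'] with m' hm'
        rw [hk]; dsimp only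
        rw [B.proj_act]; exact hs.proj_eq _ hm'.1
      exact hΘ.eq_of_projDeriv_eq e2 e1 (h2 v)
    have hδm : MDifferentiableAt (𝓘(ℝ, EP).prod 𝓘(ℝ, EP)) 𝓘(ℝ, EG) δ (σ m, h m) := by
      have hopen : IsOpen (B.proj ⁻¹' W) := hW.preimage B.contMDiff_proj.continuous
      have hσW : B.proj (s (B.proj (h m))) ∈ W := by rw [hs.proj_eq _ h3.1]; exact h3.2
      have hmem : (σ m, h m) ∈ (B.proj ⁻¹' W) ×ˢ (B.proj ⁻¹' W) := ⟨hσW, h3.2⟩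
      exact (hδ.contMDiffAt ((hopen.prod hopen).mem_nhds hmem)).mdifferentiableAt (by simp)
    have H1 : HasMFDerivAt 𝓘(ℝ, E) (𝓘(ℝ, EP).prod 𝓘(ℝ, EP)) (fun m => (σ m, h m)) m _ :=
      dσ.hasMFDerivAt.prodMk h1.hasMFDerivAt
    have H2 : HasMFDerivAt 𝓘(ℝ, E) (𝓘(ℝ, EP).prod 𝓘(ℝ, EP)) (fun m => (σ m, k m)) m _ :=
      dσ.hasMFDerivAt.prodMk dk.hasMFDerivAt
    have hδm' : MDifferentiableAt (𝓘(ℝ, EP).prod 𝓘(ℝ, EP)) 𝓘(ℝ, EG) δ (σ m, k m) := by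
      rw [hkm]; exact hδm
    have H3 : HasMFDerivAt 𝓘(ℝ, E) 𝓘(ℝ, EG) c m _ := hδm.hasMFDerivAt.comp m H1
    have H4 : HasMFDerivAt 𝓘(ℝ, E) 𝓘(ℝ, EG) (fun m' => δ (σ m', k m')) m _ :=
      hδm'.hasMFDerivAt.comp m H2
    have H5 : (fun m' => δ (σ m', k m')) =ᶠ[𝓝 m] fun _ => c m := by
      filter_upwards [hU'] with m' hm'
      exact hδa _ (by change B.proj (s _) ∈ W; rw [hs.proj_eq _ hm'.1]; exact hm'.2) _
    refine ⟨H3.mdifferentiableAt, ?_⟩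
    have e1 : modelDeriv E EG (fun m' => δ (σ m', k m')) m = 0 := by
      rw [modelDeriv_congr H5, modelDeriv_const]
    ext v
    have e2 : modelDeriv E EG c m v = (mfderiv (𝓘(ℝ, EP).prod 𝓘(ℝ, EP)) 𝓘(ℝ, EG) δ (σ m, h m) :
      EP × EP → EG) (modelDeriv E EP σ m v, modelDeriv E EP h m v) :=
      congrArg (fun T : E →L[ℝ] EG => T v) H3.mfderiv
    have e3 : modelDeriv E EG (fun m' => δ (σ m', k m')) m v =
      (mfderiv (𝓘(ℝ, EP).prod 𝓘(ℝ, EP)) 𝓘(ℝ, EG) δ (σ m, k m) :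
      EP × EP → EG) (modelDeriv E EP σ m v, modelDeriv E EP k m v) :=
      congrArg (fun T : E →L[ℝ] EG => T v) H4.mfderiv
    rw [hkm, hkv, ← e2, e1] at e3
    exact e3.symm
  have hconst := eventually_eq_of_modelDeriv_eq_zero (f := c) (m₀ := m₀)
    (hev.mono fun m hm => (hder m hm).1) (hev.mono fun m hm => (hder m hm).2)
  refine ⟨c m₀, ?_⟩
  filter_upwards [hconst, hev] with m h1 h2
  rw [← h1]
  exact hact m h2.2

/-- Two horizontal sections which agree at a point agree near that point. -/
theorem IsHorizontalSection.eventuallyEq [IsManifold 𝓘(ℝ, EN) ∞ N] [LieGroup 𝓘(ℝ, EG) ∞ G]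
    (hΘ : B.IsFormOf ℍ Θ) (hB : B.HasInvariantKernel Θ) {U V : Set N} {s t : N → P}
    (hs : B.IsHorizontalSection Θ U s) (ht : B.IsHorizontalSection Θ V t) {x : N} (hU : x ∈ U)
    (hV : x ∈ V) (hst : s x = t x) : t =ᶠ[𝓝 x] s := by
  have hx : B.proj (t x) = x := ht.proj_eq x hV
  obtain ⟨a, ha⟩ := hs.eventually_eq_act hΘ hB (ht.isHorizontalNear hV) (by rwa [hx])
  have h1 := ha.self_of_nhds
  rw [hx, hst, eq_comm, B.act_eq_self_iff] at h1
  filter_upwards [ha, ht.isOpen.mem_nhds hV] with y hy hyV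
  rw [hy, ht.proj_eq y hyV, h1, B.act_one]

end SmoothPrincipalBundle

end HorizontalMaps

/-! ### The leaf topology of a flat bundle -/

section Leaf

open Filter Topology Set

variable {EN : Type*} [NormedAddCommGroup EN] [NormedSpace ℝ EN]
  {EG : Type*} [NormedAddCommGroup EG] [NormedSpace ℝ EG]
  {EP : Type*} [NormedAddCommGroup EP] [NormedSpace ℝ EP]
  {N : Type*} [TopologicalSpace N] [ChartedSpace EN N]
  {G : Type*} [TopologicalSpace G] [ChartedSpace EG G] [Group G]
  {P : Type*} [TopologicalSpace P] [ChartedSpace EP P]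

namespace SmoothPrincipalBundle

/-- The total space `P` with the leaf topology, the finest topology for which the horizontal
sections are continuous. -/
def Leaf (_B : SmoothPrincipalBundle EN EG EP N G P) (_Θ : LieAlgForm EG EP P) : Type _ := P

variable (B : SmoothPrincipalBundle EN EG EP N G P) (Θ : LieAlgForm EG EP P)

instance : TopologicalSpace (B.Leaf Θ) where
  IsOpen O := ∀ (U : Set N) (s : N → P), B.IsHorizontalSection Θ U s → ∀ y ∈ U,
    O (s y) → ∀ᶠ z in 𝓝 y, O (s z)
  isOpen_univ _ _ _ _ _ _ := Eventually.of_forall fun _ => trivial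
  isOpen_inter O O' h h' U s hs y hy hO := (h U s hs y hy hO.1).and (h' U s hs y hy hO.2)
  isOpen_sUnion S h U s hs y hy hO := by
    obtain ⟨O, hOS, hO⟩ := hO
    exact (h O hOS U s hs y hy hO).mono fun z hz => ⟨O, hOS, hz⟩

/-- The projection of `P` with its leaf topology. -/
def leafProj : B.Leaf Θ → N := B.proj

/-- The right translation of `P` with its leaf topology. -/
def leafAct (a : G) : B.Leaf Θ → B.Leaf Θ := fun u => B.act u a

/-- A map to `P`, regarded as a map to `P` with its leaf topology. -/
def toLeaf {X : Type*} (f : X → P) : X → B.Leaf Θ := f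

theorem continuous_leafProj : Continuous (B.leafProj Θ) := by
  refine ⟨fun V hV U s hs y hy hO => ?_⟩
  have h1 : B.proj (s y) ∈ V := hO
  rw [hs.proj_eq y hy] at h1
  filter_upwards [hV.mem_nhds h1, hs.isOpen.mem_nhds hy] with z hz hzU
  change B.proj (s z) ∈ V
  rwa [hs.proj_eq z hzU]

variable {B Θ}

theorem continuous_leafAct (hB : B.HasInvariantKernel Θ) (a : G) : Continuous (B.leafAct Θ a) :=
  ⟨fun _ hO U _ hs y hy hOs => hO U _ (hs.act hB a) y hy hOs⟩

theorem IsHorizontalSection.continuousAt_toLeaf {U : Set N} {s : N → P}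
    (hs : B.IsHorizontalSection Θ U s) {y : N} (hy : y ∈ U) : ContinuousAt (B.toLeaf Θ s) y :=
  tendsto_nhds.2 fun _ hO hsO => hO U s hs y hy hsO

variable {ℍ : ∀ u : P, Submodule ℝ (TangentSpace 𝓘(ℝ, EP) u)}
  [IsManifold 𝓘(ℝ, EN) ∞ N] [LieGroup 𝓘(ℝ, EG) ∞ G]

theorem IsHorizontalSection.isOpen_image (hΘ : B.IsFormOf ℍ Θ) (hB : B.HasInvariantKernel Θ)
    {U : Set N} {s : N → P} (hs : B.IsHorizontalSection Θ U s) :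
    IsOpen (B.toLeaf Θ s '' U) := by
  rintro V t ht y hy ⟨x, hx, hxy⟩
  have hxy' : s x = t y := hxy
  have : x = y := by rw [← hs.proj_eq x hx, hxy', ht.proj_eq y hy]
  subst this
  filter_upwards [hs.eventuallyEq hΘ hB ht hx hy hxy', hs.isOpen.mem_nhds hx] with z hz hzU
  exact ⟨z, hzU, hz.symm⟩

omit [IsManifold 𝓘(ℝ, EN) ∞ N] in
/-- Horizontal maps are continuous for the leaf topology. -/
theorem IsHorizontalNear.continuousAt_toLeaf {E : Type*} [NormedAddCommGroup E] [NormedSpace ℝ E]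
    {M : Type*} [TopologicalSpace M] [ChartedSpace E M] [IsManifold 𝓘(ℝ, E) ∞ M]
    (hΘ : B.IsFormOf ℍ Θ) (hB : B.HasInvariantKernel Θ)
    (hsec : ∀ u, ∃ (U : Set N) (s : N → P), B.IsHorizontalSection Θ U s ∧ B.proj u ∈ U ∧
      s (B.proj u) = u) {h : M → P} {m₀ : M} (hh : B.IsHorizontalNear E Θ h m₀) :
    ContinuousAt (B.toLeaf Θ h) m₀ := by
  obtain ⟨U, s, hs, hU, -⟩ := hsec (h m₀)
  obtain ⟨a, ha⟩ := hs.eventually_eq_act hΘ hB hh hU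
  have h1 : ContinuousAt (fun m => B.proj (h m)) m₀ :=
    B.contMDiff_proj.continuous.continuousAt.comp hh.self_of_nhds.1.continuousAt
  have h2 : ContinuousAt (fun m => B.toLeaf Θ (fun y => B.act (s y) a) (B.proj (h m))) m₀ :=
    ContinuousAt.comp (f := fun m => B.proj (h m)) ((hs.act hB a).continuousAt_toLeaf hU) h1
  exact h2.congr (ha.mono fun m hm => hm.symm)

/-- If there are horizontal sections through all points, then the projection is a covering map for
the leaf topology: over the domain `U` of a horizontal section, the translates of that section
identify the preimage of `U` with the product of `U` and the discrete set `G`. -/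
theorem isCoveringMap_leafProj (hΘ : B.IsFormOf ℍ Θ) (hB : B.HasInvariantKernel Θ)
    (hsec : ∀ u, ∃ (U : Set N) (s : N → P), B.IsHorizontalSection Θ U s ∧ B.proj u ∈ U ∧
      s (B.proj u) = u) : IsCoveringMap (B.leafProj Θ) := by
  intro x
  obtain ⟨u, rfl⟩ := B.proj_surjective x
  obtain ⟨U, s, hs, hU, -⟩ := hsec u
  -- the set `G` with its discrete topology
  obtain ⟨I, _, _, ⟨e⟩⟩ : ∃ (I : Type _) (_ : TopologicalSpace I) (_ : DiscreteTopology I),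
    Nonempty (I ≃ G) := ⟨G, ⊥, @DiscreteTopology.mk G ⊥ rfl, ⟨Equiv.refl G⟩⟩
  refine IsEvenlyCovered.to_isEvenlyCovered_preimage (I := I) ⟨inferInstance, U, hU, hs.isOpen,
    hs.isOpen.preimage (B.continuous_leafProj Θ), ?_⟩
  have hex : ∀ v : B.leafProj Θ ⁻¹' U, ∃ i, B.act (s (B.leafProj Θ v)) (e i) = v.1 := fun v => by
    obtain ⟨a, ha⟩ := B.exists_act_eq (u := s (B.leafProj Θ v)) (v := v.1) (hs.proj_eq _ v.2)
    exact ⟨e.symm a, by rw [e.apply_symm_apply, ha]⟩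
  choose c hc using hex
  have hproj : ∀ y ∈ U, ∀ a, B.proj (B.act (s y) a) = y := fun y hy a => by
    rw [B.proj_act, hs.proj_eq _ hy]
  have hc' : ∀ (v : B.leafProj Θ ⁻¹' U) (y : N) (i : I), y ∈ U → B.act (s y) (e i) = v.1 →
      c v = i := by
    intro v y i hy hyv
    have h1 : B.leafProj Θ v = y := by
      change B.proj v.1 = y
      rw [← hyv, hproj y hy]
    have h2 := hc v
    rw [h1, ← hyv] at h2
    exact e.injective (B.act_left_injective _ h2)
  let inv : U × I → B.leafProj Θ ⁻¹' U := fun p =>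
    ⟨B.toLeaf Θ (fun y => B.act (s y) (e p.2)) p.1.1, by
      change B.proj (B.act (s p.1.1) _) ∈ U
      rw [hproj _ p.1.2]
      exact p.1.2⟩
  refine ⟨{ toFun := fun v => (⟨B.leafProj Θ v, v.2⟩, c v)
            invFun := inv
            left_inv := fun v => Subtype.ext (hc v)
            right_inv := fun p => Prod.ext (Subtype.ext (hproj _ p.1.2 _))
              (hc' (inv p) p.1 p.2 p.1.2 rfl)
            continuous_toFun := ?_
            continuous_invFun := ?_ }, fun v => rfl⟩
  · refine Continuous.prodMk ?_ ?_
    · exact ((B.continuous_leafProj Θ).comp continuous_subtype_val).subtype_mk _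
    · refine continuous_discrete_rng.2 fun i => ?_
      have := ((hs.act hB (e i)).isOpen_image hΘ hB).preimage
        (continuous_subtype_val (p := fun v => v ∈ B.leafProj Θ ⁻¹' U))
      convert this using 1
      ext v
      constructor
      · intro h
        have h' : c v = i := h
        refine ⟨B.leafProj Θ v, v.2, ?_⟩
        rw [← h']
        exact hc v
      · rintro ⟨y, hy, hyv⟩
        exact hc' v y i hy hyv
  · refine continuous_prod_of_discrete_right.2 fun i => continuous_iff_continuousAt.2 fun y => ?_
    refine Topology.IsInducing.subtypeVal.continuousAt_iff.2 ?_
    exact ContinuousAt.comp (f := fun y : U => y.1)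
      ((hs.act hB (e i)).continuousAt_toLeaf y.2) continuousAt_subtype_val

end SmoothPrincipalBundle

end Leaf

/-! ### Universal coverings -/

section Covering

open Topology Set

variable {X A : Type*} [TopologicalSpace X] [TopologicalSpace A] {q : A → X}

/-- A covering of a connected space by a nonempty space is surjective, since its range is open and
closed. -/
theorem IsCoveringMap.surjective_of_connectedSpace [ConnectedSpace X] [Nonempty A]
    (hq : IsCoveringMap q) : Function.Surjective q := by
  have hclosed : IsClosed (range q) := by
    rw [← isOpen_compl_iff, isOpen_iff_mem_nhds]
    intro x hx
    obtain ⟨-, U, hxU, hU, -, H, -⟩ := hq x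
    have : IsEmpty (q ⁻¹' {x}) := ⟨fun y => hx ⟨y.1, y.2⟩⟩
    refine Filter.mem_of_superset (hU.mem_nhds hxU) ?_
    rintro _ hyU ⟨z, rfl⟩
    exact this.false (H ⟨z, hyU⟩).2
  exact range_eq_univ.1 (IsClopen.eq_univ ⟨hclosed, hq.isOpenMap.isOpen_range⟩ (range_nonempty q))

variable [SimplyConnectedSpace A] [LocallyPathConnectedSpace A]

/-- The deck transformations of the universal covering act transitively on the fibres. -/
theorem IsCoveringMap.exists_deckGroup_apply_eq (hq : IsCoveringMap q) {x y : A} (h : q x = q y) :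
    ∃ γ : deckGroup q, γ.1 x = y := by
  obtain ⟨f, ⟨hf, hqf⟩, -⟩ := hq.existsUnique_continuousMap_lifts ⟨q, hq.continuous⟩ x y h.symm
  obtain ⟨g, ⟨hg, hqg⟩, -⟩ := hq.existsUnique_continuousMap_lifts ⟨q, hq.continuous⟩ y x h
  have hqf' : ∀ z, q (f z) = q z := fun z => congrFun hqf z
  have hqg' : ∀ z, q (g z) = q z := fun z => congrFun hqg z
  have h1 : (fun z => g (f z)) = id := hq.eq_of_comp_eq (g.continuous.comp f.continuous)
    continuous_id (funext fun z => (hqg' _).trans (hqf' z)) x (by simp [hf, hg])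
  have h2 : (fun z => f (g z)) = id := hq.eq_of_comp_eq (f.continuous.comp g.continuous)
    continuous_id (funext fun z => (hqf' _).trans (hqg' z)) y (by simp [hf, hg])
  exact ⟨⟨⟨⟨f, g, congrFun h1, congrFun h2⟩, f.continuous, g.continuous⟩, hqf'⟩, hf⟩

omit [LocallyPathConnectedSpace A] in
/-- The product of the line with a simply connected space is simply connected. -/
theorem simplyConnectedSpace_real_prod : SimplyConnectedSpace (ℝ × A) := by
  obtain ⟨e⟩ := ContractibleSpace.hequiv ℝ Unit
  exact ((e.prodCongr (ContinuousMap.HomotopyEquiv.refl A)).trans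
    (Homeomorph.punitProd A).toHomotopyEquiv).simplyConnectedSpace

/-- A flow lifts to the universal covering. -/
theorem IsCoveringMap.exists_flow_lift (hq : IsCoveringMap q) (φ : Flow ℝ X) :
    ∃ φ' : Flow ℝ A, ∀ t x, q (φ' t x) = φ t (q x) := by
  have := simplyConnectedSpace_real_prod (A := A)
  obtain ⟨x₀⟩ : Nonempty A := inferInstance
  obtain ⟨f, ⟨hf, hqf⟩, -⟩ := hq.existsUnique_continuousMap_lifts
    (⟨fun p : ℝ × A => φ p.1 (q p.2), φ.continuous continuous_fst (hq.continuous.comp continuous_snd)⟩ :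
      C(ℝ × A, X)) (0, x₀) x₀ (by simp)
  have hqf' : ∀ t x, q (f (t, x)) = φ t (q x) := fun t x => congrFun hqf (t, x)
  have h0 : ∀ x, f (0, x) = x := congrFun (hq.eq_of_comp_eq (f.continuous.comp (by fun_prop))
    continuous_id (funext fun x => by simp [hqf']) x₀ hf)
  refine ⟨⟨fun t x => f (t, x), f.continuous, fun s t x => ?_, h0⟩, hqf'⟩
  refine congrFun (hq.eq_of_comp_eq (g₁ := fun s => f (s + t, x)) (g₂ := fun s => f (s, f (t, x)))
    (f.continuous.comp (by fun_prop)) (f.continuous.comp (by fun_prop))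
    (funext fun s => by simp [hqf', φ.map_add]) 0 (by simp [h0])) s

end Covering

/-! ### The developing section and the flat flow -/

section Flat

open Filter Topology Set

variable {EN : Type*} [NormedAddCommGroup EN] [NormedSpace ℝ EN]
  {EG : Type*} [NormedAddCommGroup EG] [NormedSpace ℝ EG]
  {EP : Type*} [NormedAddCommGroup EP] [NormedSpace ℝ EP]
  {N : Type*} [TopologicalSpace N] [ChartedSpace EN N]
  {G : Type*} [TopologicalSpace G] [ChartedSpace EG G] [Group G]
  {P : Type*} [TopologicalSpace P] [ChartedSpace EP P]
  {N' : Type*} [TopologicalSpace N'] [ChartedSpace EN N'] {q : N' → N}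

theorem modelDeriv_flow_time {Φ : Flow ℝ P} (h : IsSmoothFlow (E := EP) Φ) (u : P) (t r : ℝ) :
    modelDeriv ℝ EP (fun t => Φ t u) t r = r • modelGenerator EP Φ (Φ t u) := by
  have h1 : (fun s => Φ s u) = fun s => Φ (s - t) (Φ t u) := by
    ext s; rw [← Φ.map_add, sub_add_cancel]
  have hd : HasFDerivAt (fun s : ℝ => s - t) (ContinuousLinearMap.id ℝ ℝ) t :=
    (hasFDerivAt_id t).sub_const t
  have h2 := modelDeriv_comp_apply (E := ℝ) (E' := ℝ) (E'' := EP) (g := fun s => Φ s (Φ t u))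
    (f := fun s : ℝ => s - t) t (h.mdifferentiableAt_time _ _)
    (mdifferentiableAt_iff_differentiableAt.2 hd.differentiableAt) r
  rw [h1, h2, modelDeriv_eq_fderiv, hd.fderiv, sub_self, modelGenerator, ← map_smul]
  simp

namespace SmoothPrincipalBundle

variable {B : SmoothPrincipalBundle EN EG EP N G P}
  {ℍ : ∀ u : P, Submodule ℝ (TangentSpace 𝓘(ℝ, EP) u)} {Θ : LieAlgForm EG EP P}

/-- A flow with horizontal generator is continuous in time for the leaf topology. -/
theorem continuous_toLeaf_flow [LieGroup 𝓘(ℝ, EG) ∞ G] (hΘ : B.IsFormOf ℍ Θ)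
    (hB : B.HasInvariantKernel Θ)
    (hsec : ∀ u, ∃ (U : Set N) (s : N → P), B.IsHorizontalSection Θ U s ∧ B.proj u ∈ U ∧
      s (B.proj u) = u) {Φ : Flow ℝ P} (hΦ : IsSmoothFlow (E := EP) Φ)
    (hX : ∀ u, modelForm Θ u (modelGenerator EP Φ u) = 0) (u : P) :
    Continuous (B.toLeaf Θ fun t => Φ t u) := by
  refine continuous_iff_continuousAt.2 fun t => ?_
  refine IsHorizontalNear.continuousAt_toLeaf (E := ℝ) hΘ hB hsec
    (Eventually.of_forall fun t => ⟨hΦ.mdifferentiableAt_time t u, fun r => ?_⟩)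
  rw [modelDeriv_flow_time hΦ, map_smul, hX, smul_zero]

variable [LieGroup 𝓘(ℝ, EG) ∞ G] [IsManifold 𝓘(ℝ, EN) ∞ N]

omit [ChartedSpace EN N'] in
/-- A lift of `q` which is continuous for the leaf topology is locally the composition of `q` with a
horizontal section. -/
theorem IsHorizontalSection.eventually_eq_comp (hΘ : B.IsFormOf ℍ Θ) (hB : B.HasInvariantKernel Θ)
    {σ : N' → P} (hσ : Continuous (B.toLeaf Θ σ)) (hσq : ∀ x, B.proj (σ x) = q x)
    {U : Set N} {s : N → P} (hs : B.IsHorizontalSection Θ U s) {x : N'} (hx : q x ∈ U)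
    (hsx : s (q x) = σ x) : ∀ᶠ y in 𝓝 x, q y ∈ U ∧ σ y = s (q y) := by
  have h1 : ∀ᶠ y in 𝓝 x, B.toLeaf Θ σ y ∈ B.toLeaf Θ s '' U :=
    hσ.continuousAt.eventually ((hs.isOpen_image hΘ hB).mem_nhds ⟨q x, hx, hsx⟩)
  filter_upwards [h1] with y hy
  obtain ⟨z, hz, hzy⟩ := hy
  have hzy' : s z = σ y := hzy
  have : z = q y := by rw [← hσq y, ← hzy', hs.proj_eq z hz]
  rw [← this]
  exact ⟨hz, hzy'.symm⟩

/-- The map `(x, a) ↦ σ x · a` defined by a lift `σ` of `q` which is continuous for the leaf topology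
is a local diffeomorphism. -/
theorem isLocalDiffeomorph_act_lift (hq : IsUniversalCovering (EN := EN) q)
    (hΘ : B.IsFormOf ℍ Θ) (hB : B.HasInvariantKernel Θ)
    (hsec : ∀ u, ∃ (U : Set N) (s : N → P), B.IsHorizontalSection Θ U s ∧ B.proj u ∈ U ∧
      s (B.proj u) = u)
    {σ : N' → P} (hσ : Continuous (B.toLeaf Θ σ)) (hσq : ∀ x, B.proj (σ x) = q x) :
    IsLocalDiffeomorph (𝓘(ℝ, EN).prod 𝓘(ℝ, EG)) 𝓘(ℝ, EP) 1
      (fun p : N' × G => B.act (σ p.1) p.2) := by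
  rintro ⟨x₀, a₀⟩
  obtain ⟨ψ, hx₀, hψ⟩ := hq.isLocalDiffeomorph x₀
  obtain ⟨U, s, hs, hU, hsx⟩ := hsec (σ x₀)
  rw [hσq] at hU hsx
  obtain ⟨W, δ, hW, hx₀W, hδ, hδa⟩ := B.exists_contMDiffOn_translation (q x₀)
  have hev : ∀ᶠ y in 𝓝 x₀, y ∈ ψ.source ∧ q y ∈ W ∧ q y ∈ U ∧ σ y = s (q y) :=
    Filter.Eventually.and (ψ.open_source.mem_nhds hx₀)
      (((hq.isCoveringMap.continuous.continuousAt).eventually (hW.mem_nhds hx₀W)).and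
        (hs.eventually_eq_comp hΘ hB hσ hσq hU hsx))
  obtain ⟨O, hO, hOopen, hx₀O⟩ := eventually_nhds_iff.1 hev
  have hinv : ∀ y ∈ O, ψ.invFun (q y) = y := fun y hy => by
    rw [hψ (hO y hy).1]; exact ψ.left_inv' (hO y hy).1
  have hqO : IsOpen (q '' O) := hq.isCoveringMap.isOpenMap _ hOopen
  have hδu : ∀ u, B.proj u ∈ q '' O → B.act (s (B.proj u)) (δ (s (B.proj u), u)) = u := by
    rintro u ⟨y, hy, hyu⟩
    obtain ⟨-, h2, h3, -⟩ := hO y hy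
    rw [hyu] at h2 h3
    obtain ⟨b, hb⟩ := B.exists_act_eq (u := s (B.proj u)) (v := u) (hs.proj_eq _ h3)
    conv_lhs => rw [← hb, B.proj_act, hs.proj_eq _ h3]
    rw [hδa _ (by rw [hs.proj_eq _ h3]; exact h2), hb]
  refine ⟨{ toFun := fun p => B.act (σ p.1) p.2
            invFun := fun u => (ψ.invFun (B.proj u), δ (s (B.proj u), u))
            source := O ×ˢ univ
            target := B.proj ⁻¹' (q '' O)
            map_source' := ?_
            map_target' := ?_
            left_inv' := ?_
            right_inv' := ?_
            open_source := hOopen.prod isOpen_univ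
            open_target := hqO.preimage B.contMDiff_proj.continuous
            contMDiffOn_toFun := ?_
            contMDiffOn_invFun := ?_ }, ⟨hx₀O, trivial⟩, fun p hp => rfl⟩
  · rintro ⟨x, a⟩ ⟨hx, -⟩
    exact ⟨x, hx, by rw [B.proj_act, hσq]⟩
  · rintro u ⟨y, hy, hyu⟩
    refine ⟨?_, trivial⟩
    change ψ.invFun (B.proj u) ∈ O
    rw [← hyu, hinv y hy]
    exact hy
  · rintro ⟨x, a⟩ ⟨hx, -⟩
    obtain ⟨h1, h2, h3, h4⟩ := hO x hx
    have e : B.proj (B.act (σ x) a) = q x := by rw [B.proj_act, hσq]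
    dsimp only
    rw [e, hinv x hx, h4, hδa _ (by rw [hs.proj_eq _ h3]; exact h2)]
  · rintro u hu
    obtain ⟨y, hy, hyu⟩ := id hu
    change B.act (σ (ψ.invFun (B.proj u))) (δ (s (B.proj u), u)) = u
    rw [← hyu, hinv y hy, (hO y hy).2.2.2, hyu]
    exact hδu u hu
  · have h1 : ContMDiffOn (𝓘(ℝ, EN).prod 𝓘(ℝ, EG)) 𝓘(ℝ, EN) 1 (fun p : N' × G => q p.1)
        (O ×ˢ univ) :=
      ((hq.isLocalDiffeomorph.contMDiff.of_le (by norm_cast)).comp contMDiff_fst).contMDiffOn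
    have h2 : ContMDiffOn (𝓘(ℝ, EN).prod 𝓘(ℝ, EG)) 𝓘(ℝ, EP) 1 (fun p : N' × G => s (q p.1))
        (O ×ˢ univ) := hs.contMDiffOn.comp h1 fun p hp => (hO p.1 hp.1).2.2.1
    refine ((B.contMDiff_act.of_le (by norm_cast)).comp_contMDiffOn
      (h2.prodMk contMDiff_snd.contMDiffOn)).congr fun p hp => ?_
    rw [(hO p.1 hp.1).2.2.2]
    rfl
  · have hp : ContMDiffOn 𝓘(ℝ, EP) 𝓘(ℝ, EN) 1 B.proj (B.proj ⁻¹' (q '' O)) :=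
      (B.contMDiff_proj.of_le (by norm_cast)).contMDiffOn
    refine ContMDiffOn.prodMk ?_ ?_
    · refine (ψ.contMDiffOn_invFun.of_le (by norm_cast)).comp hp ?_
      rintro u ⟨y, hy, hyu⟩
      change B.proj u ∈ ψ.target
      rw [← hyu, hψ (hO y hy).1]
      exact ψ.map_source' (hO y hy).1
    · have h1 : ContMDiffOn 𝓘(ℝ, EP) 𝓘(ℝ, EP) 1 (fun u => s (B.proj u)) (B.proj ⁻¹' (q '' O)) :=
        hs.contMDiffOn.comp hp (by
          rintro u ⟨y, hy, hyu⟩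
          change B.proj u ∈ U
          rw [← hyu]; exact (hO y hy).2.2.1)
      refine (hδ.of_le (by norm_cast)).comp (h1.prodMk contMDiffOn_id) ?_
      rintro u ⟨y, hy, hyu⟩
      obtain ⟨-, h2, h3, -⟩ := hO y hy
      rw [hyu] at h2 h3
      refine ⟨?_, h2⟩
      change B.proj (s (B.proj u)) ∈ W
      rw [hs.proj_eq _ h3]; exact h2

/-- If there are horizontal sections through all points, and the generator of `Φ` is horizontal, then
`Φ` is flat. The universal covering lifts to a leaf, the representation `ρ` is the holonomy of that
leaf, and the lifts of the orbits of `φ` to the leaf are orbits of `Φ`. -/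
theorem isFlatFlow_of_isHorizontalSection [ConnectedSpace N]
    (hq : IsUniversalCovering (EN := EN) q) {φ : Flow ℝ N} {Φ : Flow ℝ P}
    (hΦ : B.IsPrincipalExtension φ Φ) (hΘ : B.IsFormOf ℍ Θ) (hB : B.HasInvariantKernel Θ)
    (hX : ∀ u, modelForm Θ u (modelGenerator EP Φ u) = 0)
    (hsec : ∀ u, ∃ (U : Set N) (s : N → P), B.IsHorizontalSection Θ U s ∧ B.proj u ∈ U ∧
      s (B.proj u) = u) : B.IsFlatFlow q φ Φ := by
  have := hq.simplyConnected
  have : LocallyPathConnectedSpace N' := ChartedSpace.locallyPathConnectedSpace EN N'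
  have hcov := isCoveringMap_leafProj hΘ hB hsec
  obtain ⟨x₀⟩ : Nonempty N' := inferInstance
  obtain ⟨u₀, hu₀⟩ := B.proj_surjective (q x₀)
  obtain ⟨σ, ⟨-, hσq⟩, -⟩ := hcov.existsUnique_continuousMap_lifts ⟨q, hq.isCoveringMap.continuous⟩
    x₀ (show B.Leaf Θ from u₀) hu₀
  obtain ⟨φ', hφ'⟩ := hq.isCoveringMap.exists_flow_lift φ
  let τ : N' → P := σ
  have hτ : Continuous (B.toLeaf Θ τ) := σ.continuous
  have hτq : ∀ x, B.proj (τ x) = q x := congrFun hσq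
  have hdeck : ∀ (γ : deckGroup q) x, q (γ.1 x) = q x := fun γ => γ.2
  have hρ : ∀ γ : deckGroup q, ∃ a, ∀ x, τ x = B.act (τ (γ.1 x)) a := by
    intro γ
    obtain ⟨a, ha⟩ := B.exists_act_eq (u := τ (γ.1 x₀)) (v := τ x₀)
      (by rw [hτq, hτq, hdeck])
    -- both sides are lifts of `q` to a leaf, and agree at `x₀`
    refine ⟨a, fun x => congrFun (hcov.eq_of_comp_eq hτ
      ((continuous_leafAct hB a).comp (hτ.comp γ.1.continuous)) (funext fun x => ?_) x₀ ha.symm) x⟩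
    exact (hτq x).trans ((B.proj_act _ _).trans ((hτq _).trans (hdeck γ x))).symm
  choose ρ hρ using hρ
  refine ⟨φ', MonoidHom.mk' ρ fun γ γ' => ?_, fun p => B.act (τ p.1) p.2, hφ',
    isLocalDiffeomorph_act_lift hq hΘ hB hsec hτ hτq, ?_, ?_, ?_, ?_, ?_⟩
  · apply B.act_left_injective (τ ((γ * γ').1 x₀))
    rw [← hρ, B.act_mul]
    exact (hρ γ' x₀).trans (congrArg (fun u => B.act u _) (hρ γ (γ'.1 x₀)))
  · intro u
    obtain ⟨x, hx⟩ := hq.isCoveringMap.surjective_of_connectedSpace (B.proj u)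
    obtain ⟨a, ha⟩ := B.exists_act_eq (u := τ x) (v := u) ((hτq x).trans hx)
    exact ⟨(x, a), ha⟩
  · intro x y a b
    constructor
    · intro h
      have hxy : q x = q y := by
        have := congrArg B.proj h
        simpa only [B.proj_act, hτq] using this
      obtain ⟨γ, rfl⟩ := hq.isCoveringMap.exists_deckGroup_apply_eq hxy
      refine ⟨γ, rfl, ?_⟩
      dsimp only at h
      rw [hρ γ x, ← B.act_mul] at h
      exact (B.act_left_injective _ h).symm
    · rintro ⟨γ, rfl, rfl⟩
      dsimp only
      rw [hρ γ x, ← B.act_mul]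
      rfl
  · intro x a
    rw [B.proj_act, hτq]
  · intro x a b
    exact B.act_mul _ _ _
  · intro t x a
    dsimp only
    rw [hΦ.2.2]
    congr 1
    -- both sides are lifts of the orbit of `q x` to a leaf, and agree at time zero
    have h0 : Φ 0 (τ x) = τ (φ' 0 x) := by rw [Φ.map_zero_apply, φ'.map_zero_apply]
    refine congrFun (hcov.eq_of_comp_eq (continuous_toLeaf_flow hΘ hB hsec hΦ.1 hX (τ x))
      (hτ.comp (φ'.continuous continuous_id continuous_const)) (funext fun t => ?_) 0 h0) t
    change B.proj (Φ t (τ x)) = B.proj (τ (φ' t x))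
    rw [hΦ.2.1, hτq, hτq, hφ']

end SmoothPrincipalBundle

end Flat

/-! ### Local bounds for differentials -/

section Bounds

open Filter Topology
open scoped Bundle

variable {E : Type*} [NormedAddCommGroup E] [NormedSpace ℝ E]
  {M : Type*} [TopologicalSpace M] [ChartedSpace E M] [IsManifold 𝓘(ℝ, E) ∞ M]

/-- Near the centre of a chart, a Riemannian metric is equivalent to the norm in the chart. -/
theorem eventually_norm_modelDeriv_extChartAt_le (g : RiemMetric E M) (x : M) :
    ∃ C, 0 < C ∧ ∀ᶠ y in 𝓝 x, ∀ v : E,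
      ‖modelDeriv E E (extChartAt 𝓘(ℝ, E) x) y v‖ ≤ C * metricNorm g y v ∧
      metricNorm g y v ≤ C * ‖modelDeriv E E (extChartAt 𝓘(ℝ, E) x) y v‖ := by
  have : IsManifold 𝓘(ℝ, E) 1 M := IsManifold.of_le (n := ∞) (by norm_cast)
  let i : Bundle.RiemannianBundle (fun x : M => TangentSpace 𝓘(ℝ, E) x) := ⟨g.toRiemannianMetric⟩
  obtain ⟨C, hC, h1⟩ :=
    eventually_norm_trivializationAt_lt E (fun x : M => TangentSpace 𝓘(ℝ, E) x) x
  obtain ⟨C', hC', h2⟩ :=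
    eventually_norm_symmL_trivializationAt_lt E (fun x : M => TangentSpace 𝓘(ℝ, E) x) x
  have hnorm : ∀ (y : M) (v : TangentSpace 𝓘(ℝ, E) y), ‖v‖ = metricNorm g y v := fun y v =>
    norm_eq_sqrt_real_inner v
  refine ⟨max C C', lt_max_of_lt_left hC, ?_⟩
  have hb : ∀ᶠ y in 𝓝 x, y ∈ (chartAt E x).source := chart_source_mem_nhds E x
  filter_upwards [h1, h2, hb] with y h1 h2 hy v
  set t := trivializationAt E (fun x : M => TangentSpace 𝓘(ℝ, E) x) x
  have hy' : y ∈ t.baseSet := by simpa [t] using hy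
  have e : t.continuousLinearMapAt ℝ y v = modelDeriv E E (extChartAt 𝓘(ℝ, E) x) y v := by
    rw [TangentBundle.continuousLinearMapAt_trivializationAt hy]; rfl
  rw [← e]
  constructor
  · refine ((t.continuousLinearMapAt ℝ y).le_opNorm v).trans ?_
    exact mul_le_mul (h1.le.trans (le_max_left _ _)) (hnorm y v).le (norm_nonneg _)
      (hC.le.trans (le_max_left _ _))
  · have h3 := (t.symmL ℝ y).le_opNorm (t.continuousLinearMapAt ℝ y v)
    have h4 : ‖t.symmL ℝ y (t.continuousLinearMapAt ℝ y v)‖ = metricNorm g y v :=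
      (congrArg norm (t.symmL_continuousLinearMapAt (R := ℝ) hy' v)).trans (hnorm y v)
    rw [← h4]
    exact h3.trans (mul_le_mul_of_nonneg_right (h2.le.trans (le_max_right _ _)) (norm_nonneg _))

/-- The differential of a `C¹` map is locally bounded. -/
theorem ContMDiffAt.eventually_metricNorm_modelDeriv_le (g : RiemMetric E M) {f : M → M} {x : M}
    (hf : ContMDiffAt 𝓘(ℝ, E) 𝓘(ℝ, E) 1 f x) :
    ∃ C, 0 < C ∧ ∀ᶠ y in 𝓝 x, ∀ v : E,
      metricNorm g (f y) (modelDeriv E E f y v) ≤ C * metricNorm g y v := by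
  obtain ⟨C, hC, h1⟩ := eventually_norm_modelDeriv_extChartAt_le g x
  obtain ⟨C', hC', h2⟩ := eventually_norm_modelDeriv_extChartAt_le g (f x)
  set c := extChartAt 𝓘(ℝ, E) x
  set c' := extChartAt 𝓘(ℝ, E) (f x)
  have hc0 : c.symm (c x) = x := extChartAt_to_inv x
  have hF : ContDiffAt ℝ 1 (fun p => c' (f (c.symm p))) (c x) := by
    rw [← contMDiffAt_iff_contDiffAt]
    have d1 : ContMDiffAt 𝓘(ℝ, E) 𝓘(ℝ, E) 1 c.symm (c x) :=
      (contMDiffOn_extChartAt_symm x).contMDiffAt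
        ((isOpen_extChartAt_target x).mem_nhds (mem_extChartAt_target x))
    have d2 : ContMDiffAt 𝓘(ℝ, E) 𝓘(ℝ, E) 1 f (c.symm (c x)) := by rwa [hc0]
    have d3 : ContMDiffAt 𝓘(ℝ, E) 𝓘(ℝ, E) 1 c' (f (c.symm (c x))) := by
      rw [hc0]; exact contMDiffAt_extChartAt
    exact d3.comp (c x) (d2.comp (c x) d1)
  -- the derivative of the map read in charts is continuous, hence locally bounded
  obtain ⟨K, hK⟩ : ∃ K, ∀ᶠ p in 𝓝 (c x), ‖fderiv ℝ (fun p => c' (f (c.symm p))) p‖ ≤ K := by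
    have : ContinuousAt (fderiv ℝ (fun p => c' (f (c.symm p)))) (c x) :=
      (hF.fderiv_right (m := 0) (by norm_num)).continuousAt
    exact ⟨‖fderiv ℝ (fun p => c' (f (c.symm p))) (c x)‖ + 1,
      (this.norm.eventually_lt_const (lt_add_one _)).mono fun p hp => hp.le⟩
  have hd : ∀ᶠ y in 𝓝 x, MDifferentiableAt 𝓘(ℝ, E) 𝓘(ℝ, E) f y := by
    have : IsManifold 𝓘(ℝ, E) 1 M := IsManifold.of_le (n := ∞) (by norm_cast)
    have := (contMDiffAt_iff_contMDiffAt_nhds (by norm_num)).1 hf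
    exact this.mono fun y hy => hy.mdifferentiableAt one_ne_zero
  have hc : ContinuousAt c x := continuousAt_extChartAt x
  refine ⟨C' * ((|K| + 1) * C), by positivity, ?_⟩
  filter_upwards [h1, hf.continuousAt.eventually h2, hd, hc.eventually hK,
    extChartAt_source_mem_nhds (I := 𝓘(ℝ, E)) x,
    hf.continuousAt.eventually (extChartAt_source_mem_nhds (I := 𝓘(ℝ, E)) (f x))]
    with y h1 h2 hd hK hy hfy v
  have hcy : c.symm (c y) = y := c.left_inv hy
  have dy : MDifferentiableAt 𝓘(ℝ, E) 𝓘(ℝ, E) c.symm (c y) :=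
    mdifferentiableAt_extChartAt_symm' (c.map_source hy)
  have e : modelDeriv E E c' (f y) (modelDeriv E E f y v) =
      fderiv ℝ (fun p => c' (f (c.symm p))) (c y) (modelDeriv E E c y v) := by
    have d2 : MDifferentiableAt 𝓘(ℝ, E) 𝓘(ℝ, E) f (c.symm (c y)) := by rwa [hcy]
    have d3 : MDifferentiableAt 𝓘(ℝ, E) 𝓘(ℝ, E) c' (f (c.symm (c y))) := by
      rw [hcy]; exact mdifferentiableAt_extChartAt'' hfy
    rw [← modelDeriv_eq_fderiv, modelDeriv_comp_apply (g := c') (f := fun p => f (c.symm p)) (c y)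
      d3 (d2.comp (c y) dy), modelDeriv_comp_apply (g := f) (c y) d2 dy, hcy,
      modelDeriv_symm_extChartAt hy]
  calc metricNorm g (f y) (modelDeriv E E f y v)
      ≤ C' * ‖modelDeriv E E c' (f y) (modelDeriv E E f y v)‖ := (h2 _).2
    _ = C' * ‖fderiv ℝ (fun p => c' (f (c.symm p))) (c y) (modelDeriv E E c y v)‖ := by rw [e]
    _ ≤ C' * ((|K| + 1) * ‖modelDeriv E E c y v‖) := by
        gcongr
        refine (ContinuousLinearMap.le_opNorm _ _).trans ?_
        gcongr
        exact hK.trans ((le_abs_self K).trans (by linarith))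
    _ ≤ C' * ((|K| + 1) * (C * metricNorm g y v)) := by
        gcongr
        exact (h1 v).1
    _ = C' * ((|K| + 1) * C) * metricNorm g y v := by ring

end Bounds

/-! ### Flat flows have integrable horizontal distributions -/

section FlatImpliesIntegrable

open Filter Topology Set

variable {EN : Type*} [NormedAddCommGroup EN] [NormedSpace ℝ EN]
  {EG : Type*} [NormedAddCommGroup EG] [NormedSpace ℝ EG]
  {EP : Type*} [NormedAddCommGroup EP] [NormedSpace ℝ EP]
  {N : Type*} [TopologicalSpace N] [ChartedSpace EN N]
  {G : Type*} [TopologicalSpace G] [ChartedSpace EG G] [Group G]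
  {P : Type*} [TopologicalSpace P] [ChartedSpace EP P]
  {N' : Type*} [TopologicalSpace N'] [ChartedSpace EN N'] {q : N' → N}

/-- A continuous lift of a differentiable map through a local diffeomorphism is differentiable. -/
theorem IsLocalDiffeomorph.mdifferentiableAt_lift {E M : Type*} [NormedAddCommGroup E]
    [NormedSpace ℝ E] [TopologicalSpace M] [ChartedSpace E M]
    (hq : IsLocalDiffeomorph 𝓘(ℝ, EN) 𝓘(ℝ, EN) ∞ q) {h : M → N'} {m : M} (hc : ContinuousAt h m)
    (hd : MDifferentiableAt 𝓘(ℝ, E) 𝓘(ℝ, EN) (fun m => q (h m)) m) :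
    MDifferentiableAt 𝓘(ℝ, E) 𝓘(ℝ, EN) h m := by
  obtain ⟨ψ, hm, hψ⟩ := hq (h m)
  have hq' : q (h m) ∈ ψ.target := by rw [hψ hm]; exact ψ.map_source' hm
  have h1 : MDifferentiableAt 𝓘(ℝ, EN) 𝓘(ℝ, EN) ψ.invFun (q (h m)) :=
    (ψ.contMDiffOn_invFun.contMDiffAt (ψ.open_target.mem_nhds hq')).mdifferentiableAt (by simp)
  refine (h1.comp m hd).congr_of_eventuallyEq ?_
  filter_upwards [hc.eventually (ψ.open_source.mem_nhds hm)] with m' hm'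
  change h m' = ψ.invFun (q (h m'))
  rw [hψ hm']
  exact (ψ.left_inv' hm').symm

theorem IsLocalDiffeomorph.mdifferentiableAt' (hq : IsLocalDiffeomorph 𝓘(ℝ, EN) 𝓘(ℝ, EN) ∞ q)
    (x : N') : MDifferentiableAt 𝓘(ℝ, EN) 𝓘(ℝ, EN) q x :=
  (hq.contMDiff x).mdifferentiableAt (by simp)

theorem IsLocalDiffeomorph.bijective_modelDeriv (hq : IsLocalDiffeomorph 𝓘(ℝ, EN) 𝓘(ℝ, EN) ∞ q)
    (x : N') : Function.Bijective (modelDeriv EN EN q x) := by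
  have h := (hq.mfderivToContinuousLinearEquiv (by simp) x).bijective
  have e := hq.mfderivToContinuousLinearEquiv_coe (x := x) (by simp)
  have e' : ∀ v, hq.mfderivToContinuousLinearEquiv (by simp) x v = modelDeriv EN EN q x v :=
    fun v => congrArg (fun T : EN →L[ℝ] EN => T v) e
  exact (funext e' : _ = _) ▸ h

/-- If `b` is bounded by a multiple of `a` and `a` is exponentially small relative to `b` up to
constants, then the constant `β` vanishes. -/
theorem eq_zero_of_forall_mul_le {a b : ℝ → ℝ} {β C K c : ℝ} (hc : 0 < c) (hβ : 0 ≤ β)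
    (ha : ∀ t, 0 ≤ t → 0 < a t) (hb : ∀ t, 0 ≤ t → b t ≤ K * a t) (hC : 0 ≤ C)
    (h : ∀ t, 0 ≤ t → a t * β ≤ C * Real.exp (-c * t) * b t) : β = 0 := by
  have hlim : Tendsto (fun t : ℝ => C * K * Real.exp (-c * t)) atTop (𝓝 0) := by
    simpa using (tendsto_exp_neg_mul_atTop hc).const_mul (C * K)
  refine le_antisymm (ge_of_tendsto hlim ?_) hβ
  filter_upwards [eventually_ge_atTop 0] with t ht
  have h1 := h t ht
  have h2 : C * Real.exp (-c * t) * b t ≤ C * Real.exp (-c * t) * (K * a t) := by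
    have := hb t ht
    gcongr
  refine le_of_mul_le_mul_left ?_ (ha t ht)
  calc a t * β ≤ _ := h1.trans h2
    _ = a t * (C * K * Real.exp (-c * t)) := by ring

namespace SmoothPrincipalBundle

variable (B : SmoothPrincipalBundle EN EG EP N G P)

variable (q) in
/-- A developing section: a lift `σ : N' → P` of the universal covering `q`, of class `C¹`, which is
equivariant up to right translations and maps the orbits of a flow `φ'` to those of `Φ`. -/
structure IsDevelopingSection (Φ : Flow ℝ P) (φ' : Flow ℝ N') (σ : N' → P) : Prop where
  contMDiff : ContMDiff 𝓘(ℝ, EN) 𝓘(ℝ, EP) 1 σ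
  proj_eq : ∀ x, B.proj (σ x) = q x
  exists_deck : ∀ γ : deckGroup q, ∃ b, ∀ x, σ (γ.1 x) = B.act (σ x) b
  flow_eq : ∀ t x, Φ t (σ x) = σ (φ' t x)

variable {B} {φ : Flow ℝ N} {Φ : Flow ℝ P} {φ' : Flow ℝ N'} {σ : N' → P}

/-- The restriction of the isomorphism to `N' × {1}` is a developing section. -/
theorem IsFlatFlow.exists_isDevelopingSection (h : B.IsFlatFlow q φ Φ) :
    ∃ (φ' : Flow ℝ N') (σ : N' → P), (∀ t x, q (φ' t x) = φ t (q x)) ∧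
      B.IsDevelopingSection q Φ φ' σ ∧ ∀ u, ∃ x a, B.act (σ x) a = u := by
  obtain ⟨φ', ρ, F, hφ', hF, hsurj, hfib, hq, hact, hflow⟩ := h
  refine ⟨φ', fun x => F (x, 1), hφ', ⟨?_, fun x => hq x 1, fun γ => ⟨(ρ γ)⁻¹, fun x => ?_⟩,
    fun t x => hflow t x 1⟩, fun u => ?_⟩
  · exact hF.contMDiff.comp (contMDiff_id.prodMk contMDiff_const)
  · rw [← hact, one_mul, eq_comm, hfib]
    exact ⟨γ, rfl, (mul_inv_cancel _).symm⟩
  · obtain ⟨⟨x, a⟩, rfl⟩ := hsurj u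
    exact ⟨x, a, by rw [← hact, one_mul]⟩

theorem IsDevelopingSection.act (h : B.IsDevelopingSection q Φ φ' σ)
    (hΦ : B.IsPrincipalExtension φ Φ) (a : G) :
    B.IsDevelopingSection q Φ φ' (fun x => B.act (σ x) a) where
  contMDiff := ((B.contMDiff_act_left a).of_le (by norm_cast)).comp h.contMDiff
  proj_eq x := by rw [B.proj_act, h.proj_eq]
  exists_deck γ := by
    obtain ⟨b, hb⟩ := h.exists_deck γ
    refine ⟨a⁻¹ * (b * a), fun x => ?_⟩
    rw [hb, B.act_mul, B.act_inv_act, B.act_mul]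
  flow_eq t x := by rw [hΦ.2.2, h.flow_eq]

theorem IsDevelopingSection.mdifferentiableAt (h : B.IsDevelopingSection q Φ φ' σ) (x : N') :
    MDifferentiableAt 𝓘(ℝ, EN) 𝓘(ℝ, EP) σ x :=
  (h.contMDiff x).mdifferentiableAt one_ne_zero

theorem IsDevelopingSection.modelDeriv_proj (h : B.IsDevelopingSection q Φ φ' σ) (x : N')
    (y : EN) : modelDeriv EP EN B.proj (σ x) (modelDeriv EN EP σ x y) = modelDeriv EN EN q x y := by
  rw [← modelDeriv_comp_apply x (B.mdifferentiableAt_proj _) (h.mdifferentiableAt x)]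
  simp only [h.proj_eq]

variable [IsManifold 𝓘(ℝ, EP) ∞ P]

/-- Near a given point, the differential of a developing section is bounded, in terms of the
projections to the base of tangent vectors of `P`. -/
theorem IsDevelopingSection.eventually_metricNorm_le (h : B.IsDevelopingSection q Φ φ' σ)
    (hq : IsLocalDiffeomorph 𝓘(ℝ, EN) 𝓘(ℝ, EN) ∞ q) (g : RiemMetric EP P) (x₀ : N') :
    ∃ C, 0 < C ∧ ∀ᶠ x in 𝓝 x₀, ∀ (y : EN) (w : EP),
      modelDeriv EN EN q x y = modelDeriv EP EN B.proj (σ x) w →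
      metricNorm g (σ x) (modelDeriv EN EP σ x y) ≤ C * metricNorm g (σ x) w := by
  obtain ⟨ψ, hx₀, hψ⟩ := hq x₀
  have hψinv : ∀ x ∈ ψ.source, ContMDiffAt 𝓘(ℝ, EN) 𝓘(ℝ, EN) ∞ ψ.invFun (q x) := fun x hx =>
    ψ.contMDiffOn_invFun.contMDiffAt
      (ψ.open_target.mem_nhds (by rw [hψ hx]; exact ψ.map_source' hx))
  have hleft : ∀ x ∈ ψ.source, ψ.invFun (q x) = x := fun x hx => by
    rw [hψ hx]; exact ψ.left_inv' hx
  -- the projection of `P` to the image of `σ` along the fibres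
  set f : P → P := fun u => σ (ψ.invFun (B.proj u))
  have hf : ContMDiffAt 𝓘(ℝ, EP) 𝓘(ℝ, EP) 1 f (σ x₀) := by
    have h1 : ContMDiffAt 𝓘(ℝ, EP) 𝓘(ℝ, EN) 1 (fun u => ψ.invFun (B.proj u)) (σ x₀) := by
      refine ContMDiffAt.comp (σ x₀) ?_ ((B.contMDiff_proj (σ x₀)).of_le (by norm_cast))
      rw [h.proj_eq]
      exact (hψinv x₀ hx₀).of_le (by norm_cast)
    exact (h.contMDiff _).comp (σ x₀) h1
  obtain ⟨C, hC, hev⟩ := hf.eventually_metricNorm_modelDeriv_le g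
  refine ⟨C, hC, ?_⟩
  filter_upwards [h.contMDiff.continuous.continuousAt.eventually hev, ψ.open_source.mem_nhds hx₀]
    with x hx hxψ y w hyw
  have h1 := hx w
  have h2 : f (σ x) = σ x := by
    simp only [f, h.proj_eq, hleft x hxψ]
  have d1 : MDifferentiableAt 𝓘(ℝ, EN) 𝓘(ℝ, EN) ψ.invFun (q x) :=
    (hψinv x hxψ).mdifferentiableAt (by simp)
  have d2 : MDifferentiableAt 𝓘(ℝ, EN) 𝓘(ℝ, EN) ψ.invFun (B.proj (σ x)) := by rwa [h.proj_eq]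
  have d3 : MDifferentiableAt 𝓘(ℝ, EP) 𝓘(ℝ, EN) (fun u => ψ.invFun (B.proj u)) (σ x) :=
    d2.comp (σ x) (B.mdifferentiableAt_proj _)
  have h3 : modelDeriv EP EP f (σ x) w = modelDeriv EN EP σ x y := by
    rw [modelDeriv_comp_apply (g := σ) (σ x) (h.mdifferentiableAt _) d3,
      modelDeriv_comp_apply (g := ψ.invFun) (σ x) d2 (B.mdifferentiableAt_proj _), ← hyw,
      h.proj_eq, hleft x hxψ]
    congr 1
    refine modelDeriv_modelDeriv_of_leftInverse x ?_ d1 (hq.mdifferentiableAt' x) y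
    filter_upwards [ψ.open_source.mem_nhds hxψ] with z hz using hleft z hz
  rwa [h2, h3] at h1

/-- The differential of a developing section is uniformly bounded, in terms of the projections to
the base of tangent vectors of `P`: the base is compact, and the metric is right-invariant. -/
theorem IsDevelopingSection.exists_metricNorm_le [CompactSpace N] [ConnectedSpace N]
    (h : B.IsDevelopingSection q Φ φ' σ) (hq : IsUniversalCovering (EN := EN) q)
    {g : RiemMetric EP P} (hg : B.IsRightInvariant g) :
    ∃ C, 0 < C ∧ ∀ (x : N') (y : EN) (w : EP),
      modelDeriv EN EN q x y = modelDeriv EP EN B.proj (σ x) w →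
      metricNorm g (σ x) (modelDeriv EN EP σ x y) ≤ C * metricNorm g (σ x) w := by
  have := hq.simplyConnected
  have : LocallyPathConnectedSpace N' := ChartedSpace.locallyPathConnectedSpace EN N'
  have key : ∃ C, 0 < C ∧ ∀ x, q x ∈ (univ : Set N) → ∀ (y : EN) (w : EP),
      modelDeriv EN EN q x y = modelDeriv EP EN B.proj (σ x) w →
      metricNorm g (σ x) (modelDeriv EN EP σ x y) ≤ C * metricNorm g (σ x) w := by
    refine isCompact_univ.induction_on (p := fun S : Set N => ∃ C, 0 < C ∧ ∀ x, q x ∈ S →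
      ∀ (y : EN) (w : EP), modelDeriv EN EN q x y = modelDeriv EP EN B.proj (σ x) w →
      metricNorm g (σ x) (modelDeriv EN EP σ x y) ≤ C * metricNorm g (σ x) w) ?_ ?_ ?_ ?_
    · exact ⟨1, one_pos, fun x hx => hx.elim⟩
    · rintro S T hST ⟨C, hC, hT⟩
      exact ⟨C, hC, fun x hx => hT x (hST hx)⟩
    · rintro S T ⟨C, hC, hS⟩ ⟨C', hC', hT⟩
      refine ⟨max C C', lt_max_of_lt_left hC, fun x hx y w hyw => ?_⟩
      have := metricNorm_nonneg g (σ x) w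
      rcases hx with hx | hx
      · exact (hS x hx y w hyw).trans (by gcongr; exact le_max_left _ _)
      · exact (hT x hx y w hyw).trans (by gcongr; exact le_max_right _ _)
    · intro n _
      obtain ⟨x₀, rfl⟩ := hq.isCoveringMap.surjective_of_connectedSpace n
      obtain ⟨C, hC, hev⟩ := h.eventually_metricNorm_le hq.isLocalDiffeomorph g x₀
      obtain ⟨O, hO, hOopen, hx₀⟩ := eventually_nhds_iff.1 hev
      refine ⟨q '' O, mem_nhdsWithin_of_mem_nhds
        ((hq.isCoveringMap.isOpenMap _ hOopen).mem_nhds ⟨x₀, hx₀, rfl⟩), C, hC, ?_⟩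
      -- a deck transformation moves the given point to `O`
      rintro z ⟨x, hx, hxz⟩ y w hyw
      obtain ⟨γ, rfl⟩ := hq.isCoveringMap.exists_deckGroup_apply_eq hxz
      obtain ⟨b, hb⟩ := h.exists_deck γ
      have hγ : ∀ x, q (γ.1 x) = q x := γ.2
      have dγ : MDifferentiableAt 𝓘(ℝ, EN) 𝓘(ℝ, EN) γ.1 x :=
        hq.isLocalDiffeomorph.mdifferentiableAt_lift γ.1.continuous.continuousAt
          (by simp only [hγ]; exact hq.isLocalDiffeomorph.mdifferentiableAt' x)
      have eγ : ∀ v, modelDeriv EN EN q (γ.1 x) (modelDeriv EN EN γ.1 x v) =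
          modelDeriv EN EN q x v := fun v => by
        rw [← modelDeriv_comp_apply x (hq.isLocalDiffeomorph.mdifferentiableAt' _) dγ]
        simp only [hγ]
      obtain ⟨y', hy'⟩ := (hq.isLocalDiffeomorph.bijective_modelDeriv x).2
        (modelDeriv EN EN q (γ.1 x) y)
      have hyy' : modelDeriv EN EN γ.1 x y' = y :=
        (hq.isLocalDiffeomorph.bijective_modelDeriv (γ.1 x)).1 ((eγ y').trans hy')
      have e1 : modelDeriv EN EP σ (γ.1 x) y =
          modelDeriv EP EP (fun u => B.act u b) (σ x) (modelDeriv EN EP σ x y') := by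
        rw [← hyy', ← modelDeriv_comp_apply x (h.mdifferentiableAt _) dγ,
          ← modelDeriv_comp_apply (g := fun u => B.act u b) x (B.mdifferentiableAt_act_left _ _)
            (h.mdifferentiableAt x)]
        simp only [hb]
      rw [hb] at hyw
      rw [e1, hb, metricNorm_act hg]
      obtain ⟨w', rfl⟩ : ∃ w', modelDeriv EP EP (fun u => B.act u b) (σ x) w' = w :=
        ⟨_, B.modelDeriv_act_act_inv b (σ x) w⟩
      rw [metricNorm_act hg]
      refine hO x hx y' w' ?_
      rw [hy', hyw, B.modelDeriv_proj_act]
  obtain ⟨C, hC, hb⟩ := key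
  exact ⟨C, hC, fun x => hb x trivial⟩

/-- The image of the differential of a developing section contains the dynamical horizontal
distribution: for `v` in `E_s` the tangent vector `k` of the developing section over the projection of
`v` satisfies `|dΦ_t k| ≤ C |dΦ_t v|`, so by domination the central vector `k - v` vanishes. -/
theorem IsDevelopingSection.exists_modelDeriv_eq [CompactSpace N] [ConnectedSpace N]
    (h : B.IsDevelopingSection q Φ φ' σ) (hq : IsUniversalCovering (EN := EN) q)
    (hφ : IsSmoothFlow (E := EN) φ) (hΦ : B.IsPrincipalExtension φ Φ)
    (hφ' : ∀ t x, q (φ' t x) = φ t (q x))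
    {ℍ : ∀ u : P, Submodule ℝ (TangentSpace 𝓘(ℝ, EP) u)} (hℍ : B.IsDynamicalHorizontal Φ ℍ)
    (x : N') {w : EP} (hw : w ∈ ℍ (σ x)) : ∃ y, modelDeriv EN EP σ x y = w := by
  obtain ⟨Es, Eu, ⟨-, hs, hu, g, hg, C, c, hC, hc, -, -, hs2, hu2⟩, hH⟩ := hℍ
  obtain ⟨K, hK, hbound⟩ := h.exists_metricNorm_le hq hg
  have hd := hq.isLocalDiffeomorph
  have dφ' : ∀ t x, MDifferentiableAt 𝓘(ℝ, EN) 𝓘(ℝ, EN) (φ' t) x := fun t x =>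
    hd.mdifferentiableAt_lift (φ'.continuous continuous_const continuous_id).continuousAt (by
      simp only [hφ']
      exact (hφ.mdifferentiableAt t (q x)).comp x (hd.mdifferentiableAt' x))
  -- the tangent vectors of the developing section are controlled along the flow
  have hflow : ∀ t (y : EN) (v : EP), modelDeriv EN EN q x y = modelDeriv EP EN B.proj (σ x) v →
      metricNorm g (Φ t (σ x)) (modelDeriv EP EP (Φ t) (σ x) (modelDeriv EN EP σ x y)) ≤
        K * metricNorm g (Φ t (σ x)) (modelDeriv EP EP (Φ t) (σ x) v) := by
    intro t y v hyv
    have e1 : modelDeriv EP EP (Φ t) (σ x) (modelDeriv EN EP σ x y) =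
        modelDeriv EN EP σ (φ' t x) (modelDeriv EN EN (φ' t) x y) := by
      rw [← modelDeriv_comp_apply x (hΦ.1.mdifferentiableAt t _) (h.mdifferentiableAt x),
        ← modelDeriv_comp_apply x (h.mdifferentiableAt _) (dφ' t x)]
      simp only [h.flow_eq]
    rw [e1]
    have e2 : modelDeriv EN EN q (φ' t x) (modelDeriv EN EN (φ' t) x y) =
        modelDeriv EP EN B.proj (Φ t (σ x)) (modelDeriv EP EP (Φ t) (σ x) v) := by
      rw [hΦ.modelDeriv_proj_flow hφ, ← hyv, h.proj_eq,
        ← modelDeriv_comp_apply x (hd.mdifferentiableAt' _) (dφ' t x),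
        ← modelDeriv_comp_apply x (hφ.mdifferentiableAt t _) (hd.mdifferentiableAt' x)]
      simp only [hφ']
    rw [h.flow_eq] at e2 ⊢
    exact hbound _ _ _ e2
  -- the case of a vector which is dominated by the central vectors, along `ε t` for `t ≥ 0`
  have hdom : ∀ (ε : ℝ) (v : EP), (∀ t, 0 ≤ t → ∀ V : EP, V ∈ B.central Φ (σ x) →
      metricNorm g (Φ (ε * t) (σ x)) (modelDeriv EP EP (Φ (ε * t)) (σ x) v) * metricNorm g (σ x) V ≤
        C * Real.exp (-c * t) * metricNorm g (σ x) v *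
          metricNorm g (Φ (ε * t) (σ x)) (modelDeriv EP EP (Φ (ε * t)) (σ x) V)) →
      ∃ y, modelDeriv EN EP σ x y = v := by
    intro ε v hv
    by_cases hv0 : v = 0
    · exact ⟨0, by rw [hv0, map_zero]⟩
    obtain ⟨y, hy⟩ := (hd.bijective_modelDeriv x).2 (modelDeriv EP EN B.proj (σ x) v)
    refine ⟨y, ?_⟩
    set k := modelDeriv EN EP σ x y
    have hvert : k - v ∈ B.central Φ (σ x) := by
      rw [mem_central_iff]
      refine ⟨0, ?_⟩
      rw [zero_smul, sub_zero, map_sub, h.modelDeriv_proj, hy, sub_self]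
    have hinj : ∀ t, modelDeriv EP EP (Φ t) (σ x) v ≠ 0 := fun t h0 =>
      hv0 (by rw [← modelDeriv_flow_neg hΦ.1 t (σ x) v, h0, map_zero])
    have hzero : metricNorm g (σ x) (k - v) = 0 := by
      refine eq_zero_of_forall_mul_le
        (a := fun t => metricNorm g (Φ (ε * t) (σ x)) (modelDeriv EP EP (Φ (ε * t)) (σ x) v))
        (b := fun t => metricNorm g (Φ (ε * t) (σ x)) (modelDeriv EP EP (Φ (ε * t)) (σ x) (k - v)))
        (C := C * metricNorm g (σ x) v) (K := K + 1) hc (metricNorm_nonneg _ _ _)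
        (fun t _ => metricNorm_pos _ _ (hinj _)) (fun t _ => ?_)
        (mul_nonneg hC.le (metricNorm_nonneg _ _ _)) (fun t ht => ?_)
      · rw [map_sub, sub_eq_add_neg, add_mul, one_mul]
        refine (metricNorm_add_le _ _ _ _).trans ?_
        rw [metricNorm_neg]
        exact add_le_add_left (hflow _ y v hy) _
      · refine (hv t ht _ hvert).trans (le_of_eq ?_)
        ring
    by_contra hne
    exact (metricNorm_pos g (σ x) (sub_ne_zero.2 hne)).ne' hzero
  rw [hH] at hw
  obtain ⟨z, hz, X, hX, rfl⟩ := (Submodule.mem_sup (R := ℝ) (M := TangentSpace 𝓘(ℝ, EP) (σ x))).1 hw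
  obtain ⟨ws, hws, wu, hwu, rfl⟩ :=
    (Submodule.mem_sup (R := ℝ) (M := TangentSpace 𝓘(ℝ, EP) (σ x))).1 hz
  obtain ⟨r, rfl⟩ :=
    (Submodule.mem_span_singleton (R := ℝ) (M := TangentSpace 𝓘(ℝ, EP) (σ x))).1 hX
  obtain ⟨ys, hys⟩ := hdom 1 ws fun t ht V hV => by
    rw [one_mul]; exact hs2 t ht (σ x) ws hws V hV
  obtain ⟨yu, hyu⟩ := hdom (-1) wu fun t ht V hV => by
    rw [neg_one_mul]; exact hu2 t ht (σ x) wu hwu V hV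
  -- the generator
  obtain ⟨yX, hyX⟩ : ∃ y, modelDeriv EN EP σ x y = modelGenerator EP Φ (σ x) := by
    have hx0 : φ' 0 x = x := φ'.map_zero_apply x
    have d1 : MDifferentiableAt 𝓘(ℝ, ℝ) 𝓘(ℝ, EN) (fun t => φ' t x) 0 :=
      hd.mdifferentiableAt_lift (φ'.continuous continuous_id continuous_const).continuousAt (by
        simp only [hφ']
        exact hφ.mdifferentiableAt_time 0 (q x))
    refine ⟨modelDeriv ℝ EN (fun t => φ' t x) 0 1, ?_⟩
    have h2 := modelDeriv_comp_apply (g := σ) (f := fun t => φ' t x) (0 : ℝ)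
      (h.mdifferentiableAt _) d1 1
    rw [hx0] at h2
    rw [← h2, modelGenerator]
    simp only [h.flow_eq]
  refine ⟨ys + yu + r • yX, ?_⟩
  rw [map_add, map_add, map_smul, hys, hyu, hyX]
  rfl

/-- The image of the differential of a developing section is the dynamical horizontal distribution. -/
theorem IsDevelopingSection.mem_horizontal_iff [CompactSpace N] [ConnectedSpace N]
    [LieGroup 𝓘(ℝ, EG) ∞ G]
    (h : B.IsDevelopingSection q Φ φ' σ) (hq : IsUniversalCovering (EN := EN) q)
    (hφ : IsSmoothFlow (E := EN) φ) (hΦ : B.IsPrincipalExtension φ Φ)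
    (hφ' : ∀ t x, q (φ' t x) = φ t (q x))
    {ℍ : ∀ u : P, Submodule ℝ (TangentSpace 𝓘(ℝ, EP) u)} (hℍ : B.IsDynamicalHorizontal Φ ℍ)
    {Θ : LieAlgForm EG EP P} (hΘ : B.IsFormOf ℍ Θ) (x : N') (w : EP) :
    w ∈ ℍ (σ x) ↔ ∃ y, modelDeriv EN EP σ x y = w := by
  refine ⟨h.exists_modelDeriv_eq hq hφ hΦ hφ' hℍ x, ?_⟩
  rintro ⟨y, rfl⟩
  obtain ⟨w, hw, hw0⟩ := hΘ.exists_horizontal (σ x)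
    (modelDeriv EP EN B.proj (σ x) (modelDeriv EN EP σ x y))
  have hwH := (B.form_eq_zero_iff hℍ hΘ (σ x) w).1 hw0
  obtain ⟨y', hy'⟩ := h.exists_modelDeriv_eq hq hφ hΦ hφ' hℍ x hwH
  have : modelDeriv EN EN q x y' = modelDeriv EN EN q x y := by
    rw [← h.modelDeriv_proj, ← h.modelDeriv_proj, hy']
    exact hw
  rw [← (hq.isLocalDiffeomorph.bijective_modelDeriv x).1 this, hy']
  exact hwH

/-- The developing sections of a flat flow are integral manifolds of the horizontal distribution. -/
theorem IsDevelopingSection.exists_integral_manifold [CompactSpace N] [ConnectedSpace N]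
    [FiniteDimensional ℝ EN] [IsManifold 𝓘(ℝ, EN) ∞ N'] [LieGroup 𝓘(ℝ, EG) ∞ G]
    (h : B.IsDevelopingSection q Φ φ' σ) (hq : IsUniversalCovering (EN := EN) q)
    (hφ : IsSmoothFlow (E := EN) φ) (hΦ : B.IsPrincipalExtension φ Φ)
    (hφ' : ∀ t x, q (φ' t x) = φ t (q x))
    {ℍ : ∀ u : P, Submodule ℝ (TangentSpace 𝓘(ℝ, EP) u)} (hℍ : B.IsDynamicalHorizontal Φ ℍ)
    {Θ : LieAlgForm EG EP P} (hΘ : B.IsFormOf ℍ Θ) (x : N') :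
    ∃ (k : ℕ) (W : Set (EuclideanSpace ℝ (Fin k))) (f : EuclideanSpace ℝ (Fin k) → P),
      IsOpen W ∧ 0 ∈ W ∧ f 0 = σ x ∧
      ContMDiffOn 𝓘(ℝ, EuclideanSpace ℝ (Fin k)) 𝓘(ℝ, EP) 1 f W ∧
      ∀ w ∈ W,
        Function.Injective (mfderiv 𝓘(ℝ, EuclideanSpace ℝ (Fin k)) 𝓘(ℝ, EP) f w) ∧
        (mfderiv 𝓘(ℝ, EuclideanSpace ℝ (Fin k)) 𝓘(ℝ, EP) f w).range = ℍ (f w) := by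
  let e : EuclideanSpace ℝ (Fin (Module.finrank ℝ EN)) ≃L[ℝ] EN :=
    ContinuousLinearEquiv.ofFinrankEq (by simp)
  set F := EuclideanSpace ℝ (Fin (Module.finrank ℝ EN))
  set c := extChartAt 𝓘(ℝ, EN) x
  let j : F → EN := fun w => c x + e w
  have hj : ContDiff ℝ ∞ j := contDiff_const.add e.contDiff
  have hjd : ∀ w, HasFDerivAt j (e : F →L[ℝ] EN) w := fun w => e.hasFDerivAt.const_add (c x)
  have hopen : IsOpen c.target := isOpen_extChartAt_target x
  have hj0 : j 0 = c x := by simp only [j, map_zero, add_zero]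
  refine ⟨Module.finrank ℝ EN, j ⁻¹' c.target, fun w => σ (c.symm (j w)),
    hopen.preimage hj.continuous, ?_, ?_, ?_, fun w hw => ?_⟩
  · change j 0 ∈ c.target
    rw [hj0]; exact mem_extChartAt_target x
  · change σ (c.symm (j 0)) = σ x
    rw [hj0, extChartAt_to_inv]
  · have h1 : ContMDiffOn 𝓘(ℝ, EN) 𝓘(ℝ, EN) 1 c.symm c.target := contMDiffOn_extChartAt_symm x
    exact h.contMDiff.comp_contMDiffOn
      (h1.comp (contMDiff_iff_contDiff.2 (hj.of_le (by norm_cast))).contMDiffOn fun w hw => hw)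
  · have dj : MDifferentiableAt 𝓘(ℝ, F) 𝓘(ℝ, EN) j w :=
      mdifferentiableAt_iff_differentiableAt.2 (hjd w).differentiableAt
    have dc : MDifferentiableAt 𝓘(ℝ, EN) 𝓘(ℝ, EN) c.symm (j w) :=
      mdifferentiableAt_extChartAt_symm' hw
    have hder : ∀ v, modelDeriv F EP (fun w => σ (c.symm (j w))) w v =
        modelDeriv EN EP σ (c.symm (j w)) (modelDeriv EN EN c.symm (j w) (e v)) := by
      intro v
      rw [modelDeriv_comp_apply (g := σ) (f := fun w => c.symm (j w)) w (h.mdifferentiableAt _)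
        (dc.comp w dj), modelDeriv_comp_apply (g := c.symm) w dc dj, modelDeriv_eq_fderiv,
        (hjd w).fderiv]
      rfl
    have hcinj : ∀ y, modelDeriv EN EN c (c.symm (j w)) (modelDeriv EN EN c.symm (j w) y) = y :=
      modelDeriv_extChartAt_symm hw
    have hcsurj : ∀ y, modelDeriv EN EN c.symm (j w) (modelDeriv EN EN c (c.symm (j w)) y) = y := by
      intro y
      have := modelDeriv_symm_extChartAt (c.map_target hw) y
      rwa [c.right_inv hw] at this
    have hinj : ∀ v v', modelDeriv F EP (fun w => σ (c.symm (j w))) w v =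
        modelDeriv F EP (fun w => σ (c.symm (j w))) w v' → v = v' := by
      intro v v' hvv
      rw [hder, hder] at hvv
      have h2 := congrArg (modelDeriv EP EN B.proj (σ (c.symm (j w)))) hvv
      rw [h.modelDeriv_proj, h.modelDeriv_proj] at h2
      have h3 := (hq.isLocalDiffeomorph.bijective_modelDeriv _).1 h2
      have h4 := congrArg (modelDeriv EN EN c (c.symm (j w))) h3
      rw [hcinj, hcinj] at h4
      exact e.injective h4
    have hrange : ∀ z : EP, (∃ v, modelDeriv F EP (fun w => σ (c.symm (j w))) w v = z) ↔
        z ∈ ℍ (σ (c.symm (j w))) := by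
      intro z
      rw [h.mem_horizontal_iff hq hφ hΦ hφ' hℍ hΘ]
      constructor
      · rintro ⟨v, rfl⟩
        exact ⟨_, (hder v).symm⟩
      · rintro ⟨y, rfl⟩
        refine ⟨e.symm (modelDeriv EN EN c (c.symm (j w)) y), ?_⟩
        rw [hder, e.apply_symm_apply, hcsurj]
    exact ⟨fun v v' => hinj v v', Submodule.ext fun z => hrange z⟩

end SmoothPrincipalBundle

end FlatImpliesIntegrable

end

theorem mainTheorem10
    {EN : Type*} [NormedAddCommGroup EN] [NormedSpace ℝ EN] [FiniteDimensional ℝ EN]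
    {EG : Type*} [NormedAddCommGroup EG] [NormedSpace ℝ EG] [FiniteDimensional ℝ EG]
    {EP : Type*} [NormedAddCommGroup EP] [NormedSpace ℝ EP] [FiniteDimensional ℝ EP]
    {N : Type*} [TopologicalSpace N] [ChartedSpace EN N] [IsManifold 𝓘(ℝ, EN) ∞ N]
    [T2Space N] [CompactSpace N] [ConnectedSpace N]
    {G : Type*} [TopologicalSpace G] [ChartedSpace EG G] [Group G] [LieGroup 𝓘(ℝ, EG) ∞ G]
    [T2Space G]
    {P : Type*} [TopologicalSpace P] [ChartedSpace EP P] [IsManifold 𝓘(ℝ, EP) ∞ P]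
    [T2Space P]
    {N' : Type*} [TopologicalSpace N'] [ChartedSpace EN N'] [IsManifold 𝓘(ℝ, EN) ∞ N']
    (q : N' → N) (hq : IsUniversalCovering (EN := EN) q)
    (B : SmoothPrincipalBundle EN EG EP N G P)
    (φ : Flow ℝ N) (hφ : IsAnosov (E := EN) φ)
    (Φ : Flow ℝ P) (hΦ : B.IsPrincipalExtension φ Φ)
    (ℍ : ∀ u : P, Submodule ℝ (TangentSpace 𝓘(ℝ, EP) u)) (hℍ : B.IsDynamicalHorizontal Φ ℍ)
    (Θ : SmoothPrincipalBundle.LieAlgForm EG EP P) (hΘ : B.IsFormOf ℍ Θ)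
    (hΘ1 : SmoothPrincipalBundle.IsC1Form Θ) :
    List.TFAE [
      IsIntegrableDistribution ℍ,
      ∀ u (y z : TangentSpace 𝓘(ℝ, EN) (B.proj u)), B.curvature Θ u y z = 0,
      B.IsFlatFlow q φ Φ] := by
  have hφ' : IsSmoothFlow (E := EN) φ := hφ.1
  have hker := B.form_eq_zero_iff hℍ hΘ
  have hB : B.HasInvariantKernel Θ := fun a u v hv =>
    (hker _ _).2 (B.act_mem_horizontal hφ' hΦ hℍ a u ((hker u v).1 hv))
  have hX : ∀ u, modelForm Θ u (modelGenerator EP Φ u) = 0 := fun u => by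
    obtain ⟨Es, Eu, -, hH⟩ := hℍ
    refine hΘ.1 u _ ?_
    rw [hH]
    exact Submodule.mem_sup_right (Submodule.mem_span_singleton_self (flowGenerator Φ u))
  tfae_have 1 → 2 := fun hint => hΘ.curvature_eq_zero_iff.2 fun u v w hv hw =>
    B.extDerivOneForm_eq_zero_of_integrable hΘ hker hΘ1 hint u v w hv hw
  tfae_have 2 → 3 := fun hcurv => SmoothPrincipalBundle.isFlatFlow_of_isHorizontalSection hq hΦ hΘ hB hX
    (B.exists_isHorizontalSection hΘ hΘ1 (hΘ.curvature_eq_zero_iff.1 hcurv))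
  tfae_have 3 → 1 := by
    intro hflat
    obtain ⟨φ', σ, hφ'q, hσ, hsurj⟩ := hflat.exists_isDevelopingSection
    intro u
    obtain ⟨x, a, rfl⟩ := hsurj u
    exact (hσ.act hΦ a).exists_integral_manifold hq hφ' hΦ hφ'q hℍ hΘ x
  tfae_finish
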